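/- **Setting.** A ball $|x|<R$ (the inhomogeneity; shear modulus $\mu_I>0$, Poisson's ratio $-1<\nu_I<\tfrac12$) is embedded in the infinite matrix $|x|>R$ ($\mu>0$, $-1<\nu<\tfrac12$); both are linearly elastic and isotropic. Let $K=\tfrac23\mu\frac{1+\nu}{1-2\nu}$ and $K_I=\tfrac23\mu_I\frac{1+\nu_I}{1-2\nu_I}$ be the bulk moduli. The interface $r=R$ is of complete Gurtin–Murdoch type with real parameters $\mu_0,\lambda_0$ (surface elasticity) and $\sigma_0$ (surface tension). Put $$\eta_0=\frac{2\mu_0+2\lambda_0+\sigma_0}{R},\qquad \Delta=4\mu+3K_I+2\eta_0,\qquad A=-\frac{2}{\Delta}.$$ A *solution* with far-field stress $\sigma^\infty$ is a pair of displacement fields, $C^2$ up to the interface in $|x|\le R$ and in $|x|\ge R$ respectively, such that $\operatorname{div}\sigma=0$ in each phase, the displacement is continuous across $r=R$, $\sigma\to\sigma^\infty$ as $|x|\to\infty$, and on $r=R$ (for $0<\theta<\pi$; a comma denotes differentiation) $$\sigma_{rr}^{inh}-\sigma_{rr}^{mat}=\tfrac{1}{r\sin\theta}\left[T_{\varphi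 r,\varphi}+T_{\theta r}\cos\theta+(T_{\theta r,\theta}-T_{\varphi\varphi}-T_{\theta\theta})\sin\theta\right],$$ $$\sigma_{r\theta}^{inh}-\sigma_{r\theta}^{mat}=\tfrac{1}{r\sin\theta}\left[T_{\varphi\theta,\varphi}+(T_{\theta\theta,\theta}+T_{\theta r})\sin\theta+(T_{\theta\theta}-T_{\varphi\varphi})\cos\theta\right],$$ $$\sigma_{r\varphi}^{inh}-\sigma_{r\varphi}^{mat}=\tfrac{1}{r\sin\theta}\left[T_{\varphi\varphi,\varphi}+(T_{\theta\varphi,\theta}+T_{\varphi r})\sin\theta+(T_{\varphi\theta}+T_{\theta\varphi})\cos\theta\right],$$ where, with $h_\varphi=u_{\varphi,\varphi}+u_\theta\cos\theta+u_r\sin\theta$ and $h_\theta=u_{\theta,\theta}+u_r$, $$T_{\theta\theta}=\sigma_0+\tfrac{\lambda_0+\sigma_0}{r\sin\theta}h_\varphi+\tfrac{\lambda_0+2\mu_0}{r}h_\theta,\qquad T_{\varphi\varphi}=\sigma_0+\tfrac{\lambda_0+2\mu_0}{r\sin\theta}h_\varphi+\tfrac{\lambda_0+\sigma_0}{r}h_\theta,$$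 $$T_{\varphi\theta}=\tfrac{1}{r\sin\theta}\left[\mu_0(u_{\theta,\varphi}-u_\varphi\cos\theta)+(\mu_0-\sigma_0)u_{\varphi,\theta}\sin\theta\right],$$ $$T_{\theta\varphi}=\tfrac{1}{r\sin\theta}\left[(\mu_0-\sigma_0)(u_{\theta,\varphi}-u_\varphi\cos\theta)+\mu_0u_{\varphi,\theta}\sin\theta\right],$$ $$T_{\theta r}=\tfrac{\sigma_0}{r}(u_{r,\theta}-u_\theta),\qquad T_{\varphi r}=\tfrac{\sigma_0}{r\sin\theta}(u_{r,\varphi}-u_\varphi\sin\theta).$$ A solution is *regular at infinity* if $u=Ex+O(|x|^{-1})$ and $\nabla u=E+O(|x|^{-2})$, where $E$ is the strain of the matrix material under $\sigma^\infty$. The *Christensen–Lo field* $u^{C-L}$ with coefficients $A_1,A_2,D_1,D_3,D_4$ is $$u_r=U_r(r)\sin^2\theta\cos2\varphi,\quad u_\theta=U_\theta(r)\sin\theta\cos\theta\cos2\varphi,\quad u_\varphi=-U_\theta(r)\sin\theta\sin2\varphi,$$ with $U_r=A_1r-\frac{6\nu_I}{1-2\nu_I}A_2r^3$, $U_\theta=A_1r-\frac{7-4\nu_I}{1-2\nu_I}A_2r^3$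 for $r\le R$ and $U_r=D_1r+\frac{3D_3}{r^4}+\frac{5-4\nu}{1-2\nu}\frac{D_4}{r^2}$, $U_\theta=D_1r-\frac{2D_3}{r^4}+\frac{2D_4}{r^2}$ for $r\ge R$. Let $(\mathrm S)$ be the following linear system for $A_1,A_2,D_3,D_4$ with datum $D_1$, where $P=A_1-R^2\frac{7-4\nu_I}{1-2\nu_I}A_2$ and $Q=A_1-R^2\frac{6\nu_I}{1-2\nu_I}A_2$: $$D_1-\tfrac{2}{R^5}D_3+\tfrac{2}{R^3}D_4=P,\qquad D_1+\tfrac{3}{R^5}D_3+\tfrac1{R^3}\tfrac{5-4\nu}{1-2\nu}D_4=Q,$$ $$D_1+\tfrac{2}{R^3}\left(\tfrac{4}{R^2}D_3+\tfrac{1+\nu}{1-2\nu}D_4\right)=\tfrac{\mu_I}{\mu}\left(A_1-R^2\tfrac{7+2\nu_I}{1-2\nu_I}A_2\right)-6f_1,$$ $$D_1+\tfrac{2}{R^3}\left(-\tfrac{6}{R^2}D_3+\tfrac{\nu-5}{1-2\nu}D_4\right)=\tfrac{\mu_I}{\mu}\left(A_1+R^2\tfrac{3\nu_I}{1-2\nu_I}A_2\right)-3f_2,$$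 $$f_1=\tfrac{(\mu_0-\sigma_0)-3(\lambda_0+2\mu_0)}{6\mu R}P+\tfrac{\lambda_0+\mu_0+\sigma_0}{3\mu R}Q,\qquad f_2=\tfrac{\lambda_0+\mu_0+\sigma_0}{\mu R}P-\tfrac{2(\lambda_0+\mu_0+2\sigma_0)}{3\mu R}Q.$$ **Theorem.** In 1, 2 and 4 assume $\Delta\ne0$. 1. (*Simple shear*, the only nonzero far-field stresses being $\sigma^\infty_{11}=-\sigma^\infty_{22}=\sigma_d$.) Let a solution have the components of $u^{C-L}$, for some coefficients, except for an additional term in $u_r$, namely $-rA_0$ in the inhomogeneity and $-D_0/r^2$ in the matrix. Then $D_1=\frac{\sigma_d}{2\mu}$, $A_0=\frac{D_0}{R^3}=\frac{2\sigma_0/R}{\Delta}$, the system $(\mathrm S)$ holds, and hence $$u_r=u_r^{C-L}+A\sigma_0\left(\frac rR\right)^p,\qquad u_\theta=u_\theta^{C-L},\qquad u_\varphi=u_\varphi^{C-L},\tag{$*$}$$ with $p=1$ in the inhomogeneity and $p=-2$ in the matrix. 2. Conversely, for all coefficients satisfying $(\mathrm S)$ with $D_1=\frac{\sigma_d}{2\mu}$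 the field $(*)$ is a solution under simple shear, regular at infinity. 3. If $(\mathrm S)$ with $D_1=0$ has only the zero solution, then for every $\sigma_d$ the system $(\mathrm S)$ with $D_1=\frac{\sigma_d}{2\mu}$ has exactly one solution $(A_1,A_2,D_3,D_4)$. 4. (*Hydrostatic load*, $\sigma^\infty=\sigma_h I$.) Every solution with $u_\theta=u_\varphi=0$ and $u_r$ depending on $r$ only is given by $u_r=F_1r$ in the inhomogeneity and $u_r=F_2r+F_3/r^2$ in the matrix, where $$F_1=\frac{\left[1+\frac{4\mu}{3K}\right]\sigma_h-\frac{2\sigma_0}{R}}{\Delta},\quad F_2=\frac{\sigma_h}{3K},\quad F_3=R^3\,\frac{\sigma_h\left[\left(1-\frac{K_I}{K}\right)-\frac{2\eta_0}{3K}\right]-\frac{2\sigma_0}{R}}{\Delta},$$ and this field is a solution, regular at infinity. 5. If the surface energy is nonnegative, that is, $0\le\sigma_0\le2\mu_0$ and $2\mu_0+2\lambda_0+\sigma_0\ge0$, then $\Delta>0$, the hypothesis of 3 holds, and every solution that is regular at infinity is the one above: under simple shear it is $(*)$ with $D_1=\frac{\sigma_d}{2\mu}$ and the coefficients given by $(\mathrm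 S)$, and under hydrostatic load it is the field of 4. -/

import Mathlib

open Real Filter Topology Asymptotics
open scoped InnerProductSpace

noncomputable section

namespace SphInh

/-- Physical space with its Euclidean norm. -/
abbrev E3 : Type := EuclideanSpace ℝ (Fin 3)

/-! ### Isotropic linear elasticity -/

/-- First Lamé parameter in terms of shear modulus and Poisson's ratio. -/
def lame (μ ν : ℝ) : ℝ := 2 * μ * ν / (1 - 2 * ν)

/-- Three-dimensional bulk modulus. -/
def bulk (μ ν : ℝ) : ℝ := 2 / 3 * μ * (1 + ν) / (1 - 2 * ν)

/-- The Cartesian partial derivative `∂ u_i / ∂ x_j`. -/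
def partialD (u : E3 → E3) (i j : Fin 3) (x : E3) : ℝ :=
  (fderiv ℝ u x (EuclideanSpace.single j 1)) i

/-- Infinitesimal strain tensor. -/
def strain (u : E3 → E3) (x : E3) : Matrix (Fin 3) (Fin 3) ℝ :=
  fun i j => (partialD u i j x + partialD u j i x) / 2

/-- Cauchy stress tensor given by Hooke's law. -/
def stress (μ ν : ℝ) (u : E3 → E3) (x : E3) : Matrix (Fin 3) (Fin 3) ℝ :=
  (lame μ ν * (strain u x).trace) • (1 : Matrix (Fin 3) (Fin 3) ℝ) + (2 * μ) • strain u x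

/-- The equilibrium (Lamé) equation `div σ(u) = 0` at the point `x`, without body forces. -/
def EquilibriumAt (μ ν : ℝ) (u : E3 → E3) (x : E3) : Prop :=
  ∀ i : Fin 3,
    ∑ j : Fin 3, fderiv ℝ (fun y => stress μ ν u y i j) x (EuclideanSpace.single j 1) = 0

/-! ### Spherical coordinates -/

/-- Radial unit vector. -/
def eR (θ φ : ℝ) : E3 := !₂[sin θ * cos φ, sin θ * sin φ, cos θ]

/-- Polar unit vector. -/
def eT (θ φ : ℝ) : E3 := !₂[cos θ * cos φ, cos θ * sin φ, -sin θ]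

/-- Azimuthal unit vector. -/
def eP (φ : ℝ) : E3 := !₂[-sin φ, cos φ, 0]

/-- The component `u_r` at the point with spherical coordinates `(r, θ, φ)`. -/
def uR (u : E3 → E3) (r θ φ : ℝ) : ℝ := ⟪u (r • eR θ φ), eR θ φ⟫_ℝ

/-- The component `u_θ` at the point with spherical coordinates `(r, θ, φ)`. -/
def uT (u : E3 → E3) (r θ φ : ℝ) : ℝ := ⟪u (r • eR θ φ), eT θ φ⟫_ℝ

/-- The component `u_φ` at the point with spherical coordinates `(r, θ, φ)`. -/
def uP (u : E3 → E3) (r θ φ : ℝ) : ℝ := ⟪u (r • eR θ φ), eP φ⟫_ℝ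

/-- The component `a · S n` of a second-order tensor `S`. -/
def comp (S : Matrix (Fin 3) (Fin 3) ℝ) (a n : E3) : ℝ :=
  ∑ i : Fin 3, ∑ j : Fin 3, a i * S i j * n j

/-! ### The composite and its interface -/

/-- Radius of the inhomogeneity, moduli of the matrix (`μ`, `ν`) and of the inhomogeneity
(`μI`, `νI`), surface elastic moduli `μ0`, `l0` (the surface Lamé parameter `λ₀`) and surface
tension `s0` (that is, `σ₀`). -/
structure Composite where
  R : ℝ
  μ : ℝ
  ν : ℝ
  μI : ℝ
  νI : ℝ
  μ0 : ℝ
  l0 : ℝ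
  s0 : ℝ

/-- The standing assumptions: positive radius and positive definite bulk elastic energies.
Nothing is assumed on the surface parameters. -/
structure Composite.Admissible (c : Composite) : Prop where
  R_pos : 0 < c.R
  μ_pos : 0 < c.μ
  ν_gt : -1 < c.ν
  ν_lt : c.ν < 1 / 2
  μI_pos : 0 < c.μI
  νI_gt : -1 < c.νI
  νI_lt : c.νI < 1 / 2

namespace Composite

variable (c : Composite)

/-- Bulk modulus of the matrix. -/
def K : ℝ := bulk c.μ c.ν

/-- Bulk modulus of the inhomogeneity. -/
def KI : ℝ := bulk c.μI c.νI

/-- `η₀ = (2 μ₀ + 2 λ₀ + σ₀) / R`. -/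
def eta0 : ℝ := (2 * c.μ0 + 2 * c.l0 + c.s0) / c.R

/-- `4 μ + 3 K_I + 2 η₀`. -/
def denom : ℝ := 4 * c.μ + 3 * c.KI + 2 * c.eta0

/-! Components of the surface stress tensor on the sphere `r = R`. They only involve the values
of `u` on that sphere. -/

/-- `u_{φ,φ} + u_θ cos θ + u_r sin θ` on the interface. -/
def hoopP (u : E3 → E3) (θ φ : ℝ) : ℝ :=
  deriv (fun t => uP u c.R θ t) φ + uT u c.R θ φ * cos θ + uR u c.R θ φ * sin θ

/-- `u_{θ,θ} + u_r` on the interface. -/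
def hoopT (u : E3 → E3) (θ φ : ℝ) : ℝ :=
  deriv (fun t => uT u c.R t φ) θ + uR u c.R θ φ

/-- `T_{θθ}`. -/
def Ttt (u : E3 → E3) (θ φ : ℝ) : ℝ :=
  c.s0 + (c.l0 + c.s0) / (c.R * sin θ) * c.hoopP u θ φ
    + (c.l0 + 2 * c.μ0) / c.R * c.hoopT u θ φ

/-- `T_{φφ}`. -/
def Tpp (u : E3 → E3) (θ φ : ℝ) : ℝ :=
  c.s0 + (c.l0 + 2 * c.μ0) / (c.R * sin θ) * c.hoopP u θ φ
    + (c.l0 + c.s0) / c.R * c.hoopT u θ φ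

/-- `T_{φθ}`. -/
def Tpt (u : E3 → E3) (θ φ : ℝ) : ℝ :=
  1 / (c.R * sin θ) *
    (c.μ0 * (deriv (fun t => uT u c.R θ t) φ - uP u c.R θ φ * cos θ)
      + (c.μ0 - c.s0) * deriv (fun t => uP u c.R t φ) θ * sin θ)

/-- `T_{θφ}`. -/
def Ttp (u : E3 → E3) (θ φ : ℝ) : ℝ :=
  1 / (c.R * sin θ) *
    ((c.μ0 - c.s0) * (deriv (fun t => uT u c.R θ t) φ - uP u c.R θ φ * cos θ)
      + c.μ0 * deriv (fun t => uP u c.R t φ) θ * sin θ)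

/-- `T_{θr}`. -/
def Ttr (u : E3 → E3) (θ φ : ℝ) : ℝ :=
  c.s0 / c.R * (deriv (fun t => uR u c.R t φ) θ - uT u c.R θ φ)

/-- `T_{φr}`. -/
def Tpr (u : E3 → E3) (θ φ : ℝ) : ℝ :=
  c.s0 / (c.R * sin θ) * (deriv (fun t => uR u c.R θ t) φ - uP u c.R θ φ * sin θ)

/-- Radial traction jump prescribed by the interface. -/
def jumpR (u : E3 → E3) (θ φ : ℝ) : ℝ :=
  1 / (c.R * sin θ) *
    (deriv (fun t => c.Tpr u θ t) φ + c.Ttr u θ φ * cos θ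
      + (deriv (fun t => c.Ttr u t φ) θ - c.Tpp u θ φ - c.Ttt u θ φ) * sin θ)

/-- Polar traction jump prescribed by the interface. -/
def jumpT (u : E3 → E3) (θ φ : ℝ) : ℝ :=
  1 / (c.R * sin θ) *
    (deriv (fun t => c.Tpt u θ t) φ
      + (deriv (fun t => c.Ttt u t φ) θ + c.Ttr u θ φ) * sin θ
      + (c.Ttt u θ φ - c.Tpp u θ φ) * cos θ)

/-- Azimuthal traction jump prescribed by the interface. -/
def jumpP (u : E3 → E3) (θ φ : ℝ) : ℝ :=
  1 / (c.R * sin θ) *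
    (deriv (fun t => c.Tpp u θ t) φ
      + (deriv (fun t => c.Ttp u t φ) θ + c.Tpr u θ φ) * sin θ
      + (c.Tpt u θ φ + c.Ttp u θ φ) * cos θ)

/-- `(uI, uM)` solves the inhomogeneity problem with complete Gurtin–Murdoch interface and
uniform far-field stress `S`. Here `uI` is the displacement in the closed ball `‖x‖ ≤ R` and
`uM` the displacement in the closed exterior `R ≤ ‖x‖`; each is of class `C²` up to the
interface. Since the displacement is continuous across the interface, the surface stresses may
be computed from `uI`. -/
structure IsSolution (S : Matrix (Fin 3) (Fin 3) ℝ) (uI uM : E3 → E3) : Prop where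
  smoothI : ∀ x : E3, ‖x‖ ≤ c.R → ContDiffAt ℝ 2 uI x
  smoothM : ∀ x : E3, c.R ≤ ‖x‖ → ContDiffAt ℝ 2 uM x
  equilibriumI : ∀ x : E3, ‖x‖ < c.R → EquilibriumAt c.μI c.νI uI x
  equilibriumM : ∀ x : E3, c.R < ‖x‖ → EquilibriumAt c.μ c.ν uM x
  continuity : ∀ x : E3, ‖x‖ = c.R → uI x = uM x
  tractionR : ∀ θ φ : ℝ, 0 < θ → θ < π →
    comp (stress c.μI c.νI uI (c.R • eR θ φ)) (eR θ φ) (eR θ φ)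
      - comp (stress c.μ c.ν uM (c.R • eR θ φ)) (eR θ φ) (eR θ φ) = c.jumpR uI θ φ
  tractionT : ∀ θ φ : ℝ, 0 < θ → θ < π →
    comp (stress c.μI c.νI uI (c.R • eR θ φ)) (eT θ φ) (eR θ φ)
      - comp (stress c.μ c.ν uM (c.R • eR θ φ)) (eT θ φ) (eR θ φ) = c.jumpT uI θ φ
  tractionP : ∀ θ φ : ℝ, 0 < θ → θ < π →
    comp (stress c.μI c.νI uI (c.R • eR θ φ)) (eP φ) (eR θ φ)
      - comp (stress c.μ c.ν uM (c.R • eR θ φ)) (eP φ) (eR θ φ) = c.jumpP uI θ φ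
  farField : Tendsto (fun x : E3 => stress c.μ c.ν uM x) (Bornology.cobounded E3) (𝓝 S)

/-- The uniform strain of the matrix material under the stress `S` (inverse Hooke's law). -/
def farStrain (S : Matrix (Fin 3) (Fin 3) ℝ) : Matrix (Fin 3) (Fin 3) ℝ :=
  (1 / (2 * c.μ)) • (S - (c.ν / (1 + c.ν) * S.trace) • (1 : Matrix (Fin 3) (Fin 3) ℝ))

/-- The usual regularity at infinity: with `E` the far-field strain,
`u(x) = E x + O(|x|⁻¹)` and `∇u(x) = E + O(|x|⁻²)`. -/
structure RegularAtInfinity (S : Matrix (Fin 3) (Fin 3) ℝ) (uM : E3 → E3) : Prop where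
  displacement :
    (fun x : E3 => uM x - WithLp.toLp 2 ((c.farStrain S).mulVec x.ofLp))
      =O[Bornology.cobounded E3] (fun x : E3 => ‖x‖⁻¹)
  gradient : ∀ i j : Fin 3,
    (fun x : E3 => partialD uM i j x - c.farStrain S i j)
      =O[Bornology.cobounded E3] (fun x : E3 => (‖x‖ ^ 2)⁻¹)

/-- The surface elastic energy density is nonnegative. -/
structure SurfaceNonneg : Prop where
  tension : 0 ≤ c.s0
  shear : c.s0 ≤ 2 * c.μ0
  area : 0 ≤ 2 * c.μ0 + 2 * c.l0 + c.s0

/-! ### Christensen–Lo profiles -/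

/-- `U_r` inside the inhomogeneity. -/
def UrInh (A1 A2 r : ℝ) : ℝ := A1 * r - 6 * c.νI / (1 - 2 * c.νI) * A2 * r ^ 3

/-- `U_θ` inside the inhomogeneity. -/
def UtInh (A1 A2 r : ℝ) : ℝ := A1 * r - (7 - 4 * c.νI) / (1 - 2 * c.νI) * A2 * r ^ 3

/-- `U_r` in the matrix. -/
def UrMat (D1 D3 D4 r : ℝ) : ℝ :=
  D1 * r + 3 * D3 / r ^ 4 + (5 - 4 * c.ν) / (1 - 2 * c.ν) * (D4 / r ^ 2)

/-- `U_θ` in the matrix. -/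
def UtMat (D1 D3 D4 r : ℝ) : ℝ := D1 * r - 2 * D3 / r ^ 4 + 2 * (D4 / r ^ 2)

/-- The displacement has the spherical components
`u_r = a(r) + U_r(r) sin²θ cos 2φ`, `u_θ = U_θ(r) sin θ cos θ cos 2φ`,
`u_φ = - U_θ(r) sin θ sin 2φ`, where `U_r`, `U_θ` are the Christensen–Lo profiles of the
respective phase and the additional radial term `a` is `aI` in the inhomogeneity and `aM` in the
matrix. -/
structure HasShearForm (aI aM : ℝ → ℝ) (A1 A2 D1 D3 D4 : ℝ) (uI uM : E3 → E3) : Prop where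
  inhR : ∀ r θ φ : ℝ, 0 ≤ r → r ≤ c.R →
    uR uI r θ φ = aI r + c.UrInh A1 A2 r * sin θ ^ 2 * cos (2 * φ)
  inhT : ∀ r θ φ : ℝ, 0 ≤ r → r ≤ c.R →
    uT uI r θ φ = c.UtInh A1 A2 r * sin θ * cos θ * cos (2 * φ)
  inhP : ∀ r θ φ : ℝ, 0 ≤ r → r ≤ c.R →
    uP uI r θ φ = -(c.UtInh A1 A2 r * sin θ * sin (2 * φ))
  matR : ∀ r θ φ : ℝ, c.R ≤ r →
    uR uM r θ φ = aM r + c.UrMat D1 D3 D4 r * sin θ ^ 2 * cos (2 * φ)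
  matT : ∀ r θ φ : ℝ, c.R ≤ r →
    uT uM r θ φ = UtMat D1 D3 D4 r * sin θ * cos θ * cos (2 * φ)
  matP : ∀ r θ φ : ℝ, c.R ≤ r →
    uP uM r θ φ = -(UtMat D1 D3 D4 r * sin θ * sin (2 * φ))

/-- The coefficient `A = -2 / (4 μ + 3 K_I + 2 η₀)` of the additional radial term. -/
def A : ℝ := -2 / c.denom

/-- The modified Christensen–Lo representation: the additional radial term is
`A σ₀ (r / R) ^ p` with `p = 1` in the inhomogeneity and `p = -2` in the matrix. -/
def HasModifiedForm (A1 A2 D1 D3 D4 : ℝ) (uI uM : E3 → E3) : Prop :=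
  c.HasShearForm (fun r => c.A * c.s0 * (r / c.R) ^ (1 : ℤ))
    (fun r => c.A * c.s0 * (r / c.R) ^ (-2 : ℤ)) A1 A2 D1 D3 D4 uI uM

/-- `A₁ - R² (7 - 4 ν_I)/(1 - 2 ν_I) A₂`, which is `U_θ(R) / R`. -/
def tipT (A1 A2 : ℝ) : ℝ := A1 - c.R ^ 2 * ((7 - 4 * c.νI) / (1 - 2 * c.νI)) * A2

/-- `A₁ - R² 6 ν_I/(1 - 2 ν_I) A₂`, which is `U_r(R) / R`. -/
def tipR (A1 A2 : ℝ) : ℝ := A1 - c.R ^ 2 * (6 * c.νI / (1 - 2 * c.νI)) * A2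

/-- Interface contribution to the tangential traction balance. -/
def f1 (A1 A2 : ℝ) : ℝ :=
  ((c.μ0 - c.s0) - 3 * (c.l0 + 2 * c.μ0)) / (6 * c.μ * c.R) * c.tipT A1 A2
    + (c.l0 + c.μ0 + c.s0) / (3 * c.μ * c.R) * c.tipR A1 A2

/-- Interface contribution to the radial traction balance. -/
def f2 (A1 A2 : ℝ) : ℝ :=
  (c.l0 + c.μ0 + c.s0) / (c.μ * c.R) * c.tipT A1 A2
    - 2 * ((c.l0 + c.μ0 + 2 * c.s0) / (3 * c.μ * c.R)) * c.tipR A1 A2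

/-- The linear system for the four coefficients `A₁, A₂, D₃, D₄`: continuity of the tangential
and radial displacements, balance of the tangential and radial tractions. -/
structure ShearSystem (D1 A1 A2 D3 D4 : ℝ) : Prop where
  contT : D1 - 2 / c.R ^ 5 * D3 + 2 / c.R ^ 3 * D4 = c.tipT A1 A2
  contR : D1 + 3 / c.R ^ 5 * D3 + 1 / c.R ^ 3 * ((5 - 4 * c.ν) / (1 - 2 * c.ν)) * D4
    = c.tipR A1 A2
  tracT : D1 + 2 / c.R ^ 3 * (4 / c.R ^ 2 * D3 + (1 + c.ν) / (1 - 2 * c.ν) * D4)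
    = c.μI / c.μ * (A1 - c.R ^ 2 * ((7 + 2 * c.νI) / (1 - 2 * c.νI)) * A2) - 6 * c.f1 A1 A2
  tracR : D1 + 2 / c.R ^ 3 * (-6 / c.R ^ 2 * D3 + (c.ν - 5) / (1 - 2 * c.ν) * D4)
    = c.μI / c.μ * (A1 + c.R ^ 2 * (3 * c.νI / (1 - 2 * c.νI)) * A2) - 3 * c.f2 A1 A2

/-- The matrix of the linear system is nonsingular: the homogeneous system has only the trivial
solution. -/
def Nonsingular : Prop :=
  ∀ A1 A2 D3 D4 : ℝ, c.ShearSystem 0 A1 A2 D3 D4 → A1 = 0 ∧ A2 = 0 ∧ D3 = 0 ∧ D4 = 0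

/-! ### Hydrostatic load -/

/-- The displacement is purely radial, with `u_r = f(r)` in the inhomogeneity and `u_r = g(r)` in
the matrix. -/
structure HasRadialForm (f g : ℝ → ℝ) (uI uM : E3 → E3) : Prop where
  inhR : ∀ r θ φ : ℝ, 0 ≤ r → r ≤ c.R → uR uI r θ φ = f r
  inhT : ∀ r θ φ : ℝ, 0 ≤ r → r ≤ c.R → uT uI r θ φ = 0
  inhP : ∀ r θ φ : ℝ, 0 ≤ r → r ≤ c.R → uP uI r θ φ = 0
  matR : ∀ r θ φ : ℝ, c.R ≤ r → uR uM r θ φ = g r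
  matT : ∀ r θ φ : ℝ, c.R ≤ r → uT uM r θ φ = 0
  matP : ∀ r θ φ : ℝ, c.R ≤ r → uP uM r θ φ = 0

/-- `F₁`. -/
def F1 (sh : ℝ) : ℝ := ((1 + 4 * c.μ / (3 * c.K)) * sh - 2 * c.s0 / c.R) / c.denom

/-- `F₂`. -/
def F2 (sh : ℝ) : ℝ := sh / (3 * c.K)

/-- `F₃`. -/
def F3 (sh : ℝ) : ℝ :=
  c.R ^ 3 * ((sh * ((1 - c.KI / c.K) - 2 * c.eta0 / (3 * c.K)) - 2 * c.s0 / c.R) / c.denom)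

/-- `u_r = F₁ r` in the inhomogeneity, `u_r = F₂ r + F₃ / r²` in the matrix, and
`u_θ = u_φ = 0`. -/
def HasHydrostaticForm (sh : ℝ) (uI uM : E3 → E3) : Prop :=
  c.HasRadialForm (fun r => c.F1 sh * r) (fun r => c.F2 sh * r + c.F3 sh / r ^ 2) uI uM

end Composite

/-- Simple shear: the only nonzero stresses are `σ₁₁ = -σ₂₂ = sd`. -/
def shearStress (sd : ℝ) : Matrix (Fin 3) (Fin 3) ℝ := !![sd, 0, 0; 0, -sd, 0; 0, 0, 0]

/-- Hydrostatic stress: `σ₁₁ = σ₂₂ = σ₃₃ = sh`, the other components vanish. -/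
def hydroStress (sh : ℝ) : Matrix (Fin 3) (Fin 3) ℝ := !![sh, 0, 0; 0, sh, 0; 0, 0, sh]

end SphInh

end

noncomputable section

namespace SphInh

open MeasureTheory

/-! ### Spherical frame -/

/-! Put q = x₁² − x₂². In Cartesian form the Christensen–Lo displacement is α q x + β (x₁, −x₂, 0)
with α, β depending on |x| only, and the additional radial term contributes γ x. On this class
(`field`) everything is explicit. The stress is a tensor `tens`, whose traction on a sphere has the
angular dependence 1 and sin²θ cos 2φ in the normal component, and sin θ cos θ cos 2φ, −sin θ sin 2φ
with a common coefficient in the tangential ones. The surface operator preserves this angular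
dependence (`jumpR_of_form`, `jumpT_of_form`, `jumpP_of_form`). So the interface conditions are
equivalent to finitely many scalar equations, `CoefficientSystem`, which decouple. The part constant
in the angles involves the radial term alone; it is the only one in which the surface tension acts
as a load, and its elimination has the determinant Δ (`radial_coefficients_iff`). The rest is the
system (S).

Read in one direction (`isSolution_of_system`) this constructs solutions; read in the other
(`system_of_isSolution`), with the equations evaluated at a few angles, it determines the
coefficients. Under hydrostatic load the profile is not prescribed: for u = k(|x|) x equilibrium is
the Euler equation t k'' + 4 k' = 0, so k = a + b t⁻³ (`radial_equilibrium`), and b = 0 in the ball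
by continuity at the centre. Since (S) is a square linear system, uniqueness for zero datum gives
unique solvability for every datum.

Uniqueness among all regular solutions (`solution_unique`) is an energy argument for the difference
w of two solutions. In each phase div(σ(w) w) is twice the elastic energy density. Across the
interface the flux of σ(w) w changes by a surface integral which, by the divergence theorem on the
sphere, is a quadratic surface energy; this is nonnegative under the stated inequalities
(`surfPower_sub_nonneg`). At infinity the flux tends to zero, as σ(w) w = O(|x|⁻³). Hence the bulk
energies vanish, w has no strain, and such a field is zero if it becomes small along rays
(`eq_zero_of_strain_eq_zero`): outside because of the decay, inside because w vanishes on the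
interface. The same uniqueness makes the homogeneous system (S) nonsingular (`nonsingular`). -/

theorem e3_sum_single (v : E3) : v = ∑ j : Fin 3, v j • EuclideanSpace.single j (1 : ℝ) := by
  ext i
  fin_cases i <;> simp [Fin.sum_univ_three]

theorem e3_inner (v w : E3) : ⟪v, w⟫_ℝ = v 0 * w 0 + v 1 * w 1 + v 2 * w 2 := by
  simp [PiLp.inner_apply, Fin.sum_univ_three, mul_comm]

theorem e3_norm_sq (x : E3) : ‖x‖ ^ 2 = x 0 ^ 2 + x 1 ^ 2 + x 2 ^ 2 := by
  rw [← real_inner_self_eq_norm_sq, e3_inner]; ring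

@[simp] theorem eR_zero (θ φ : ℝ) : eR θ φ 0 = sin θ * cos φ := rfl
@[simp] theorem eR_one (θ φ : ℝ) : eR θ φ 1 = sin θ * sin φ := rfl
@[simp] theorem eR_two (θ φ : ℝ) : eR θ φ 2 = cos θ := rfl
@[simp] theorem eT_zero (θ φ : ℝ) : eT θ φ 0 = cos θ * cos φ := rfl
@[simp] theorem eT_one (θ φ : ℝ) : eT θ φ 1 = cos θ * sin φ := rfl
@[simp] theorem eT_two (θ φ : ℝ) : eT θ φ 2 = -sin θ := rfl
@[simp] theorem eP_zero (φ : ℝ) : eP φ 0 = -sin φ := rfl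
@[simp] theorem eP_one (φ : ℝ) : eP φ 1 = cos φ := rfl
@[simp] theorem eP_two (φ : ℝ) : eP φ 2 = 0 := rfl

theorem norm_eR (θ φ : ℝ) : ‖eR θ φ‖ = 1 := by
  have h : ‖eR θ φ‖ ^ 2 = 1 := by
    rw [e3_norm_sq]
    simp only [eR_zero, eR_one, eR_two]
    linear_combination sin θ ^ 2 * sin_sq_add_cos_sq φ + sin_sq_add_cos_sq θ
  exact (pow_eq_one_iff_of_nonneg (norm_nonneg _) two_ne_zero).1 h

theorem norm_smul_eR {r : ℝ} (hr : 0 ≤ r) (θ φ : ℝ) : ‖r • eR θ φ‖ = r := by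
  rw [norm_smul, norm_eR, mul_one, Real.norm_of_nonneg hr]

/-- A vector is determined by its components in the spherical frame. -/
theorem eq_of_inner_frame {v w : E3} {θ φ : ℝ} (hR : ⟪v, eR θ φ⟫_ℝ = ⟪w, eR θ φ⟫_ℝ)
    (hT : ⟪v, eT θ φ⟫_ℝ = ⟪w, eT θ φ⟫_ℝ) (hP : ⟪v, eP φ⟫_ℝ = ⟪w, eP φ⟫_ℝ) : v = w := by
  simp only [e3_inner, eR_zero, eR_one, eR_two, eT_zero, eT_one, eT_two, eP_zero, eP_one,
    eP_two] at hR hT hP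
  have h1 := sin_sq_add_cos_sq θ
  have h2 := sin_sq_add_cos_sq φ
  ext i
  fin_cases i
  · change v 0 = w 0
    -- The coefficients of `hR`, `hT`, `hP` expand a Cartesian basis vector in the spherical frame;
    -- the other terms reduce modulo sin² + cos² = 1.
    linear_combination sin θ * cos φ * hR + cos θ * cos φ * hT - sin φ * hP
      - ((v 0 - w 0) * cos φ ^ 2 + (v 1 - w 1) * cos φ * sin φ) * h1 - (v 0 - w 0) * h2
  · change v 1 = w 1
    linear_combination sin θ * sin φ * hR + cos θ * sin φ * hT + cos φ * hP
      - ((v 0 - w 0) * cos φ * sin φ + (v 1 - w 1) * sin φ ^ 2) * h1 - (v 1 - w 1) * h2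
  · change v 2 = w 2
    linear_combination cos θ * hR - sin θ * hT - (v 2 - w 2) * h1

/-- Every point has spherical coordinates. -/
theorem exists_spherical (x : E3) :
    ∃ θ φ : ℝ, 0 ≤ θ ∧ θ ≤ π ∧ 0 ≤ φ ∧ φ ≤ 2 * π ∧ x = ‖x‖ • eR θ φ := by
  rcases eq_or_ne x 0 with rfl | hx
  · exact ⟨0, 0, le_rfl, pi_pos.le, le_rfl, by positivity, by simp⟩
  have hn : 0 < ‖x‖ := norm_pos_iff.2 hx
  have hsq := e3_norm_sq x
  -- The polar angle is arccos (x₃/|x|), and the azimuth is the argument of the complex number x₁ +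
  -- i x₂, whose modulus is |x| sin θ.
  have hle : |x 2 / ‖x‖| ≤ 1 := by
    rw [abs_div, abs_of_pos hn, div_le_one hn]
    exact abs_le_of_sq_le_sq (by nlinarith [sq_nonneg (x 0), sq_nonneg (x 1)]) hn.le
  obtain ⟨hl, hu⟩ := abs_le.1 hle
  have hcos : ‖x‖ * cos (arccos (x 2 / ‖x‖)) = x 2 := by
    rw [cos_arccos hl hu]; field_simp
  set θ := arccos (x 2 / ‖x‖) with hθ
  have hsin : 0 ≤ sin θ := sin_nonneg_of_nonneg_of_le_pi (arccos_nonneg _) (arccos_le_pi _)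
  set z : ℂ := ⟨x 0, x 1⟩ with hz
  have hzn : ‖z‖ = ‖x‖ * sin θ := by
    have h1 : ‖z‖ ^ 2 = x 0 ^ 2 + x 1 ^ 2 := by
      rw [Complex.sq_norm, Complex.normSq_apply]; simp [hz]; ring
    have h2 : ‖z‖ ^ 2 = (‖x‖ * sin θ) ^ 2 := by
      rw [h1]
      linear_combination (-1 : ℝ) * hsq + (x 2 + ‖x‖ * cos θ) * hcos
        - ‖x‖ ^ 2 * sin_sq_add_cos_sq θ
    exact (pow_left_inj₀ (norm_nonneg _) (by positivity) two_ne_zero).1 h2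
  have hz0 : ‖z‖ * cos z.arg = x 0 := by rw [Complex.norm_mul_cos_arg]
  have hz1 : ‖z‖ * sin z.arg = x 1 := by rw [Complex.norm_mul_sin_arg]
  have key : ∀ φ : ℝ, cos φ = cos z.arg → sin φ = sin z.arg → x = ‖x‖ • eR θ φ := by
    intro φ hc hs
    ext i
    fin_cases i
    · change x 0 = ‖x‖ * (sin θ * cos φ)
      rw [hc, ← hz0, hzn]; ring
    · change x 1 = ‖x‖ * (sin θ * sin φ)
      rw [hs, ← hz1, hzn]; ring
    · change x 2 = ‖x‖ * cos θ
      rw [hcos]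
  -- The principal argument lies in (−π, π]; negative values are shifted by 2π into [0, 2π].
  rcases le_or_gt 0 z.arg with h | h
  · exact ⟨θ, z.arg, arccos_nonneg _, arccos_le_pi _, h,
      by linarith [Complex.arg_le_pi z, pi_pos], key _ rfl rfl⟩
  · exact ⟨θ, z.arg + 2 * π, arccos_nonneg _, arccos_le_pi _,
      by linarith [Complex.neg_pi_lt_arg z], by linarith, key _ (cos_add_two_pi _) (sin_add_two_pi _)⟩

theorem uR_eq (u : E3 → E3) (r θ φ : ℝ) : uR u r θ φ =
    u (r • eR θ φ) 0 * (sin θ * cos φ) + u (r • eR θ φ) 1 * (sin θ * sin φ)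
      + u (r • eR θ φ) 2 * cos θ := by
  simp [uR, e3_inner]

theorem uT_eq (u : E3 → E3) (r θ φ : ℝ) : uT u r θ φ =
    u (r • eR θ φ) 0 * (cos θ * cos φ) + u (r • eR θ φ) 1 * (cos θ * sin φ)
      - u (r • eR θ φ) 2 * sin θ := by
  simp [uT, e3_inner]; ring

theorem uP_eq (u : E3 → E3) (r θ φ : ℝ) : uP u r θ φ =
    u (r • eR θ φ) 1 * cos φ - u (r • eR θ φ) 0 * sin φ := by
  simp [uP, e3_inner]; ring

theorem comp_eq (S : Matrix (Fin 3) (Fin 3) ℝ) (a n : E3) : comp S a n =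
    a 0 * S 0 0 * n 0 + a 0 * S 0 1 * n 1 + a 0 * S 0 2 * n 2
    + (a 1 * S 1 0 * n 0 + a 1 * S 1 1 * n 1 + a 1 * S 1 2 * n 2)
    + (a 2 * S 2 0 * n 0 + a 2 * S 2 1 * n 1 + a 2 * S 2 2 * n 2) := by
  simp [comp, Fin.sum_univ_three]

/-! ### Partial derivatives -/

/-- The Cartesian coordinates as continuous linear functionals. -/
def coordL (i : Fin 3) : E3 →L[ℝ] ℝ := EuclideanSpace.proj i

theorem fderiv_apply_eq_sum (u : E3 → E3) (x v : E3) (i : Fin 3) :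
    (fderiv ℝ u x v) i = ∑ j : Fin 3, partialD u i j x * v j := by
  conv_lhs => rw [e3_sum_single v]
  simp [partialD, Fin.sum_univ_three, mul_comm]

theorem hasDerivAt_comp_curve {u : E3 → E3} {c : ℝ → E3} {c' : E3} {t : ℝ}
    (hu : DifferentiableAt ℝ u (c t)) (hc : HasDerivAt c c' t) (i : Fin 3) :
    HasDerivAt (fun s => u (c s) i)
      (partialD u i 0 (c t) * c' 0 + partialD u i 1 (c t) * c' 1 + partialD u i 2 (c t) * c' 2)
      t := by
  have h := hu.hasFDerivAt.comp_hasDerivAt t hc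
  have h2 := (coordL i).hasFDerivAt.comp_hasDerivAt
    t h
  refine h2.congr_deriv ?_
  change (fderiv ℝ u (c t) c') i = _
  rw [fderiv_apply_eq_sum, Fin.sum_univ_three]

theorem contDiffAt_partialD {u : E3 → E3} {x : E3} (hu : ContDiffAt ℝ 2 u x) (i j : Fin 3) :
    ContDiffAt ℝ 1 (partialD u i j) x := by
  have h : ContDiffAt ℝ 1 (fderiv ℝ u) x := hu.fderiv_right (by norm_num)
  have h2 := h.clm_apply (contDiffAt_const (c := EuclideanSpace.single j (1 : ℝ)))
  exact (coordL i).contDiff.contDiffAt.comp x h2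

theorem continuousAt_partialD {u : E3 → E3} {x : E3} (hu : ContDiffAt ℝ 1 u x) (i j : Fin 3) :
    ContinuousAt (partialD u i j) x := by
  have h : ContDiffAt ℝ 0 (fderiv ℝ u) x := hu.fderiv_right (by norm_num)
  have h2 := h.continuousAt.clm_apply
    (continuousAt_const (y := EuclideanSpace.single j (1 : ℝ)))
  exact ((coordL i).continuous.continuousAt).comp h2

theorem contDiffAt_coord {n : WithTop ℕ∞} {u : E3 → E3} {x : E3} (hu : ContDiffAt ℝ n u x)
    (i : Fin 3) : ContDiffAt ℝ n (fun y => u y i) x :=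
  (coordL i).contDiff.contDiffAt.comp x hu

theorem partialD_eq_fderiv_coord {u : E3 → E3} {x : E3} (hu : DifferentiableAt ℝ u x)
    (i j : Fin 3) :
    partialD u i j x = fderiv ℝ (fun y => u y i) x (EuclideanSpace.single j 1) := by
  have h := (coordL i).hasFDerivAt.comp x
    hu.hasFDerivAt
  exact (congrArg (fun L : E3 →L[ℝ] ℝ => L (EuclideanSpace.single j 1)) h.fderiv).symm

theorem partialD_sub {u v : E3 → E3} {x : E3} (hu : DifferentiableAt ℝ u x)
    (hv : DifferentiableAt ℝ v x) (i j : Fin 3) :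
    partialD (fun y => u y - v y) i j x = partialD u i j x - partialD v i j x := by
  have h : fderiv ℝ (fun y => u y - v y) x = fderiv ℝ u x - fderiv ℝ v x := fderiv_fun_sub hu hv
  simp [partialD, h]

theorem hasDerivAt_e3 {f : ℝ → E3} {f' : E3} {t : ℝ}
    (h : ∀ i, HasDerivAt (fun s => f s i) (f' i) t) : HasDerivAt f f' t := by
  have h1 : HasDerivAt (fun s => (f s).ofLp) f'.ofLp t := hasDerivAt_pi.2 h
  exact (EuclideanSpace.equiv (Fin 3) ℝ).symm.toContinuousLinearMap.hasFDerivAt.comp_hasDerivAt t h1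

theorem hasDerivAt_eR_theta (r θ φ : ℝ) :
    HasDerivAt (fun t => r • eR t φ) (r • eT θ φ) θ := by
  refine hasDerivAt_e3 fun i => ?_
  fin_cases i
  · exact ((hasDerivAt_sin θ).mul_const _).const_mul r
  · exact ((hasDerivAt_sin θ).mul_const _).const_mul r
  · exact (hasDerivAt_cos θ).const_mul r

theorem hasDerivAt_eR_phi (r θ φ : ℝ) :
    HasDerivAt (fun t => r • eR θ t) ((r * sin θ) • eP φ) φ := by
  refine hasDerivAt_e3 fun i => ?_
  fin_cases i
  · exact (((hasDerivAt_cos φ).const_mul (sin θ)).const_mul r).congr_deriv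
      (show _ = r * sin θ * (-sin φ) by ring)
  · exact (((hasDerivAt_sin φ).const_mul (sin θ)).const_mul r).congr_deriv
      (show _ = r * sin θ * (cos φ) by ring)
  · exact (hasDerivAt_const φ (r * cos θ)).congr_deriv (show _ = r * sin θ * 0 by ring)

theorem hasDerivAt_smul_eR (r θ φ : ℝ) : HasDerivAt (fun t => t • eR θ φ) (eR θ φ) r := by
  simpa using (hasDerivAt_id r).smul_const (eR θ φ)

/-- The displacement gradient as a matrix. -/
def grad (u : E3 → E3) (x : E3) : Matrix (Fin 3) (Fin 3) ℝ := fun i j => partialD u i j x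

/-- The trace may be computed in any orthonormal basis; this turns a sum of frame components into
the Cartesian divergence. -/
theorem comp_frame_trace (S : Matrix (Fin 3) (Fin 3) ℝ) (θ φ : ℝ) :
    comp S (eR θ φ) (eR θ φ) + comp S (eT θ φ) (eT θ φ) + comp S (eP φ) (eP φ)
      = S 0 0 + S 1 1 + S 2 2 := by
  simp only [comp_eq, eR_zero, eR_one, eR_two, eT_zero, eT_one, eT_two, eP_zero, eP_one, eP_two]
  linear_combination (S 0 0 * cos φ ^ 2 + S 1 1 * sin φ ^ 2 + S 2 2 + S 0 1 * cos φ * sin φ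
    + S 1 0 * cos φ * sin φ) * sin_sq_add_cos_sq θ + (S 0 0 + S 1 1) * sin_sq_add_cos_sq φ

/-! ### Derivatives of the spherical components along the coordinate lines -/

section FrameDerivatives

variable {u : E3 → E3} {r θ φ : ℝ}

theorem hasDerivAt_uR_r (hu : DifferentiableAt ℝ u (r • eR θ φ)) :
    HasDerivAt (fun t => uR u t θ φ)
    (comp (grad u (r • eR θ φ)) (eR θ φ) (eR θ φ)) r := by
  have h := fun i => hasDerivAt_comp_curve hu (hasDerivAt_smul_eR r θ φ) i
  simp only [uR_eq]
  refine ((((h 0).mul_const (sin θ * cos φ)).add ((h 1).mul_const (sin θ * sin φ))).add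
    ((h 2).mul_const (cos θ))).congr_deriv ?_
  simp only [comp_eq, grad, eR_zero, eR_one, eR_two]
  ring

/-- Here and below, the terms without the gradient come from the rotation of the frame: ∂θ eR = eT,
∂θ eT = −eR, ∂φ eR = sin θ eP, ∂φ eT = cos θ eP, ∂φ eP = −sin θ eR − cos θ eT. -/
theorem hasDerivAt_uR_theta (hu : DifferentiableAt ℝ u (r • eR θ φ)) :
    HasDerivAt (fun t => uR u r t φ)
    (r * comp (grad u (r • eR θ φ)) (eR θ φ) (eT θ φ) + uT u r θ φ) θ := by
  have h := fun i => hasDerivAt_comp_curve hu (hasDerivAt_eR_theta r θ φ) i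
  simp only [uR_eq, uT_eq]
  refine ((((h 0).mul ((hasDerivAt_sin θ).mul_const (cos φ))).add
    ((h 1).mul ((hasDerivAt_sin θ).mul_const (sin φ)))).add
    ((h 2).mul (hasDerivAt_cos θ))).congr_deriv ?_
  simp only [comp_eq, grad, eR_zero, eR_one, eR_two, eT_zero, eT_one, eT_two, PiLp.smul_apply,
    smul_eq_mul]
  ring

theorem hasDerivAt_uT_theta (hu : DifferentiableAt ℝ u (r • eR θ φ)) :
    HasDerivAt (fun t => uT u r t φ)
    (r * comp (grad u (r • eR θ φ)) (eT θ φ) (eT θ φ) - uR u r θ φ) θ := by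
  have h := fun i => hasDerivAt_comp_curve hu (hasDerivAt_eR_theta r θ φ) i
  simp only [uR_eq, uT_eq]
  refine ((((h 0).mul ((hasDerivAt_cos θ).mul_const (cos φ))).add
    ((h 1).mul ((hasDerivAt_cos θ).mul_const (sin φ)))).sub
    ((h 2).mul (hasDerivAt_sin θ))).congr_deriv ?_
  simp only [comp_eq, grad, eT_zero, eT_one, eT_two, PiLp.smul_apply, smul_eq_mul]
  ring

theorem hasDerivAt_uP_theta (hu : DifferentiableAt ℝ u (r • eR θ φ)) :
    HasDerivAt (fun t => uP u r t φ)
    (r * comp (grad u (r • eR θ φ)) (eP φ) (eT θ φ)) θ := by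
  have h := fun i => hasDerivAt_comp_curve hu (hasDerivAt_eR_theta r θ φ) i
  simp only [uP_eq]
  refine (((h 1).mul_const (cos φ)).sub ((h 0).mul_const (sin φ))).congr_deriv ?_
  simp only [comp_eq, grad, eT_zero, eT_one, eT_two, eP_zero, eP_one, eP_two, PiLp.smul_apply,
    smul_eq_mul]
  ring

theorem hasDerivAt_uR_phi (hu : DifferentiableAt ℝ u (r • eR θ φ)) :
    HasDerivAt (fun t => uR u r θ t)
    (r * sin θ * comp (grad u (r • eR θ φ)) (eR θ φ) (eP φ) + sin θ * uP u r θ φ) φ := by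
  have h := fun i => hasDerivAt_comp_curve hu (hasDerivAt_eR_phi r θ φ) i
  simp only [uR_eq, uP_eq]
  refine ((((h 0).mul ((hasDerivAt_cos φ).const_mul (sin θ))).add
    ((h 1).mul ((hasDerivAt_sin φ).const_mul (sin θ)))).add
    ((h 2).mul_const (cos θ))).congr_deriv ?_
  simp only [comp_eq, grad, eR_zero, eR_one, eR_two, eP_zero, eP_one, eP_two, PiLp.smul_apply,
    smul_eq_mul]
  ring

theorem hasDerivAt_uT_phi (hu : DifferentiableAt ℝ u (r • eR θ φ)) :
    HasDerivAt (fun t => uT u r θ t)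
    (r * sin θ * comp (grad u (r • eR θ φ)) (eT θ φ) (eP φ) + cos θ * uP u r θ φ) φ := by
  have h := fun i => hasDerivAt_comp_curve hu (hasDerivAt_eR_phi r θ φ) i
  simp only [uT_eq, uP_eq]
  refine ((((h 0).mul ((hasDerivAt_cos φ).const_mul (cos θ))).add
    ((h 1).mul ((hasDerivAt_sin φ).const_mul (cos θ)))).sub
    ((h 2).mul_const (sin θ))).congr_deriv ?_
  simp only [comp_eq, grad, eT_zero, eT_one, eT_two, eP_zero, eP_one, eP_two, PiLp.smul_apply,
    smul_eq_mul]
  ring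

theorem hasDerivAt_uP_phi (hu : DifferentiableAt ℝ u (r • eR θ φ)) :
    HasDerivAt (fun t => uP u r θ t)
    (r * sin θ * comp (grad u (r • eR θ φ)) (eP φ) (eP φ) - cos θ * uT u r θ φ
      - sin θ * uR u r θ φ) φ := by
  have h := fun i => hasDerivAt_comp_curve hu (hasDerivAt_eR_phi r θ φ) i
  simp only [uR_eq, uT_eq, uP_eq]
  refine (((h 1).mul (hasDerivAt_cos φ)).sub ((h 0).mul (hasDerivAt_sin φ))).congr_deriv ?_
  simp only [comp_eq, grad, eP_zero, eP_one, eP_two, PiLp.smul_apply, smul_eq_mul]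
  linear_combination (u (r • eR θ φ) 0 * cos φ + u (r • eR θ φ) 1 * sin φ)
    * sin_sq_add_cos_sq θ

end FrameDerivatives

/-- The map from spherical to Cartesian coordinates. -/
def sph (p : Fin 3 → ℝ) : E3 := p 0 • eR (p 1) (p 2)

theorem contDiff_e3 {E : Type*} [NormedAddCommGroup E] [NormedSpace ℝ E] {n : WithTop ℕ∞}
    {f : E → E3} (h : ∀ i, ContDiff ℝ n fun s => f s i) : ContDiff ℝ n f :=
  (EuclideanSpace.equiv (Fin 3) ℝ).symm.toContinuousLinearMap.contDiff.comp (contDiff_pi.2 h)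

theorem contDiff_sph {n : WithTop ℕ∞} : ContDiff ℝ n sph := by
  refine contDiff_e3 fun i => ?_
  fin_cases i
  · change ContDiff ℝ n fun p : Fin 3 → ℝ => p 0 * (sin (p 1) * cos (p 2))
    fun_prop
  · change ContDiff ℝ n fun p : Fin 3 → ℝ => p 0 * (sin (p 1) * sin (p 2))
    fun_prop
  · change ContDiff ℝ n fun p : Fin 3 → ℝ => p 0 * cos (p 1)
    fun_prop

/-! ### The divergence theorem in spherical coordinates -/

theorem insertNth_zero_three (v : ℝ) (x : Fin 2 → ℝ) :
    (Fin.insertNth (α := fun _ => ℝ) 0 v x : Fin 3 → ℝ) = ![v, x 0, x 1] := by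
  funext i; fin_cases i <;> rfl

theorem insertNth_one_three (v : ℝ) (x : Fin 2 → ℝ) :
    (Fin.insertNth (α := fun _ => ℝ) 1 v x : Fin 3 → ℝ) = ![x 0, v, x 1] := by
  funext i; fin_cases i <;> rfl

theorem insertNth_two_three (v : ℝ) (x : Fin 2 → ℝ) :
    (Fin.insertNth (α := fun _ => ℝ) 2 v x : Fin 3 → ℝ) = ![x 0, x 1, v] := by
  funext i; fin_cases i <;> rfl

theorem insertNth_zero_two (v : ℝ) (x : Fin 1 → ℝ) :
    (Fin.insertNth (α := fun _ => ℝ) 0 v x : Fin 2 → ℝ) = ![v, x 0] := by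
  funext i; fin_cases i <;> rfl

theorem insertNth_one_two (v : ℝ) (x : Fin 1 → ℝ) :
    (Fin.insertNth (α := fun _ => ℝ) 1 v x : Fin 2 → ℝ) = ![x 0, v] := by
  funext i; fin_cases i <;> rfl

/-- The divergence theorem on a box for continuously differentiable functions, with the divergence
given by ordinary derivatives along the coordinate lines. -/
theorem integral_box_divergence {n : ℕ} {a b : Fin (n + 1) → ℝ} (hle : a ≤ b)
    (f : Fin (n + 1) → (Fin (n + 1) → ℝ) → ℝ) (d : Fin (n + 1) → (Fin (n + 1) → ℝ) → ℝ)
    (hf : ∀ i, ∀ x ∈ Set.Icc a b, ContDiffAt ℝ 1 (f i) x)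
    (hd : ∀ x : Fin (n + 1) → ℝ, (∀ i, x i ∈ Set.Ioo (a i) (b i)) →
      ∀ i, HasDerivAt (fun t => f i (Function.update x i t)) (d i x) (x i))
    (D : (Fin (n + 1) → ℝ) → ℝ)
    (hD : ∀ x : Fin (n + 1) → ℝ, (∀ i, x i ∈ Set.Ioo (a i) (b i)) → D x = ∑ i, d i x) :
    ∫ x in Set.Icc a b, D x = ∑ i : Fin (n + 1),
      ((∫ x in Set.Icc (a ∘ i.succAbove) (b ∘ i.succAbove), f i (i.insertNth (b i) x)) -
        ∫ x in Set.Icc (a ∘ i.succAbove) (b ∘ i.succAbove), f i (i.insertNth (a i) x)) := by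
  rw [← integral_divergence_of_hasFDerivAt_off_countable' a b hle f (fun i x => fderiv ℝ (f i) x) ∅
    Set.countable_empty]
  -- The identities for `d` and `D` are assumed in the open box only; its boundary is a null set.
  · rw [volume_pi, ← setIntegral_congr_set Measure.univ_pi_Ioo_ae_eq_Icc,
      ← setIntegral_congr_set Measure.univ_pi_Ioo_ae_eq_Icc]
    refine setIntegral_congr_fun (MeasurableSet.univ_pi fun i => measurableSet_Ioo) fun x hx => ?_
    have hx' : ∀ i, x i ∈ Set.Ioo (a i) (b i) := fun i => hx i (Set.mem_univ i)
    have hxI : x ∈ Set.Icc a b := ⟨fun i => (hx' i).1.le, fun i => (hx' i).2.le⟩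
    change D x = ∑ i, fderiv ℝ (f i) x (Pi.single i 1)
    rw [hD x hx']
    refine Finset.sum_congr rfl fun i _ => ?_
    have h1 : HasFDerivAt (f i) (fderiv ℝ (f i) x) (Function.update x i (x i)) := by
      rw [Function.update_eq_self]
      exact ((hf i x hxI).differentiableAt (by norm_num)).hasFDerivAt
    exact (hd x hx' i).unique (h1.comp_hasDerivAt (x i) (hasDerivAt_update x i (x i)))
  · exact fun i x hx => (hf i x hx).continuousAt.continuousWithinAt
  · intro x hx i
    have hx' : ∀ i, x i ∈ Set.Ioo (a i) (b i) := fun i => hx.1 i (Set.mem_univ i)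
    exact ((hf i x ⟨fun i => (hx' i).1.le, fun i => (hx' i).2.le⟩).differentiableAt
      (by norm_num)).hasFDerivAt
  · refine ContinuousOn.integrableOn_compact isCompact_Icc ?_
    refine continuousOn_finsetSum _ fun i _ x hx => ?_
    have h : ContDiffAt ℝ 0 (fderiv ℝ (f i)) x := (hf i x hx).fderiv_right (by norm_num)
    exact (h.continuousAt.clm_apply continuousAt_const).continuousWithinAt

/-- The coordinate rectangle of the sphere. -/
def angles : Set (Fin 2 → ℝ) := Set.Icc ![0, 0] ![π, 2 * π]

/-- The coordinate box of the spherical shell `a ≤ ‖x‖ ≤ b`. -/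
def shell (a b : ℝ) : Set (Fin 3 → ℝ) := Set.Icc ![a, 0, 0] ![b, π, 2 * π]

/-- Flux of a vector field through the sphere of radius `r`. -/
def flux (V : E3 → E3) (r : ℝ) : ℝ :=
  ∫ p in angles, r ^ 2 * sin (p 0) * uR V r (p 0) (p 1)

theorem mem_shell {a b : ℝ} {p : Fin 3 → ℝ} :
    p ∈ shell a b ↔ (a ≤ p 0 ∧ p 0 ≤ b) ∧ (0 ≤ p 1 ∧ p 1 ≤ π) ∧ (0 ≤ p 2 ∧ p 2 ≤ 2 * π) := by
  simp only [shell, Set.mem_Icc, Pi.le_def, Fin.forall_fin_succ]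
  simp
  tauto

theorem mem_angles {p : Fin 2 → ℝ} :
    p ∈ angles ↔ (0 ≤ p 0 ∧ p 0 ≤ π) ∧ (0 ≤ p 1 ∧ p 1 ≤ 2 * π) := by
  simp only [angles, Set.mem_Icc, Pi.le_def, Fin.forall_fin_succ]
  simp
  tauto

theorem norm_sph {p : Fin 3 → ℝ} (h : 0 ≤ p 0) : ‖sph p‖ = p 0 := norm_smul_eR h _ _

theorem contDiffAt_coord_sph {V : E3 → E3} {n : WithTop ℕ∞} {p : Fin 3 → ℝ}
    (hV : ContDiffAt ℝ n V (sph p)) (i : Fin 3) : ContDiffAt ℝ n (fun q => V (sph q) i) p :=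
  (contDiffAt_coord hV i).comp p contDiff_sph.contDiffAt

/-- The three components of a vector field, multiplied by the factors of the divergence in
spherical coordinates. -/
def sphField (V : E3 → E3) : Fin 3 → (Fin 3 → ℝ) → ℝ :=
  ![fun p => p 0 ^ 2 * sin (p 1) * uR V (p 0) (p 1) (p 2),
    fun p => p 0 * sin (p 1) * uT V (p 0) (p 1) (p 2),
    fun p => p 0 * uP V (p 0) (p 1) (p 2)]

theorem contDiffAt_sphField {V : E3 → E3} {p : Fin 3 → ℝ} (hV : ContDiffAt ℝ 1 V (sph p))
    (i : Fin 3) : ContDiffAt ℝ 1 (sphField V i) p := by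
  have h0 : ContDiffAt ℝ 1 (fun q : Fin 3 → ℝ => V (q 0 • eR (q 1) (q 2)) 0) p :=
    contDiffAt_coord_sph hV 0
  have h1 : ContDiffAt ℝ 1 (fun q : Fin 3 → ℝ => V (q 0 • eR (q 1) (q 2)) 1) p :=
    contDiffAt_coord_sph hV 1
  have h2 : ContDiffAt ℝ 1 (fun q : Fin 3 → ℝ => V (q 0 • eR (q 1) (q 2)) 2) p :=
    contDiffAt_coord_sph hV 2
  fin_cases i
  · simp only [sphField, uR_eq]
    change ContDiffAt ℝ 1 (fun q : Fin 3 → ℝ => q 0 ^ 2 * sin (q 1) *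
      (V (q 0 • eR (q 1) (q 2)) 0 * (sin (q 1) * cos (q 2)) +
        V (q 0 • eR (q 1) (q 2)) 1 * (sin (q 1) * sin (q 2)) +
        V (q 0 • eR (q 1) (q 2)) 2 * cos (q 1))) p
    fun_prop
  · simp only [sphField, uT_eq]
    change ContDiffAt ℝ 1 (fun q : Fin 3 → ℝ => q 0 * sin (q 1) *
      (V (q 0 • eR (q 1) (q 2)) 0 * (cos (q 1) * cos (q 2)) +
        V (q 0 • eR (q 1) (q 2)) 1 * (cos (q 1) * sin (q 2)) -
        V (q 0 • eR (q 1) (q 2)) 2 * sin (q 1))) p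
    fun_prop
  · simp only [sphField, uP_eq]
    change ContDiffAt ℝ 1 (fun q : Fin 3 → ℝ => q 0 *
      (V (q 0 • eR (q 1) (q 2)) 1 * cos (q 2) - V (q 0 • eR (q 1) (q 2)) 0 * sin (q 2))) p
    fun_prop

/-- The derivatives along the coordinate lines of the functions in `sphField`. -/
def sphFieldDeriv (V : E3 → E3) (i : Fin 3) (p : Fin 3 → ℝ) : ℝ :=
  deriv (fun t => sphField V i (Function.update p i t)) (p i)

/-- The derivatives of the factors r² sin θ, r sin θ and r cancel the frame terms, and what remains
is r² sin θ times the trace of the gradient. With these factors nothing is divided by r or sin θ, so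
the centre and the poles need no separate treatment. -/
theorem sphField_divergence {V : E3 → E3} {p : Fin 3 → ℝ} (hV : ContDiffAt ℝ 1 V (sph p)) :
    p 0 ^ 2 * sin (p 1) * (partialD V 0 0 (sph p) + partialD V 1 1 (sph p) + partialD V 2 2 (sph p))
      = ∑ i, sphFieldDeriv V i p := by
  have hV' : DifferentiableAt ℝ V (p 0 • eR (p 1) (p 2)) := hV.differentiableAt (by norm_num)
  have e0 : HasDerivAt (fun t => sphField V 0 (Function.update p 0 t)) _ (p 0) :=
    (((hasDerivAt_id (p 0)).pow 2).mul_const (sin (p 1))).mul (hasDerivAt_uR_r hV')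
  have e1 : HasDerivAt (fun t => sphField V 1 (Function.update p 1 t)) _ (p 1) :=
    ((hasDerivAt_sin (p 1)).const_mul (p 0)).mul (hasDerivAt_uT_theta hV')
  have e2 : HasDerivAt (fun t => sphField V 2 (Function.update p 2 t)) _ (p 2) :=
    (hasDerivAt_uP_phi hV').const_mul (p 0)
  have htr := comp_frame_trace (grad V (sph p)) (p 1) (p 2)
  rw [Fin.sum_univ_three, sphFieldDeriv, sphFieldDeriv, sphFieldDeriv, e0.deriv, e1.deriv, e2.deriv]
  simp only [id, Pi.pow_apply]
  change comp (grad V (p 0 • eR (p 1) (p 2))) _ _ + comp (grad V (p 0 • eR (p 1) (p 2))) _ _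
    + comp (grad V (p 0 • eR (p 1) (p 2))) _ _ = partialD V 0 0 (sph p) + partialD V 1 1 (sph p)
      + partialD V 2 2 (sph p) at htr
  rw [← htr]
  norm_num
  ring

/-- Only two of the six faces of the coordinate box contribute: sin θ = 0 on the polar faces, and
the faces φ = 0 and φ = 2π cancel by periodicity. Inner radius zero is allowed, which covers the
full ball. -/
theorem integral_shell_divergence {V : E3 → E3} {a b : ℝ} (ha : 0 ≤ a) (hab : a ≤ b)
    (hV : ∀ x : E3, a ≤ ‖x‖ → ‖x‖ ≤ b → ContDiffAt ℝ 1 V x) :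
    ∫ p in shell a b, p 0 ^ 2 * sin (p 1) *
      (partialD V 0 0 (sph p) + partialD V 1 1 (sph p) + partialD V 2 2 (sph p))
      = flux V b - flux V a := by
  have hV' : ∀ p ∈ shell a b, ContDiffAt ℝ 1 V (sph p) := by
    intro p hp
    have h := (mem_shell.1 hp).1
    exact hV _ (by rw [norm_sph (ha.trans h.1)]; exact h.1)
      (by rw [norm_sph (ha.trans h.1)]; exact h.2)
  have hle : (![a, 0, 0] : Fin 3 → ℝ) ≤ ![b, π, 2 * π] := by
    intro i
    fin_cases i
    · exact hab
    · exact pi_pos.le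
    · exact two_pi_pos.le
  have key := integral_box_divergence hle (sphField V) (sphFieldDeriv V)
    (fun i x hx => contDiffAt_sphField (hV' x hx) i) ?_ (fun p => p 0 ^ 2 * sin (p 1) *
      (partialD V 0 0 (sph p) + partialD V 1 1 (sph p) + partialD V 2 2 (sph p))) ?_
  · rw [shell, key, Fin.sum_univ_three]
    have t1 : ∀ (v : ℝ) (x : Fin 2 → ℝ), sin v = 0 →
        sphField V 1 (Fin.insertNth (α := fun _ => ℝ) 1 v x) = 0 := by
      intro v x hv
      rw [insertNth_one_three]
      simp [sphField, hv]
    have t2 : ∀ (x : Fin 2 → ℝ), sphField V 2 (Fin.insertNth (α := fun _ => ℝ) 2 (2 * π) x)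
        = sphField V 2 (Fin.insertNth (α := fun _ => ℝ) 2 0 x) := by
      intro x
      rw [insertNth_two_three, insertNth_two_three]
      simp [sphField, uP_eq, eR]
    have t0 : ∀ (v : ℝ) (x : Fin 2 → ℝ), sphField V 0 (Fin.insertNth (α := fun _ => ℝ) 0 v x)
        = v ^ 2 * sin (x 0) * uR V v (x 0) (x 1) := by
      intro v x
      rw [insertNth_zero_three]
      simp [sphField]
    have i1 : ∀ v : ℝ, (![v, 0, 0] : Fin 3 → ℝ) ∘ Fin.succAbove 0 = ![0, 0] := by
      intro v; funext i; fin_cases i <;> rfl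
    have i2 : ∀ v : ℝ, (![v, π, 2 * π] : Fin 3 → ℝ) ∘ Fin.succAbove 0 = ![π, 2 * π] := by
      intro v; funext i; fin_cases i <;> rfl
    have z1 : (![a, 0, 0] : Fin 3 → ℝ) 1 = 0 := rfl
    have z2 : (![b, π, 2 * π] : Fin 3 → ℝ) 1 = π := rfl
    have z3 : (![a, 0, 0] : Fin 3 → ℝ) 2 = 0 := rfl
    have z4 : (![b, π, 2 * π] : Fin 3 → ℝ) 2 = 2 * π := rfl
    have z5 : (![a, 0, 0] : Fin 3 → ℝ) 0 = a := rfl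
    have z6 : (![b, π, 2 * π] : Fin 3 → ℝ) 0 = b := rfl
    simp only [z1, z2, z3, z4, z5, z6, t1 0 _ sin_zero, t1 π _ sin_pi, t2, t0, i1, i2, sub_self,
      add_zero]
    rfl
  · intro p hp i
    have hpI : p ∈ shell a b := ⟨fun i => (hp i).1.le, fun i => (hp i).2.le⟩
    have h1 : DifferentiableAt ℝ (sphField V i) (Function.update p i (p i)) := by
      rw [Function.update_eq_self]
      exact (contDiffAt_sphField (hV' p hpI) i).differentiableAt (by norm_num)
    exact (h1.hasFDerivAt.comp_hasDerivAt (p i)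
      (hasDerivAt_update p i (p i))).differentiableAt.hasDerivAt
  · intro p hp
    exact sphField_divergence (hV' p ⟨fun i => (hp i).1.le, fun i => (hp i).2.le⟩)

/-- The divergence theorem on the sphere in the coordinates `(θ, φ)`: there is no boundary term. -/
theorem integral_sphere_divergence (F G : (Fin 2 → ℝ) → ℝ) (hF : ContDiff ℝ 1 F)
    (hG : ContDiff ℝ 1 G) (hF0 : ∀ φ, F ![0, φ] = 0) (hFπ : ∀ φ, F ![π, φ] = 0)
    (hG2 : ∀ θ, G ![θ, 2 * π] = G ![θ, 0]) (D : (Fin 2 → ℝ) → ℝ)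
    (hD : ∀ θ φ : ℝ, 0 < θ → θ < π → D ![θ, φ] =
      deriv (fun t => F ![t, φ]) θ + deriv (fun t => G ![θ, t]) φ) :
    ∫ p in angles, D p = 0 := by
  have hle : (![0, 0] : Fin 2 → ℝ) ≤ ![π, 2 * π] := by
    intro i
    fin_cases i
    · exact pi_pos.le
    · exact two_pi_pos.le
  have vec : ∀ p : Fin 2 → ℝ, p = ![p 0, p 1] := by
    intro p; funext i; fin_cases i <;> rfl
  have u0 : ∀ (p : Fin 2 → ℝ) (t : ℝ), Function.update p 0 t = ![t, p 1] := by
    intro p t; funext i; fin_cases i <;> rfl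
  have u1 : ∀ (p : Fin 2 → ℝ) (t : ℝ), Function.update p 1 t = ![p 0, t] := by
    intro p t; funext i; fin_cases i <;> rfl
  have hdiff : ∀ i, ContDiff ℝ 1 ((![F, G] : Fin 2 → (Fin 2 → ℝ) → ℝ) i) := by
    intro i; fin_cases i
    · exact hF
    · exact hG
  have key := integral_box_divergence hle ![F, G]
    (fun i p => deriv (fun t => (![F, G] : Fin 2 → (Fin 2 → ℝ) → ℝ) i (Function.update p i t)) (p i))
    (fun i x _ => (hdiff i).contDiffAt) ?_ D ?_
  · rw [angles, key, Fin.sum_univ_two]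
    have z1 : (![0, 0] : Fin 2 → ℝ) 0 = 0 := rfl
    have z2 : (![π, 2 * π] : Fin 2 → ℝ) 0 = π := rfl
    have z3 : (![0, 0] : Fin 2 → ℝ) 1 = 0 := rfl
    have z4 : (![π, 2 * π] : Fin 2 → ℝ) 1 = 2 * π := rfl
    have z5 : (![F, G] : Fin 2 → (Fin 2 → ℝ) → ℝ) 0 = F := rfl
    have z6 : (![F, G] : Fin 2 → (Fin 2 → ℝ) → ℝ) 1 = G := rfl
    simp only [z1, z2, z3, z4, z5, z6, insertNth_zero_two, insertNth_one_two, hF0, hFπ, hG2,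
      sub_self, add_zero]
  · intro p hp i
    have h1 : DifferentiableAt ℝ ((![F, G] : Fin 2 → (Fin 2 → ℝ) → ℝ) i)
        (Function.update p i (p i)) := (hdiff i).contDiffAt.differentiableAt (by norm_num)
    exact (h1.hasFDerivAt.comp_hasDerivAt (p i)
      (hasDerivAt_update p i (p i))).differentiableAt.hasDerivAt
  · intro p hp
    have h := hD (p 0) (p 1) (hp 0).1 (hp 0).2
    rw [← vec p] at h
    rw [h, Fin.sum_univ_two]
    simp only [u0, u1]
    rfl

/-! ### Stress and bulk energy -/

theorem stress_apply (μ ν : ℝ) (u : E3 → E3) (x : E3) (i j : Fin 3) : stress μ ν u x i j =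
    lame μ ν * (partialD u 0 0 x + partialD u 1 1 x + partialD u 2 2 x)
      * (1 : Matrix (Fin 3) (Fin 3) ℝ) i j + μ * (partialD u i j x + partialD u j i x) := by
  simp only [stress, strain, Matrix.add_apply, Matrix.smul_apply, Matrix.trace, Matrix.diag,
    Fin.sum_univ_three, smul_eq_mul]
  ring

theorem contDiffAt_stress {μ ν : ℝ} {u : E3 → E3} {x : E3} (hu : ContDiffAt ℝ 2 u x)
    (i j : Fin 3) : ContDiffAt ℝ 1 (fun y => stress μ ν u y i j) x := by
  have h := contDiffAt_partialD hu
  simp only [stress_apply]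
  have h0 := h 0 0
  have h1 := h 1 1
  have h2 := h 2 2
  have h3 := h i j
  have h4 := h j i
  fun_prop

theorem stress_sub {μ ν : ℝ} {u v : E3 → E3} {x : E3} (hu : DifferentiableAt ℝ u x)
    (hv : DifferentiableAt ℝ v x) :
    stress μ ν (fun y => u y - v y) x = stress μ ν u x - stress μ ν v x := by
  ext i j
  simp only [Matrix.sub_apply, stress_apply, partialD_sub hu hv]
  ring

theorem eventually_contDiffAt_two {u : E3 → E3} {x : E3} (hu : ContDiffAt ℝ 2 u x) :
    ∀ᶠ y in 𝓝 x, ContDiffAt ℝ 2 u y := hu.eventually (by simp)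

theorem EquilibriumAt.sub {μ ν : ℝ} {u v : E3 → E3} {x : E3} (hu : ContDiffAt ℝ 2 u x)
    (hv : ContDiffAt ℝ 2 v x) (hue : EquilibriumAt μ ν u x) (hve : EquilibriumAt μ ν v x) :
    EquilibriumAt μ ν (fun y => u y - v y) x := by
  intro i
  have h : ∀ j, fderiv ℝ (fun y => stress μ ν (fun y => u y - v y) y i j) x =
      fderiv ℝ (fun y => stress μ ν u y i j) x - fderiv ℝ (fun y => stress μ ν v y i j) x := by
    intro j
    have he : (fun y => stress μ ν (fun y => u y - v y) y i j) =ᶠ[𝓝 x]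
        fun y => stress μ ν u y i j - stress μ ν v y i j := by
      filter_upwards [eventually_contDiffAt_two hu, eventually_contDiffAt_two hv] with y h1 h2
      rw [stress_sub (h1.differentiableAt (by norm_num)) (h2.differentiableAt (by norm_num))]
      rfl
    rw [he.fderiv_eq, fderiv_fun_sub ((contDiffAt_stress hu i j).differentiableAt (by norm_num))
      ((contDiffAt_stress hv i j).differentiableAt (by norm_num))]
  have h1 := hue i
  have h2 := hve i
  simp only [h, sub_apply, Finset.sum_sub_distrib, h1, h2, sub_self]

/-- Twice the elastic energy density. -/
def energy (μ ν : ℝ) (w : E3 → E3) (x : E3) : ℝ :=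
  ∑ i : Fin 3, ∑ j : Fin 3, stress μ ν w x j i * partialD w j i x

/-- Splitting into volumetric and deviatoric parts by λ = K − 2μ/3 makes the energy a sum of squares
with positive coefficients. Both its nonnegativity and the vanishing of the strain at zero energy
are read off from this form. -/
theorem energy_eq {μ ν : ℝ} (hν : 1 - 2 * ν ≠ 0) (w : E3 → E3) (x : E3) :
    energy μ ν w x = bulk μ ν * (strain w x 0 0 + strain w x 1 1 + strain w x 2 2) ^ 2
      + 2 / 3 * μ * ((strain w x 0 0 - strain w x 1 1) ^ 2 + (strain w x 1 1 - strain w x 2 2) ^ 2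
        + (strain w x 2 2 - strain w x 0 0) ^ 2)
      + 4 * μ * (strain w x 0 1 ^ 2 + strain w x 1 2 ^ 2 + strain w x 2 0 ^ 2) := by
  have hl : lame μ ν = bulk μ ν - 2 / 3 * μ := by
    rw [lame, bulk]; field_simp; ring
  simp only [energy, Fin.sum_univ_three, stress_apply, strain, hl]
  simp
  ring

theorem bulk_pos {μ ν : ℝ} (hμ : 0 < μ) (h1 : -1 < ν) (h2 : ν < 1 / 2) : 0 < bulk μ ν := by
  have h3 : 0 < 1 + ν := by linarith
  have h4 : 0 < 1 - 2 * ν := by linarith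
  unfold bulk
  positivity

theorem energy_nonneg {μ ν : ℝ} (hμ : 0 < μ) (h1 : -1 < ν) (h2 : ν < 1 / 2) (w : E3 → E3)
    (x : E3) : 0 ≤ energy μ ν w x := by
  rw [energy_eq (by linarith)]
  have := bulk_pos hμ h1 h2
  positivity

theorem strain_eq_zero_of_energy {μ ν : ℝ} (hμ : 0 < μ) (h1 : -1 < ν) (h2 : ν < 1 / 2)
    {w : E3 → E3} {x : E3} (h : energy μ ν w x = 0) : strain w x = 0 := by
  rw [energy_eq (by linarith)] at h
  have hK := bulk_pos hμ h1 h2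
  have sq3 : ∀ p q r : ℝ, p ^ 2 + q ^ 2 + r ^ 2 = 0 → p = 0 ∧ q = 0 ∧ r = 0 := by
    intro p q r h
    refine ⟨?_, ?_, ?_⟩ <;> refine pow_eq_zero_iff two_ne_zero |>.1 ?_ <;>
      linarith [sq_nonneg p, sq_nonneg q, sq_nonneg r]
  have split : ∀ K m s d t : ℝ, 0 < K → 0 < m → 0 ≤ s → 0 ≤ d → 0 ≤ t →
      K * s + 2 / 3 * m * d + 4 * m * t = 0 → s = 0 ∧ d = 0 ∧ t = 0 := by
    intro K m s d t hK hm hs hd ht h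
    have e1 : 0 ≤ K * s := by positivity
    have e2 : 0 ≤ 2 / 3 * m * d := by positivity
    have e3 : 0 ≤ 4 * m * t := by positivity
    have f1 : K * s = 0 := by linarith
    have f2 : 2 / 3 * m * d = 0 := by linarith
    have f3 : 4 * m * t = 0 := by linarith
    exact ⟨by simpa [hK.ne'] using f1, by simpa [hm.ne'] using f2, by simpa [hm.ne'] using f3⟩
  obtain ⟨g1, g2, g3⟩ := split _ _ _ _ _ hK hμ (sq_nonneg _) (by positivity) (by positivity) h
  have g4 := pow_eq_zero_iff two_ne_zero |>.1 g1
  obtain ⟨p1, p2, -⟩ := sq3 _ _ _ g2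
  obtain ⟨q1, q2, q3⟩ := sq3 _ _ _ g3
  have hsymm : ∀ i j, strain w x i j = strain w x j i := by
    intro i j; simp only [strain]; ring
  ext i j
  fin_cases i <;> fin_cases j <;> simp only [Fin.zero_eta, Fin.mk_one, Fin.reduceFinMk,
    Matrix.zero_apply]
  · linarith
  · exact q1
  · rw [hsymm]; exact q3
  · rw [hsymm]; exact q1
  · linarith
  · exact q2
  · exact q3
  · rw [hsymm]; exact q2
  · linarith

/-- The power vector field `σ(w) w`. -/
def power (μ ν : ℝ) (w : E3 → E3) (x : E3) : E3 :=
  WithLp.toLp 2 fun i => ∑ j : Fin 3, stress μ ν w x j i * w x j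

theorem power_apply (μ ν : ℝ) (w : E3 → E3) (x : E3) (i : Fin 3) :
    power μ ν w x i = ∑ j : Fin 3, stress μ ν w x j i * w x j := rfl

theorem contDiffAt_power {μ ν : ℝ} {w : E3 → E3} {x : E3} (hw : ContDiffAt ℝ 2 w x) :
    ContDiffAt ℝ 1 (power μ ν w) x := by
  have h : ContDiffAt ℝ 1 (fun y => (power μ ν w y).ofLp) x := by
    refine contDiffAt_pi.2 fun i => ?_
    simp only [power_apply]
    exact ContDiffAt.sum fun j _ => (contDiffAt_stress hw j i).mul
      ((contDiffAt_coord hw j).of_le (by norm_num))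
  exact (EuclideanSpace.equiv (Fin 3) ℝ).symm.toContinuousLinearMap.contDiff.contDiffAt.comp x h

/-- The product rule gives w · div σ + σ : ∇w, and equilibrium removes the first term. -/
theorem divergence_power {μ ν : ℝ} {w : E3 → E3} {x : E3} (hw : ContDiffAt ℝ 2 w x)
    (he : EquilibriumAt μ ν w x) :
    partialD (power μ ν w) 0 0 x + partialD (power μ ν w) 1 1 x + partialD (power μ ν w) 2 2 x
      = energy μ ν w x := by
  have hs := fun i j => (contDiffAt_stress (μ := μ) (ν := ν) hw i j).differentiableAt (by norm_num)
  have hc : ∀ j, DifferentiableAt ℝ (fun y => w y j) x := fun j =>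
    (contDiffAt_coord hw j).differentiableAt (by norm_num)
  have hd : ∀ i : Fin 3, partialD (power μ ν w) i i x = ∑ j : Fin 3,
      (w x j * fderiv ℝ (fun y => stress μ ν w y j i) x (EuclideanSpace.single i 1)
        + stress μ ν w x j i * partialD w j i x) := by
    intro i
    rw [partialD_eq_fderiv_coord ((contDiffAt_power hw).differentiableAt (by norm_num))]
    simp only [power_apply]
    rw [fderiv_fun_sum fun j _ => (hs j i).fun_mul (hc j), _root_.sum_apply]
    refine Finset.sum_congr rfl fun j _ => ?_
    rw [fderiv_fun_mul (hs j i) (hc j),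
      partialD_eq_fderiv_coord (hw.differentiableAt (by norm_num))]
    simp
    ring
  have h0 := he 0
  have h1 := he 1
  have h2 := he 2
  simp only [energy, hd, Fin.sum_univ_three] at h0 h1 h2 ⊢
  linear_combination w x 0 * h0 + w x 1 * h1 + w x 2 * h2

/-- The flux density is the work of the traction; resolved in the frame, it is in the form into
which the three interface conditions can be inserted. -/
theorem uR_power (μ ν : ℝ) (w : E3 → E3) (r θ φ : ℝ) : uR (power μ ν w) r θ φ =
    uR w r θ φ * comp (stress μ ν w (r • eR θ φ)) (eR θ φ) (eR θ φ)
      + uT w r θ φ * comp (stress μ ν w (r • eR θ φ)) (eT θ φ) (eR θ φ)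
      + uP w r θ φ * comp (stress μ ν w (r • eR θ φ)) (eP φ) (eR θ φ) := by
  set x := r • eR θ φ with hx
  set S := stress μ ν w x with hS
  have hw : w x = uR w r θ φ • eR θ φ + uT w r θ φ • eT θ φ + uP w r θ φ • eP φ := by
    have h1 := sin_sq_add_cos_sq θ
    have h2 := sin_sq_add_cos_sq φ
    refine eq_of_inner_frame (θ := θ) (φ := φ) ?_ ?_ ?_
    · change uR w r θ φ = _
      simp only [e3_inner, PiLp.add_apply, PiLp.smul_apply, smul_eq_mul, eR_zero, eR_one, eR_two,
        eT_zero, eT_one, eT_two, eP_zero, eP_one, eP_two]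
      linear_combination (-uR w r θ φ - 0) * h1 - (uR w r θ φ * sin θ ^ 2
        + uT w r θ φ * sin θ * cos θ) * h2
    · change uT w r θ φ = _
      simp only [e3_inner, PiLp.add_apply, PiLp.smul_apply, smul_eq_mul, eR_zero, eR_one, eR_two,
        eT_zero, eT_one, eT_two, eP_zero, eP_one, eP_two]
      linear_combination (-uT w r θ φ) * h1 - (uT w r θ φ * cos θ ^ 2
        + uR w r θ φ * sin θ * cos θ) * h2
    · change uP w r θ φ = _
      simp only [e3_inner, PiLp.add_apply, PiLp.smul_apply, smul_eq_mul, eR_zero, eR_one, eR_two,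
        eT_zero, eT_one, eT_two, eP_zero, eP_one, eP_two]
      linear_combination (-uP w r θ φ) * h2
  have h3 := congrArg (fun v : E3 => v 0) hw
  have h4 := congrArg (fun v : E3 => v 1) hw
  have h5 := congrArg (fun v : E3 => v 2) hw
  simp only [PiLp.add_apply, PiLp.smul_apply, smul_eq_mul] at h3 h4 h5
  rw [uR, e3_inner, ← hx]
  simp only [power_apply, Fin.sum_univ_three, comp_eq, ← hS]
  rw [h3, h4, h5]
  ring

/-! ### Infinitesimally rigid displacements -/

/-- A displacement without strain that can be made small along every ray vanishes. -/
theorem eq_zero_of_strain_eq_zero {w : E3 → E3} {U : Set E3} (hU : IsOpen U)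
    (hw : ∀ y ∈ U, DifferentiableAt ℝ w y) (hs : ∀ y ∈ U, strain w y = 0)
    (hray : ∀ y ∈ U, ∀ ε > 0, ∃ t : ℝ, 1 ≤ t ∧ (∀ s ∈ Set.Ico 1 t, s • y ∈ U) ∧
      ContinuousAt w (t • y) ∧ ‖w (t • y)‖ ≤ ε) :
    ∀ y ∈ U, w y = 0 := by
  have skew : ∀ y ∈ U, ∀ i j, partialD w i j y = -partialD w j i y := by
    intro y hy i j
    have h := congrFun (congrFun (hs y hy) i) j
    simp only [strain, Matrix.zero_apply] at h
    linarith
  have hcurve : ∀ (y : E3) (s : ℝ), s • y ∈ U → ∀ i, HasDerivAt (fun s : ℝ => w (s • y) i)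
      (partialD w i 0 (s • y) * y 0 + partialD w i 1 (s • y) * y 1
        + partialD w i 2 (s • y) * y 2) s := by
    intro y s hy i
    refine hasDerivAt_comp_curve (hw _ hy) ?_ i
    simpa using (hasDerivAt_id s).smul_const y
  have hcont : ∀ (y : E3) (s : ℝ), ContinuousAt w (s • y) → ∀ i,
      ContinuousAt (fun s : ℝ => w (s • y) i) s := by
    intro y s h i
    have h1 : ContinuousAt (fun s : ℝ => w (s • y)) s :=
      ContinuousAt.comp (f := fun s : ℝ => s • y) h (by fun_prop)
    exact (coordL i).continuous.continuousAt.comp h1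
  -- The end point of the segment need not lie in `U`: it may be a point of the interface, where
  -- only continuity is used.
  have hcontI : ∀ (y : E3) (t : ℝ), (∀ s ∈ Set.Ico 1 t, s • y ∈ U) → ContinuousAt w (t • y) →
      ∀ s ∈ Set.Icc 1 t, ∀ i, ContinuousAt (fun s : ℝ => w (s • y) i) s := by
    intro y t h1 h2 s hs i
    rcases eq_or_lt_of_le hs.2 with rfl | h
    · exact hcont _ _ h2 i
    · exact hcont _ _ (hw _ (h1 s ⟨hs.1, h⟩)).continuousAt i
  have hcoord : ∀ (v : E3) (i : Fin 3), |v i| ≤ ‖v‖ := fun v i => PiLp.norm_apply_le v i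
  -- The derivative of w(s y) · y in s is the quadratic form of a skew gradient, hence zero. So this
  -- product is constant along the ray, and it is arbitrarily small at the far end.
  have hrad : ∀ y ∈ U, w y 0 * y 0 + w y 1 * y 1 + w y 2 * y 2 = 0 := by
    intro y hy
    refine eq_of_abs_sub_le_all fun δ hδ => ?_
    obtain ⟨t, ht1, htU, htc, hte⟩ := hray y hy (δ / (‖y‖ + 1)) (by positivity)
    have hc := hcontI y t htU htc
    have hconst := constant_of_has_deriv_right_zero
      (f := fun s : ℝ => w (s • y) 0 * y 0 + w (s • y) 1 * y 1 + w (s • y) 2 * y 2)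
      (a := 1) (b := t)
      (fun s hs => (((((hc s hs 0).mul_const _).add ((hc s hs 1).mul_const _)).add
        ((hc s hs 2).mul_const _))).continuousWithinAt)
      (fun s hs => by
        have hd := hcurve y s (htU s hs)
        have sk := skew (s • y) (htU s hs)
        refine (((((hd 0).mul_const (y 0)).add ((hd 1).mul_const (y 1))).add
          ((hd 2).mul_const (y 2))).congr_deriv ?_).hasDerivWithinAt
        linear_combination y 0 ^ 2 / 2 * sk 0 0 + y 1 ^ 2 / 2 * sk 1 1 + y 2 ^ 2 / 2 * sk 2 2
          + y 0 * y 1 * sk 0 1 + y 0 * y 2 * sk 0 2 + y 1 * y 2 * sk 1 2) t ⟨ht1, le_rfl⟩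
    simp only [one_smul] at hconst
    rw [← hconst, sub_zero, ← e3_inner]
    calc |⟪w (t • y), y⟫_ℝ| ≤ ‖w (t • y)‖ * ‖y‖ := abs_real_inner_le_norm _ _
      _ ≤ δ / (‖y‖ + 1) * (‖y‖ + 1) := by gcongr; linarith
      _ = δ := by field_simp
  -- Differentiating w(z) · z = 0 and using skewness once more yields Euler's relation for
  -- homogeneity of degree one. No second derivatives and no connectedness of `U` are needed.
  have heul : ∀ y ∈ U, ∀ j, w y j =
      partialD w j 0 y * y 0 + partialD w j 1 y * y 1 + partialD w j 2 y * y 2 := by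
    intro y hy j
    have h0 : (fun z : E3 => w z 0 * z 0 + w z 1 * z 1 + w z 2 * z 2) =ᶠ[𝓝 y] fun _ => 0 := by
      filter_upwards [hU.mem_nhds hy] with z hz using hrad z hz
    have hwc := hw y hy
    have hcurve2 : HasDerivAt (fun s : ℝ => y + s • EuclideanSpace.single j (1 : ℝ))
        (EuclideanSpace.single j (1 : ℝ)) 0 := by
      simpa using ((hasDerivAt_id (0 : ℝ)).smul_const (EuclideanSpace.single j (1 : ℝ))).const_add y
    have hy0 : y + (0 : ℝ) • EuclideanSpace.single j (1 : ℝ) = y := by simp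
    have hd := fun i => hasDerivAt_comp_curve (u := w) (t := 0)
      (c := fun s : ℝ => y + s • EuclideanSpace.single j (1 : ℝ)) (by simpa using hwc) hcurve2 i
    have hd2 := fun i => hasDerivAt_comp_curve (u := fun z => z) (t := 0)
      (c := fun s : ℝ => y + s • EuclideanSpace.single j (1 : ℝ)) (by fun_prop) hcurve2 i
    have hid : ∀ i k : Fin 3, partialD (fun z => z) i k y = if i = k then 1 else 0 := by
      intro i k
      simp [partialD]
    have hsum := (((hd 0).mul (hd2 0)).add ((hd 1).mul (hd2 1))).add ((hd 2).mul (hd2 2))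
    have hcont2 : Tendsto (fun s : ℝ => y + s • EuclideanSpace.single j (1 : ℝ)) (𝓝 0) (𝓝 y) := by
      have := hcurve2.continuousAt.tendsto
      rwa [hy0] at this
    have hz := hsum.unique ((hasDerivAt_const (0 : ℝ) (0 : ℝ)).congr_of_eventuallyEq
      (hcont2.eventually h0))
    rw [hy0] at hz
    have sk := skew y hy
    simp only [hid] at hz
    fin_cases j <;> simp at hz ⊢ <;>
      linear_combination hz - y 0 * sk _ 0 - y 1 * sk _ 1 - y 2 * sk _ 2
  intro y hy
  ext j
  change w y j = 0
  refine eq_of_abs_sub_le_all fun δ hδ => ?_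
  obtain ⟨t, ht1, htU, htc, hte⟩ := hray y hy δ hδ
  have hc := hcontI y t htU htc
  have ht0 : 0 < t := by linarith
  -- By Euler's relation w(s y)/s is constant along the ray; since t ≥ 1, dividing by t keeps the
  -- value at the far end small.
  have hconst := constant_of_has_deriv_right_zero
    (f := fun s : ℝ => w (s • y) j / s) (a := 1) (b := t)
    (fun s hs => ((hc s hs j).div continuousAt_id (by
      have := hs.1; simp only [id]; linarith)).continuousWithinAt)
    (fun s hs => by
      have hs0 : s ≠ 0 := by have := hs.1; linarith
      refine (((hcurve y s (htU s hs) j).div (hasDerivAt_id s) hs0).congr_deriv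
        ?_).hasDerivWithinAt
      have he := heul (s • y) (htU s hs) j
      simp only [PiLp.smul_apply, smul_eq_mul] at he
      rw [he]
      simp only [id]
      field_simp
      ring) t ⟨ht1, le_rfl⟩
  simp only [one_smul, div_one] at hconst
  rw [← hconst, sub_zero, abs_div, abs_of_pos ht0]
  exact (div_le_self (abs_nonneg _) ht1).trans ((hcoord _ j).trans hte)

/-! ### The surface stress as a contraction of the displacement gradient -/

theorem contDiff_sphere {n : WithTop ℕ∞} (r : ℝ) :
    ContDiff ℝ n fun p : Fin 2 → ℝ => r • eR (p 0) (p 1) := by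
  refine contDiff_e3 fun i => ?_
  fin_cases i
  · change ContDiff ℝ n fun p : Fin 2 → ℝ => r * (sin (p 0) * cos (p 1))
    fun_prop
  · change ContDiff ℝ n fun p : Fin 2 → ℝ => r * (sin (p 0) * sin (p 1))
    fun_prop
  · change ContDiff ℝ n fun p : Fin 2 → ℝ => r * cos (p 0)
    fun_prop

theorem contDiff_comp_sphere {n : WithTop ℕ∞} {r : ℝ} (hr : 0 ≤ r)
    {S : E3 → Matrix (Fin 3) (Fin 3) ℝ}
    (hS : ∀ x : E3, ‖x‖ = r → ∀ i j, ContDiffAt ℝ n (fun y => S y i j) x)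
    {a b : (Fin 2 → ℝ) → E3} (ha : ∀ i, ContDiff ℝ n fun p => a p i)
    (hb : ∀ i, ContDiff ℝ n fun p => b p i) :
    ContDiff ℝ n fun p : Fin 2 → ℝ => comp (S (r • eR (p 0) (p 1))) (a p) (b p) := by
  have h : ∀ i j, ContDiff ℝ n fun p : Fin 2 → ℝ => S (r • eR (p 0) (p 1)) i j := fun i j =>
    contDiff_iff_contDiffAt.2 fun p =>
      (hS _ (norm_smul_eR hr _ _) i j).comp p (contDiff_sphere r).contDiffAt
  simp only [comp]
  exact ContDiff.sum fun i _ => ContDiff.sum fun j _ => ((ha i).mul (h i j)).mul (hb j)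

theorem contDiff_frameR {n : WithTop ℕ∞} (i : Fin 3) :
    ContDiff ℝ n fun p : Fin 2 → ℝ => eR (p 0) (p 1) i := by
  fin_cases i
  · change ContDiff ℝ n fun p : Fin 2 → ℝ => sin (p 0) * cos (p 1)
    fun_prop
  · change ContDiff ℝ n fun p : Fin 2 → ℝ => sin (p 0) * sin (p 1)
    fun_prop
  · change ContDiff ℝ n fun p : Fin 2 → ℝ => cos (p 0)
    fun_prop

theorem contDiff_frameT {n : WithTop ℕ∞} (i : Fin 3) :
    ContDiff ℝ n fun p : Fin 2 → ℝ => eT (p 0) (p 1) i := by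
  fin_cases i
  · change ContDiff ℝ n fun p : Fin 2 → ℝ => cos (p 0) * cos (p 1)
    fun_prop
  · change ContDiff ℝ n fun p : Fin 2 → ℝ => cos (p 0) * sin (p 1)
    fun_prop
  · change ContDiff ℝ n fun p : Fin 2 → ℝ => -sin (p 0)
    fun_prop

theorem contDiff_frameP {n : WithTop ℕ∞} (i : Fin 3) :
    ContDiff ℝ n fun p : Fin 2 → ℝ => eP (p 1) i := by
  fin_cases i
  · change ContDiff ℝ n fun p : Fin 2 → ℝ => -sin (p 1)
    fun_prop
  · change ContDiff ℝ n fun p : Fin 2 → ℝ => cos (p 1)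
    fun_prop
  · change ContDiff ℝ n fun p : Fin 2 → ℝ => 0
    fun_prop

theorem contDiff_uR_sphere {n : WithTop ℕ∞} {u : E3 → E3} {r : ℝ} (hr : 0 ≤ r)
    (hu : ∀ x : E3, ‖x‖ = r → ContDiffAt ℝ n u x) :
    ContDiff ℝ n fun p : Fin 2 → ℝ => uR u r (p 0) (p 1) := by
  have h : ContDiff ℝ n fun p : Fin 2 → ℝ => u (r • eR (p 0) (p 1)) :=
    contDiff_iff_contDiffAt.2 fun p =>
      (hu _ (norm_smul_eR hr _ _)).comp p (contDiff_sphere r).contDiffAt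
  exact h.inner ℝ (contDiff_e3 contDiff_frameR)

theorem contDiff_uT_sphere {n : WithTop ℕ∞} {u : E3 → E3} {r : ℝ} (hr : 0 ≤ r)
    (hu : ∀ x : E3, ‖x‖ = r → ContDiffAt ℝ n u x) :
    ContDiff ℝ n fun p : Fin 2 → ℝ => uT u r (p 0) (p 1) := by
  have h : ContDiff ℝ n fun p : Fin 2 → ℝ => u (r • eR (p 0) (p 1)) :=
    contDiff_iff_contDiffAt.2 fun p =>
      (hu _ (norm_smul_eR hr _ _)).comp p (contDiff_sphere r).contDiffAt
  exact h.inner ℝ (contDiff_e3 contDiff_frameT)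

theorem contDiff_uP_sphere {n : WithTop ℕ∞} {u : E3 → E3} {r : ℝ} (hr : 0 ≤ r)
    (hu : ∀ x : E3, ‖x‖ = r → ContDiffAt ℝ n u x) :
    ContDiff ℝ n fun p : Fin 2 → ℝ => uP u r (p 0) (p 1) := by
  have h : ContDiff ℝ n fun p : Fin 2 → ℝ => u (r • eR (p 0) (p 1)) :=
    contDiff_iff_contDiffAt.2 fun p =>
      (hu _ (norm_smul_eR hr _ _)).comp p (contDiff_sphere r).contDiffAt
  exact h.inner ℝ (contDiff_e3 contDiff_frameP)

namespace Composite

variable (c : Composite)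

/-- The displacement gradient at a point of the interface. -/
def ifGrad (u : E3 → E3) (θ φ : ℝ) : Matrix (Fin 3) (Fin 3) ℝ := grad u (c.R • eR θ φ)

/-- `T_{θθ}` through the displacement gradient. -/
def Mtt (u : E3 → E3) (θ φ : ℝ) : ℝ := c.s0
  + (c.l0 + c.s0) * comp (c.ifGrad u θ φ) (eP φ) (eP φ)
  + (c.l0 + 2 * c.μ0) * comp (c.ifGrad u θ φ) (eT θ φ) (eT θ φ)

/-- `T_{φφ}` through the displacement gradient. -/
def Mpp (u : E3 → E3) (θ φ : ℝ) : ℝ := c.s0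
  + (c.l0 + 2 * c.μ0) * comp (c.ifGrad u θ φ) (eP φ) (eP φ)
  + (c.l0 + c.s0) * comp (c.ifGrad u θ φ) (eT θ φ) (eT θ φ)

/-- `T_{φθ}` through the displacement gradient. -/
def Mpt (u : E3 → E3) (θ φ : ℝ) : ℝ := c.μ0 * comp (c.ifGrad u θ φ) (eT θ φ) (eP φ)
  + (c.μ0 - c.s0) * comp (c.ifGrad u θ φ) (eP φ) (eT θ φ)

/-- `T_{θφ}` through the displacement gradient. -/
def Mtp (u : E3 → E3) (θ φ : ℝ) : ℝ := (c.μ0 - c.s0) * comp (c.ifGrad u θ φ) (eT θ φ) (eP φ)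
  + c.μ0 * comp (c.ifGrad u θ φ) (eP φ) (eT θ φ)

/-- `T_{θr}` through the displacement gradient. -/
def Mtr (u : E3 → E3) (θ φ : ℝ) : ℝ := c.s0 * comp (c.ifGrad u θ φ) (eR θ φ) (eT θ φ)

/-- `T_{φr}` through the displacement gradient. -/
def Mpr (u : E3 → E3) (θ φ : ℝ) : ℝ := c.s0 * comp (c.ifGrad u θ φ) (eR θ φ) (eP φ)

variable {c} {u : E3 → E3}

section Equalities

variable {θ φ : ℝ}

/-- The undifferentiated terms are exactly those produced by the rotation of the frame, so the hoop
strains are components of the gradient. In consequence the surface stresses, written with 1/sin θ,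
agree off the poles with expressions that are smooth on the whole coordinate rectangle, as the
divergence theorem requires. -/
theorem hoopP_eq (hu : DifferentiableAt ℝ u (c.R • eR θ φ)) :
    c.hoopP u θ φ = c.R * sin θ * comp (c.ifGrad u θ φ) (eP φ) (eP φ) := by
  rw [hoopP, (hasDerivAt_uP_phi hu).deriv, ifGrad]; ring

theorem hoopT_eq (hu : DifferentiableAt ℝ u (c.R • eR θ φ)) :
    c.hoopT u θ φ = c.R * comp (c.ifGrad u θ φ) (eT θ φ) (eT θ φ) := by
  rw [hoopT, (hasDerivAt_uT_theta hu).deriv, ifGrad]; ring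

theorem Ttt_eq (hR : c.R ≠ 0) (hu : DifferentiableAt ℝ u (c.R • eR θ φ)) (hθ : sin θ ≠ 0) :
    c.Ttt u θ φ = c.Mtt u θ φ := by
  rw [Ttt, hoopP_eq hu, hoopT_eq hu, Mtt]; field_simp

theorem Tpp_eq (hR : c.R ≠ 0) (hu : DifferentiableAt ℝ u (c.R • eR θ φ)) (hθ : sin θ ≠ 0) :
    c.Tpp u θ φ = c.Mpp u θ φ := by
  rw [Tpp, hoopP_eq hu, hoopT_eq hu, Mpp]; field_simp

theorem Tpt_eq (hR : c.R ≠ 0) (hu : DifferentiableAt ℝ u (c.R • eR θ φ)) (hθ : sin θ ≠ 0) :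
    c.Tpt u θ φ = c.Mpt u θ φ := by
  rw [Tpt, (hasDerivAt_uT_phi hu).deriv, (hasDerivAt_uP_theta hu).deriv, Mpt, ifGrad]
  field_simp
  ring

theorem Ttp_eq (hR : c.R ≠ 0) (hu : DifferentiableAt ℝ u (c.R • eR θ φ)) (hθ : sin θ ≠ 0) :
    c.Ttp u θ φ = c.Mtp u θ φ := by
  rw [Ttp, (hasDerivAt_uT_phi hu).deriv, (hasDerivAt_uP_theta hu).deriv, Mtp, ifGrad]
  field_simp
  ring

theorem Ttr_eq (hR : c.R ≠ 0) (hu : DifferentiableAt ℝ u (c.R • eR θ φ)) :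
    c.Ttr u θ φ = c.Mtr u θ φ := by
  rw [Ttr, (hasDerivAt_uR_theta hu).deriv, Mtr, ifGrad]
  field_simp
  ring

theorem Tpr_eq (hR : c.R ≠ 0) (hu : DifferentiableAt ℝ u (c.R • eR θ φ)) (hθ : sin θ ≠ 0) :
    c.Tpr u θ φ = c.Mpr u θ φ := by
  rw [Tpr, (hasDerivAt_uR_phi hu).deriv, Mpr, ifGrad]
  field_simp
  ring

end Equalities

section Smoothness

theorem contDiff_ifGrad (hR : 0 ≤ c.R) (hu : ∀ x : E3, ‖x‖ = c.R → ContDiffAt ℝ 2 u x)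
    {a b : (Fin 2 → ℝ) → E3} (ha : ∀ i, ContDiff ℝ 1 fun p => a p i)
    (hb : ∀ i, ContDiff ℝ 1 fun p => b p i) :
    ContDiff ℝ 1 fun p : Fin 2 → ℝ => comp (c.ifGrad u (p 0) (p 1)) (a p) (b p) :=
  contDiff_comp_sphere hR (fun x hx i j => contDiffAt_partialD (hu x hx) i j) ha hb

theorem contDiff_Mtt (hR : 0 ≤ c.R) (hu : ∀ x : E3, ‖x‖ = c.R → ContDiffAt ℝ 2 u x) :
    ContDiff ℝ 1 fun p : Fin 2 → ℝ => c.Mtt u (p 0) (p 1) :=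
  (contDiff_const.add (contDiff_const.mul
    (contDiff_ifGrad hR hu contDiff_frameP contDiff_frameP))).add
    (contDiff_const.mul (contDiff_ifGrad hR hu contDiff_frameT contDiff_frameT))

theorem contDiff_Mpp (hR : 0 ≤ c.R) (hu : ∀ x : E3, ‖x‖ = c.R → ContDiffAt ℝ 2 u x) :
    ContDiff ℝ 1 fun p : Fin 2 → ℝ => c.Mpp u (p 0) (p 1) :=
  (contDiff_const.add (contDiff_const.mul
    (contDiff_ifGrad hR hu contDiff_frameP contDiff_frameP))).add
    (contDiff_const.mul (contDiff_ifGrad hR hu contDiff_frameT contDiff_frameT))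

theorem contDiff_Mpt (hR : 0 ≤ c.R) (hu : ∀ x : E3, ‖x‖ = c.R → ContDiffAt ℝ 2 u x) :
    ContDiff ℝ 1 fun p : Fin 2 → ℝ => c.Mpt u (p 0) (p 1) :=
  (contDiff_const.mul (contDiff_ifGrad hR hu contDiff_frameT contDiff_frameP)).add
    (contDiff_const.mul (contDiff_ifGrad hR hu contDiff_frameP contDiff_frameT))

theorem contDiff_Mtp (hR : 0 ≤ c.R) (hu : ∀ x : E3, ‖x‖ = c.R → ContDiffAt ℝ 2 u x) :
    ContDiff ℝ 1 fun p : Fin 2 → ℝ => c.Mtp u (p 0) (p 1) :=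
  (contDiff_const.mul (contDiff_ifGrad hR hu contDiff_frameT contDiff_frameP)).add
    (contDiff_const.mul (contDiff_ifGrad hR hu contDiff_frameP contDiff_frameT))

theorem contDiff_Mtr (hR : 0 ≤ c.R) (hu : ∀ x : E3, ‖x‖ = c.R → ContDiffAt ℝ 2 u x) :
    ContDiff ℝ 1 fun p : Fin 2 → ℝ => c.Mtr u (p 0) (p 1) :=
  contDiff_const.mul (contDiff_ifGrad hR hu contDiff_frameR contDiff_frameT)

theorem contDiff_Mpr (hR : 0 ≤ c.R) (hu : ∀ x : E3, ‖x‖ = c.R → ContDiffAt ℝ 2 u x) :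
    ContDiff ℝ 1 fun p : Fin 2 → ℝ => c.Mpr u (p 0) (p 1) :=
  contDiff_const.mul (contDiff_ifGrad hR hu contDiff_frameR contDiff_frameP)

end Smoothness

/-! ### Power of the interface tractions -/

variable (c) in
/-- The meridional part of the surface power flux. -/
def powerT (u w : E3 → E3) (p : Fin 2 → ℝ) : ℝ := sin (p 0) *
  (uR w c.R (p 0) (p 1) * c.Mtr u (p 0) (p 1) + uT w c.R (p 0) (p 1) * c.Mtt u (p 0) (p 1)
    + uP w c.R (p 0) (p 1) * c.Mtp u (p 0) (p 1))

variable (c) in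
/-- The azimuthal part of the surface power flux. -/
def powerP (u w : E3 → E3) (p : Fin 2 → ℝ) : ℝ :=
  uR w c.R (p 0) (p 1) * c.Mpr u (p 0) (p 1) + uT w c.R (p 0) (p 1) * c.Mpt u (p 0) (p 1)
    + uP w c.R (p 0) (p 1) * c.Mpp u (p 0) (p 1)

variable (c) in
/-- The power of the surface stress of `u` on the surface gradient of `w`. -/
def surfPower (u w : E3 → E3) (θ φ : ℝ) : ℝ :=
  c.Mtt u θ φ * comp (c.ifGrad w θ φ) (eT θ φ) (eT θ φ)
  + c.Mpp u θ φ * comp (c.ifGrad w θ φ) (eP φ) (eP φ)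
  + c.Mpt u θ φ * comp (c.ifGrad w θ φ) (eT θ φ) (eP φ)
  + c.Mtp u θ φ * comp (c.ifGrad w θ φ) (eP φ) (eT θ φ)
  + c.Mtr u θ φ * comp (c.ifGrad w θ φ) (eR θ φ) (eT θ φ)
  + c.Mpr u θ φ * comp (c.ifGrad w θ φ) (eR θ φ) (eP φ)

theorem contDiff_powerT {w : E3 → E3} (hR : 0 ≤ c.R)
    (hu : ∀ x : E3, ‖x‖ = c.R → ContDiffAt ℝ 2 u x)
    (hw : ∀ x : E3, ‖x‖ = c.R → ContDiffAt ℝ 1 w x) : ContDiff ℝ 1 (c.powerT u w) := by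
  have h1 := contDiff_uR_sphere hR hw
  have h2 := contDiff_uT_sphere hR hw
  have h3 := contDiff_uP_sphere hR hw
  have h4 := contDiff_Mtr hR hu
  have h5 := contDiff_Mtt hR hu
  have h6 := contDiff_Mtp hR hu
  unfold powerT
  fun_prop

theorem contDiff_powerP {w : E3 → E3} (hR : 0 ≤ c.R)
    (hu : ∀ x : E3, ‖x‖ = c.R → ContDiffAt ℝ 2 u x)
    (hw : ∀ x : E3, ‖x‖ = c.R → ContDiffAt ℝ 1 w x) : ContDiff ℝ 1 (c.powerP u w) := by
  have h1 := contDiff_uR_sphere hR hw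
  have h2 := contDiff_uT_sphere hR hw
  have h3 := contDiff_uP_sphere hR hw
  have h4 := contDiff_Mpr hR hu
  have h5 := contDiff_Mpt hR hu
  have h6 := contDiff_Mpp hR hu
  unfold powerP
  fun_prop

theorem powerP_periodic (u w : E3 → E3) (θ : ℝ) :
    c.powerP u w ![θ, 2 * π] = c.powerP u w ![θ, 0] := by
  have h1 : eR θ (2 * π) = eR θ 0 := by simp [eR]
  have h2 : eT θ (2 * π) = eT θ 0 := by simp [eT]
  have h3 : eP (2 * π) = eP 0 := by simp [eP]
  simp [powerP, uR, uT, uP, Mpr, Mpt, Mpp, ifGrad, h1, h2, h3]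

theorem differentiableAt_line_theta {f : ℝ → ℝ → ℝ}
    (hf : ContDiff ℝ 1 fun p : Fin 2 → ℝ => f (p 0) (p 1)) (θ φ : ℝ) :
    DifferentiableAt ℝ (fun t => f t φ) θ := by
  have h : ContDiff ℝ 1 fun t : ℝ => (![t, φ] : Fin 2 → ℝ) := by
    refine contDiff_pi.2 fun i => ?_
    fin_cases i
    · exact contDiff_id
    · exact contDiff_const
  exact (hf.comp h).differentiable (by norm_num) θ

theorem differentiableAt_line_phi {f : ℝ → ℝ → ℝ}
    (hf : ContDiff ℝ 1 fun p : Fin 2 → ℝ => f (p 0) (p 1)) (θ φ : ℝ) :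
    DifferentiableAt ℝ (fun t => f θ t) φ := by
  have h : ContDiff ℝ 1 fun t : ℝ => (![θ, t] : Fin 2 → ℝ) := by
    refine contDiff_pi.2 fun i => ?_
    fin_cases i
    · exact contDiff_const
    · exact contDiff_id
  exact (hf.comp h).differentiable (by norm_num) φ

/-- Surface form of the product rule div(Tw) = w · div T + T : ∇w. The jump conditions are the
components of the surface divergence of T, and their curvature terms cancel the frame terms arising
when the components of w are differentiated. -/
theorem surface_power_identity {w : E3 → E3} (hR : 0 < c.R)
    (hu : ∀ x : E3, ‖x‖ = c.R → ContDiffAt ℝ 2 u x)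
    (hw : ∀ x : E3, ‖x‖ = c.R → ContDiffAt ℝ 1 w x) {θ : ℝ} (h0 : 0 < θ) (hπ : θ < π) (φ : ℝ) :
    c.R * sin θ * (uR w c.R θ φ * c.jumpR u θ φ + uT w c.R θ φ * c.jumpT u θ φ
        + uP w c.R θ φ * c.jumpP u θ φ) + c.R * sin θ * c.surfPower u w θ φ =
      deriv (fun t => c.powerT u w ![t, φ]) θ + deriv (fun t => c.powerP u w ![θ, t]) φ := by
  have hsin : sin θ ≠ 0 := (sin_pos_of_pos_of_lt_pi h0 hπ).ne'
  have hud : ∀ θ φ, DifferentiableAt ℝ u (c.R • eR θ φ) := fun θ φ =>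
    (hu _ (norm_smul_eR hR.le _ _)).differentiableAt (by norm_num)
  have hwd : DifferentiableAt ℝ w (c.R • eR θ φ) :=
    (hw _ (norm_smul_eR hR.le _ _)).differentiableAt (by norm_num)
  -- Along a meridian the smooth forms of T_{θθ} and T_{θφ} may be substituted only where sin does
  -- not vanish, so those two derivatives are compared locally.
  have hev : ∀ᶠ t in 𝓝 θ, sin t ≠ 0 := continuous_sin.continuousAt.eventually_ne hsin
  have e1 : deriv (fun t => c.Tpr u θ t) φ = deriv (fun t => c.Mpr u θ t) φ := by
    congr 1; funext t; exact Tpr_eq hR.ne' (hud _ _) hsin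
  have e2 : deriv (fun t => c.Ttr u t φ) θ = deriv (fun t => c.Mtr u t φ) θ := by
    congr 1; funext t; exact Ttr_eq hR.ne' (hud _ _)
  have e3 : deriv (fun t => c.Tpt u θ t) φ = deriv (fun t => c.Mpt u θ t) φ := by
    congr 1; funext t; exact Tpt_eq hR.ne' (hud _ _) hsin
  have e4 : deriv (fun t => c.Ttt u t φ) θ = deriv (fun t => c.Mtt u t φ) θ :=
    EventuallyEq.deriv_eq (hev.mono fun t ht => Ttt_eq hR.ne' (hud _ _) ht)
  have e5 : deriv (fun t => c.Tpp u θ t) φ = deriv (fun t => c.Mpp u θ t) φ := by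
    congr 1; funext t; exact Tpp_eq hR.ne' (hud _ _) hsin
  have e6 : deriv (fun t => c.Ttp u t φ) θ = deriv (fun t => c.Mtp u t φ) θ :=
    EventuallyEq.deriv_eq (hev.mono fun t ht => Ttp_eq hR.ne' (hud _ _) ht)
  have d1 := (differentiableAt_line_phi (contDiff_Mpr hR.le hu) θ φ).hasDerivAt
  have d2 := (differentiableAt_line_theta (contDiff_Mtr hR.le hu) θ φ).hasDerivAt
  have d3 := (differentiableAt_line_phi (contDiff_Mpt hR.le hu) θ φ).hasDerivAt
  have d4 := (differentiableAt_line_theta (contDiff_Mtt hR.le hu) θ φ).hasDerivAt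
  have d5 := (differentiableAt_line_phi (contDiff_Mpp hR.le hu) θ φ).hasDerivAt
  have d6 := (differentiableAt_line_theta (contDiff_Mtp hR.le hu) θ φ).hasDerivAt
  have g1 : HasDerivAt (fun t => c.powerT u w ![t, φ]) _ θ :=
    (hasDerivAt_sin θ).mul ((((hasDerivAt_uR_theta hwd).mul d2).add
      ((hasDerivAt_uT_theta hwd).mul d4)).add ((hasDerivAt_uP_theta hwd).mul d6))
  have g2 : HasDerivAt (fun t => c.powerP u w ![θ, t]) _ φ :=
    (((hasDerivAt_uR_phi hwd).mul d1).add ((hasDerivAt_uT_phi hwd).mul d3)).add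
      ((hasDerivAt_uP_phi hwd).mul d5)
  rw [g1.deriv, g2.deriv, jumpR, jumpT, jumpP, e1, e2, e3, e4, e5, e6, Tpp_eq hR.ne' (hud _ _) hsin,
    Ttt_eq hR.ne' (hud _ _) hsin, Tpr_eq hR.ne' (hud _ _) hsin, Ttr_eq hR.ne' (hud _ _),
    Tpt_eq hR.ne' (hud _ _) hsin, Ttp_eq hR.ne' (hud _ _) hsin, surfPower]
  have hR' := hR.ne'
  have z0 : (![θ, φ] : Fin 2 → ℝ) 0 = θ := rfl
  have z1 : (![θ, φ] : Fin 2 → ℝ) 1 = φ := rfl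
  simp only [ifGrad, z0, z1]
  field_simp
  ring

/-- The quadratic part of the surface energy is nonnegative. -/
theorem surfPower_sub_nonneg (hc : c.SurfaceNonneg) {v w : E3 → E3} {θ φ : ℝ}
    (h : c.ifGrad w θ φ = c.ifGrad u θ φ - c.ifGrad v θ φ) :
    0 ≤ c.surfPower u w θ φ - c.surfPower v w θ φ := by
  have hl : ∀ a b, comp (c.ifGrad w θ φ) a b = comp (c.ifGrad u θ φ) a b
      - comp (c.ifGrad v θ φ) a b := by
    intro a b; rw [h]; simp only [comp_eq, Matrix.sub_apply]; ring
  -- The constant surface tension in T cancels in the difference. The remaining quadratic form is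
  -- diagonal in the trace, the difference of the diagonal entries, the symmetric and the skew
  -- tangential shear and the two normal slopes.
  have key : c.surfPower u w θ φ - c.surfPower v w θ φ =
      (2 * c.μ0 + 2 * c.l0 + c.s0) / 2 * (comp (c.ifGrad w θ φ) (eT θ φ) (eT θ φ)
        + comp (c.ifGrad w θ φ) (eP φ) (eP φ)) ^ 2
      + (2 * c.μ0 - c.s0) / 2 * (comp (c.ifGrad w θ φ) (eT θ φ) (eT θ φ)
        - comp (c.ifGrad w θ φ) (eP φ) (eP φ)) ^ 2
      + (2 * c.μ0 - c.s0) / 2 * (comp (c.ifGrad w θ φ) (eT θ φ) (eP φ)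
        + comp (c.ifGrad w θ φ) (eP φ) (eT θ φ)) ^ 2
      + c.s0 / 2 * (comp (c.ifGrad w θ φ) (eT θ φ) (eP φ)
        - comp (c.ifGrad w θ φ) (eP φ) (eT θ φ)) ^ 2
      + c.s0 * comp (c.ifGrad w θ φ) (eR θ φ) (eT θ φ) ^ 2
      + c.s0 * comp (c.ifGrad w θ φ) (eR θ φ) (eP φ) ^ 2 := by
    simp only [surfPower, Mtt, Mpp, Mpt, Mtp, Mtr, Mpr, hl]
    ring
  rw [key]
  have h1 := hc.tension
  have h2 : 0 ≤ 2 * c.μ0 - c.s0 := by linarith [hc.shear]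
  have h3 := hc.area
  positivity

end Composite

/-! ### Uniqueness -/

theorem continuous_flux_integrand {V : E3 → E3} {r : ℝ} (hr : 0 ≤ r)
    (hV : ∀ x : E3, ‖x‖ = r → ContDiffAt ℝ 1 V x) :
    Continuous fun p : Fin 2 → ℝ => r ^ 2 * sin (p 0) * uR V r (p 0) (p 1) := by
  have h := (contDiff_uR_sphere hr hV).continuous
  fun_prop

theorem isCompact_angles : IsCompact angles := isCompact_Icc

/-- The flux of a vector field of order `‖x‖⁻³` tends to zero. -/
theorem tendsto_flux_zero {V : E3 → E3}
    (hV : V =O[Bornology.cobounded E3] fun x => (‖x‖ ^ 3)⁻¹) :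
    Tendsto (flux V) atTop (𝓝 0) := by
  obtain ⟨C, hC⟩ := hV.bound
  obtain ⟨ρ, -, hρ⟩ := (hasBasis_cobounded_norm (E := E3)).eventually_iff.1 hC
  -- The factor r² of the area against the decay r⁻³ leaves r⁻¹.
  have hb : ∀ r, max ρ 1 ≤ r → ‖flux V r‖ ≤ (|C| * volume.real angles) * r⁻¹ := by
    intro r hr
    have hr1 : 1 ≤ r := (le_max_right _ _).trans hr
    have hr0 : 0 < r := by linarith
    have h1 : ∀ p ∈ angles, ‖r ^ 2 * sin (p 0) * uR V r (p 0) (p 1)‖ ≤ |C| * r⁻¹ := by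
      intro p _
      have hn := norm_smul_eR hr0.le (p 0) (p 1)
      have h2 : ‖V (r • eR (p 0) (p 1))‖ ≤ C * ‖(‖r • eR (p 0) (p 1)‖ ^ 3)⁻¹‖ := by
        refine @hρ _ ?_
        change ρ ≤ ‖r • eR (p 0) (p 1)‖
        rw [hn]; exact (le_max_left _ _).trans hr
      rw [hn, norm_inv, norm_pow, Real.norm_of_nonneg hr0.le] at h2
      have h3 : |uR V r (p 0) (p 1)| ≤ ‖V (r • eR (p 0) (p 1))‖ := by
        have := abs_real_inner_le_norm (V (r • eR (p 0) (p 1))) (eR (p 0) (p 1))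
        rwa [norm_eR, mul_one] at this
      rw [norm_mul, norm_mul, norm_pow, Real.norm_of_nonneg hr0.le, Real.norm_eq_abs,
        Real.norm_eq_abs]
      calc r ^ 2 * |sin (p 0)| * |uR V r (p 0) (p 1)|
          ≤ r ^ 2 * 1 * (|C| * (r ^ 3)⁻¹) := by
            gcongr
            · exact abs_sin_le_one _
            · exact h3.trans (h2.trans (by gcongr; exact le_abs_self C))
        _ = |C| * r⁻¹ := by field_simp
    have h4 := norm_setIntegral_le_of_norm_le_const (μ := volume)
      isCompact_angles.measure_lt_top h1
    refine h4.trans (le_of_eq ?_)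
    ring
  refine squeeze_zero_norm' (a := fun r : ℝ => (|C| * volume.real angles) * r⁻¹) ?_ ?_
  · filter_upwards [eventually_ge_atTop (max ρ 1)] with r hr using hb r hr
  · simpa using tendsto_inv_atTop_zero.const_mul (|C| * volume.real angles)

/-- If the energy integral over a shell vanishes, so does the energy density. -/
theorem energy_eq_zero_of_integral {μ ν : ℝ} (hμ : 0 < μ) (h1 : -1 < ν) (h2 : ν < 1 / 2)
    {w : E3 → E3} {a b : ℝ} (ha : 0 ≤ a) (hab : a < b)
    (hw : ∀ x : E3, a ≤ ‖x‖ → ‖x‖ ≤ b → ContDiffAt ℝ 2 w x)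
    (hI : ∫ p in shell a b, p 0 ^ 2 * sin (p 1) * energy μ ν w (sph p) ≤ 0) :
    ∀ x : E3, a < ‖x‖ → ‖x‖ < b → energy μ ν w x = 0 := by
  have hcE : ∀ p ∈ shell a b, ContinuousAt (fun p => energy μ ν w (sph p)) p := by
    intro p hp
    have hp0 := (mem_shell.1 hp).1
    have hn := norm_sph (ha.trans hp0.1)
    have hwp := hw (sph p) (by rw [hn]; exact hp0.1) (by rw [hn]; exact hp0.2)
    have h3 : ContinuousAt (energy μ ν w) (sph p) := by
      unfold energy
      exact tendsto_finsetSum _ fun i _ => tendsto_finsetSum _ fun j _ =>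
        (contDiffAt_stress hwp j i).continuousAt.mul (contDiffAt_partialD hwp j i).continuousAt
    exact ContinuousAt.comp (f := sph) h3 (contDiff_sph (n := 0)).continuous.continuousAt
  have hc : ContinuousOn (fun p : Fin 3 → ℝ => p 0 ^ 2 * sin (p 1) * energy μ ν w (sph p))
      (shell a b) := fun p hp => by
    have := hcE p hp
    have h4 : ContinuousAt (fun p : Fin 3 → ℝ => p 0 ^ 2 * sin (p 1)) p := by fun_prop
    exact (h4.mul this).continuousWithinAt
  have hnn : ∀ p ∈ shell a b, 0 ≤ p 0 ^ 2 * sin (p 1) * energy μ ν w (sph p) := by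
    intro p hp
    obtain ⟨-, hp1, -⟩ := mem_shell.1 hp
    exact mul_nonneg (mul_nonneg (sq_nonneg _) (sin_nonneg_of_nonneg_of_le_pi hp1.1 hp1.2))
      (energy_nonneg hμ h1 h2 _ _)
  have hmeas : MeasurableSet (shell a b) := measurableSet_Icc
  have hnn' : 0 ≤ᵐ[volume.restrict (shell a b)]
      fun p : Fin 3 → ℝ => p 0 ^ 2 * sin (p 1) * energy μ ν w (sph p) :=
    (ae_restrict_iff' hmeas).2 (Eventually.of_forall hnn)
  have hint : IntegrableOn (fun p : Fin 3 → ℝ => p 0 ^ 2 * sin (p 1) * energy μ ν w (sph p))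
      (shell a b) := hc.integrableOn_compact isCompact_Icc
  have hzero := (setIntegral_eq_zero_iff_of_nonneg_ae hnn' hint).1
    (le_antisymm hI (setIntegral_nonneg hmeas hnn))
  -- The weight r² sin θ vanishes at the poles and at the centre, so the integrand controls the
  -- energy only in the open box. There a continuous function that is zero almost everywhere is
  -- zero; the polar axis and the half-plane φ = 0 are then reached by continuity.
  set U : Set (Fin 3 → ℝ) := Set.univ.pi fun i => Set.Ioo ((![a, 0, 0] : Fin 3 → ℝ) i)
    ((![b, π, 2 * π] : Fin 3 → ℝ) i) with hU
  have hUo : IsOpen U := isOpen_set_pi Set.finite_univ fun i _ => isOpen_Ioo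
  have hUs : U ⊆ shell a b := fun p hp =>
    ⟨fun i => (hp i (Set.mem_univ i)).1.le, fun i => (hp i (Set.mem_univ i)).2.le⟩
  have hon : Set.EqOn (fun p : Fin 3 → ℝ => p 0 ^ 2 * sin (p 1) * energy μ ν w (sph p)) 0 U :=
    Measure.eqOn_open_of_ae_eq (ae_restrict_of_ae_restrict_of_subset hUs hzero) hUo
      (hc.mono hUs) continuousOn_const
  have hEU : ∀ p ∈ U, energy μ ν w (sph p) = 0 := by
    intro p hp
    have h5 := hon hp
    have hp0 : a < p 0 := (hp 0 (Set.mem_univ 0)).1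
    have hp1 : 0 < p 1 := (hp 1 (Set.mem_univ 1)).1
    have hp2 : p 1 < π := (hp 1 (Set.mem_univ 1)).2
    have hs := sin_pos_of_pos_of_lt_pi hp1 hp2
    have hpos : p 0 ^ 2 * sin (p 1) ≠ 0 := by
      have : 0 < p 0 := by linarith
      positivity
    exact (mul_eq_zero.1 h5).resolve_left hpos
  have hcl : shell a b ⊆ closure U := by
    rw [hU, closure_pi_set]
    intro p hp i _
    have h6 : (![a, 0, 0] : Fin 3 → ℝ) i ≠ (![b, π, 2 * π] : Fin 3 → ℝ) i := by
      fin_cases i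
      · exact hab.ne
      · exact pi_pos.ne
      · exact two_pi_pos.ne
    change p i ∈ closure (Set.Ioo _ _)
    rw [closure_Ioo h6]
    exact ⟨hp.1 i, hp.2 i⟩
  intro x hxa hxb
  obtain ⟨θ, φ, hθ0, hθπ, hφ0, hφ, hx⟩ := exists_spherical x
  have hp : (![‖x‖, θ, φ] : Fin 3 → ℝ) ∈ shell a b :=
    mem_shell.2 ⟨⟨hxa.le, hxb.le⟩, ⟨hθ0, hθπ⟩, ⟨hφ0, hφ⟩⟩
  have hxs : sph ![‖x‖, θ, φ] = x := hx.symm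
  have hcl2 := hcl hp
  have h7 : energy μ ν w (sph ![‖x‖, θ, φ]) ∈ closure ({0} : Set ℝ) :=
    ((hcE _ hp).continuousWithinAt (s := U)).mem_closure hcl2 fun p hp => hEU p hp
  rw [hxs] at h7
  simpa using h7

theorem isBigO_e3 {u : E3 → E3} {g : E3 → ℝ} {l : Filter E3}
    (h : ∀ i, (fun x => u x i) =O[l] g) : u =O[l] g := by
  have h4 : u = fun x => u x 0 • EuclideanSpace.single 0 (1 : ℝ)
      + u x 1 • EuclideanSpace.single 1 (1 : ℝ) + u x 2 • EuclideanSpace.single 2 (1 : ℝ) := by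
    funext x
    conv_lhs => rw [e3_sum_single (u x)]
    rw [Fin.sum_univ_three]
  have h5 : ∀ i : Fin 3, (fun x => u x i • EuclideanSpace.single i (1 : ℝ)) =O[l] g := fun i =>
    (IsBigO.of_bound 1 (Eventually.of_forall fun x => by simp [norm_smul])).trans (h i)
  rw [h4]
  exact ((h5 0).add (h5 1)).add (h5 2)

namespace Composite

variable {c : Composite}

theorem isBigO_power {μ ν : ℝ} {w : E3 → E3}
    (hw : w =O[Bornology.cobounded E3] fun x => ‖x‖⁻¹)
    (hD : ∀ i j, partialD w i j =O[Bornology.cobounded E3] fun x => (‖x‖ ^ 2)⁻¹) :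
    power μ ν w =O[Bornology.cobounded E3] fun x => (‖x‖ ^ 3)⁻¹ := by
  have hs : ∀ i j, (fun x => stress μ ν w x i j) =O[Bornology.cobounded E3]
      fun x => (‖x‖ ^ 2)⁻¹ := by
    intro i j
    simp only [stress_apply]
    have h1 := (((hD 0 0).add (hD 1 1)).add (hD 2 2)).const_mul_left (lame μ ν)
    have h2 := h1.const_mul_left ((1 : Matrix (Fin 3) (Fin 3) ℝ) i j)
    have h3 := ((hD i j).add (hD j i)).const_mul_left μ
    refine (h2.add h3).congr_left fun x => ?_
    ring
  have hc : ∀ j, (fun x => w x j) =O[Bornology.cobounded E3] fun x => ‖x‖⁻¹ := fun j =>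
    (IsBigO.of_norm_le fun x => PiLp.norm_apply_le (w x) j).trans hw.norm_left
  have hp : ∀ i, (fun x => power μ ν w x i) =O[Bornology.cobounded E3]
      fun x => (‖x‖ ^ 3)⁻¹ := by
    intro i
    simp only [power_apply, Fin.sum_univ_three]
    refine ((((hs 0 i).mul (hc 0)).add ((hs 1 i).mul (hc 1))).add
      ((hs 2 i).mul (hc 2))).congr_right fun x => ?_
    rw [← mul_inv]; ring
  exact isBigO_e3 hp

/-- Two solutions for the same far-field stress, both regular at infinity, coincide if the surface
energy is nonnegative. -/
theorem solution_unique (hc : c.Admissible) (hs : c.SurfaceNonneg)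
    {S : Matrix (Fin 3) (Fin 3) ℝ} {uI uM vI vM : E3 → E3}
    (hu : c.IsSolution S uI uM) (hv : c.IsSolution S vI vM)
    (hur : c.RegularAtInfinity S uM) (hvr : c.RegularAtInfinity S vM) :
    (∀ x : E3, ‖x‖ ≤ c.R → uI x = vI x) ∧ (∀ x : E3, c.R ≤ ‖x‖ → uM x = vM x) := by
  have hR := hc.R_pos
  set wI : E3 → E3 := fun x => uI x - vI x with hwI
  set wM : E3 → E3 := fun x => uM x - vM x with hwM
  have hwIs : ∀ x : E3, ‖x‖ ≤ c.R → ContDiffAt ℝ 2 wI x := fun x hx =>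
    (hu.smoothI x hx).sub (hv.smoothI x hx)
  have hwMs : ∀ x : E3, c.R ≤ ‖x‖ → ContDiffAt ℝ 2 wM x := fun x hx =>
    (hu.smoothM x hx).sub (hv.smoothM x hx)
  have hwIe : ∀ x : E3, ‖x‖ < c.R → EquilibriumAt c.μI c.νI wI x := fun x hx =>
    (hu.equilibriumI x hx).sub (hu.smoothI x hx.le) (hv.smoothI x hx.le) (hv.equilibriumI x hx)
  have hwMe : ∀ x : E3, c.R < ‖x‖ → EquilibriumAt c.μ c.ν wM x := fun x hx =>
    (hu.equilibriumM x hx).sub (hu.smoothM x hx.le) (hv.smoothM x hx.le) (hv.equilibriumM x hx)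
  have hcont : ∀ x : E3, ‖x‖ = c.R → wI x = wM x := fun x hx => by
    simp only [hwI, hwM, hu.continuity x hx, hv.continuity x hx]
  have hwO : wM =O[Bornology.cobounded E3] fun x => ‖x‖⁻¹ :=
    (hur.displacement.sub hvr.displacement).congr_left fun x => by simp [hwM]
  have hwD : ∀ i j, partialD wM i j =O[Bornology.cobounded E3] fun x => (‖x‖ ^ 2)⁻¹ := by
    intro i j
    refine ((hur.gradient i j).sub (hvr.gradient i j)).congr' ?_ (EventuallyEq.refl _ _)
    refine (hasBasis_cobounded_norm (E := E3)).eventually_iff.2 ⟨c.R, trivial, fun x hx => ?_⟩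
    have hx' : c.R ≤ ‖x‖ := hx
    simp only [hwM]
    rw [partialD_sub ((hu.smoothM x hx').differentiableAt (by norm_num))
      ((hv.smoothM x hx').differentiableAt (by norm_num))]
    ring
  set VI := power c.μI c.νI wI with hVI
  set VM := power c.μ c.ν wM with hVM
  have hVIs : ∀ x : E3, ‖x‖ ≤ c.R → ContDiffAt ℝ 1 VI x := fun x hx => contDiffAt_power (hwIs x hx)
  have hVMs : ∀ x : E3, c.R ≤ ‖x‖ → ContDiffAt ℝ 1 VM x := fun x hx => contDiffAt_power (hwMs x hx)
  -- the energy balance in the two phases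
  have hbalI : ∫ p in shell 0 c.R, p 0 ^ 2 * sin (p 1) * energy c.μI c.νI wI (sph p)
      = flux VI c.R := by
    have h1 := integral_shell_divergence le_rfl hR.le (fun x _ hx => hVIs x hx)
    have h2 : flux VI 0 = 0 := by simp [flux]
    rw [h2, sub_zero] at h1
    rw [← h1]
    -- Equilibrium is known only in the open phase, so the integrands are compared on the open box.
    rw [shell, volume_pi, ← setIntegral_congr_set Measure.univ_pi_Ioo_ae_eq_Icc,
      ← setIntegral_congr_set Measure.univ_pi_Ioo_ae_eq_Icc]
    refine setIntegral_congr_fun (MeasurableSet.univ_pi fun i => measurableSet_Ioo) fun p hp => ?_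
    have hp0 : 0 < p 0 ∧ p 0 < c.R := hp 0 (Set.mem_univ 0)
    have hn := norm_sph hp0.1.le
    change _ = p 0 ^ 2 * sin (p 1) * _
    rw [hVI, divergence_power (hwIs _ (by rw [hn]; exact hp0.2.le))
      (hwIe _ (by rw [hn]; exact hp0.2))]
  have hbalM : ∀ a b, c.R ≤ a → a ≤ b →
      ∫ p in shell a b, p 0 ^ 2 * sin (p 1) * energy c.μ c.ν wM (sph p)
      = flux VM b - flux VM a := by
    intro a b ha hab
    rw [← integral_shell_divergence (hR.le.trans ha) hab (fun x hx _ => hVMs x (ha.trans hx))]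
    rw [shell, volume_pi, ← setIntegral_congr_set Measure.univ_pi_Ioo_ae_eq_Icc,
      ← setIntegral_congr_set Measure.univ_pi_Ioo_ae_eq_Icc]
    refine setIntegral_congr_fun (MeasurableSet.univ_pi fun i => measurableSet_Ioo) fun p hp => ?_
    have hp0 : a < p 0 ∧ p 0 < b := hp 0 (Set.mem_univ 0)
    have hn := norm_sph (hR.le.trans (ha.trans hp0.1.le))
    change _ = p 0 ^ 2 * sin (p 1) * _
    rw [hVM, divergence_power (hwMs _ (by rw [hn]; exact ha.trans hp0.1.le))
      (hwMe _ (by rw [hn]; exact ha.trans_lt hp0.1))]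
  have hnnM : ∀ a b, 0 ≤ ∫ p in shell a b, p 0 ^ 2 * sin (p 1) * energy c.μ c.ν wM (sph p) := by
    intro a b
    refine setIntegral_nonneg measurableSet_Icc fun p hp => ?_
    obtain ⟨-, hp1, -⟩ := mem_shell.1 hp
    exact mul_nonneg (mul_nonneg (sq_nonneg _) (sin_nonneg_of_nonneg_of_le_pi hp1.1 hp1.2))
      (energy_nonneg hc.μ_pos hc.ν_gt hc.ν_lt _ _)
  have hnnI : 0 ≤ ∫ p in shell 0 c.R, p 0 ^ 2 * sin (p 1) * energy c.μI c.νI wI (sph p) := by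
    refine setIntegral_nonneg measurableSet_Icc fun p hp => ?_
    obtain ⟨-, hp1, -⟩ := mem_shell.1 hp
    exact mul_nonneg (mul_nonneg (sq_nonneg _) (sin_nonneg_of_nonneg_of_le_pi hp1.1 hp1.2))
      (energy_nonneg hc.μI_pos hc.νI_gt hc.νI_lt _ _)
  -- the energy balance of the interface
  have hjump : flux VI c.R ≤ flux VM c.R := by
    have hue : ∀ x : E3, ‖x‖ = c.R → ContDiffAt ℝ 2 uI x := fun x hx => hu.smoothI x hx.le
    have hve : ∀ x : E3, ‖x‖ = c.R → ContDiffAt ℝ 2 vI x := fun x hx => hv.smoothI x hx.le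
    have hwe : ∀ x : E3, ‖x‖ = c.R → ContDiffAt ℝ 1 wI x := fun x hx =>
      (hwIs x hx.le).of_le (by norm_num)
    have hgrad : ∀ θ φ, c.ifGrad wI θ φ = c.ifGrad uI θ φ - c.ifGrad vI θ φ := by
      intro θ φ
      have hn := norm_smul_eR hR.le θ φ
      ext i j
      exact partialD_sub ((hue _ hn).differentiableAt (by norm_num))
        ((hve _ hn).differentiableAt (by norm_num)) i j
    -- The surface stress is affine, not linear, in the displacement. The power on `wI` is therefore
    -- formed for `uI` and `vI` separately and subtracted.
    set F := fun p => c.powerT uI wI p - c.powerT vI wI p with hF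
    set G := fun p => c.powerP uI wI p - c.powerP vI wI p with hG
    have hTu := contDiff_powerT hR.le hue hwe
    have hTv := contDiff_powerT hR.le hve hwe
    have hPu := contDiff_powerP hR.le hue hwe
    have hPv := contDiff_powerP hR.le hve hwe
    set Q : (Fin 2 → ℝ) → ℝ := fun p => c.surfPower uI wI (p 0) (p 1)
      - c.surfPower vI wI (p 0) (p 1) with hQ
    have hQc : Continuous Q := by
      have hw2 : ∀ x : E3, ‖x‖ = c.R → ContDiffAt ℝ 2 wI x := fun x hx => hwIs x hx.le
      have g1 := (contDiff_ifGrad hR.le hw2 contDiff_frameT contDiff_frameT).continuous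
      have g2 := (contDiff_ifGrad hR.le hw2 contDiff_frameP contDiff_frameP).continuous
      have g3 := (contDiff_ifGrad hR.le hw2 contDiff_frameT contDiff_frameP).continuous
      have g4 := (contDiff_ifGrad hR.le hw2 contDiff_frameP contDiff_frameT).continuous
      have g5 := (contDiff_ifGrad hR.le hw2 contDiff_frameR contDiff_frameT).continuous
      have g6 := (contDiff_ifGrad hR.le hw2 contDiff_frameR contDiff_frameP).continuous
      have k : ∀ {z : E3 → E3}, (∀ x : E3, ‖x‖ = c.R → ContDiffAt ℝ 2 z x) →
          Continuous fun p : Fin 2 → ℝ => c.surfPower z wI (p 0) (p 1) := fun hz =>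
        ((((((contDiff_Mtt hR.le hz).continuous.mul g1).add
          ((contDiff_Mpp hR.le hz).continuous.mul g2)).add
          ((contDiff_Mpt hR.le hz).continuous.mul g3)).add
          ((contDiff_Mtp hR.le hz).continuous.mul g4)).add
          ((contDiff_Mtr hR.le hz).continuous.mul g5)).add
          ((contDiff_Mpr hR.le hz).continuous.mul g6)
      exact (k hue).sub (k hve)
    -- The factor R⁻¹ converts the weight R² sin θ of the fluxes into the weight R sin θ of the
    -- surface identity. The traction conditions and the continuity of w turn the power of the jumps
    -- into the difference of the two flux densities.
    have hzero := integral_sphere_divergence F G (hTu.sub hTv) (hPu.sub hPv)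
      (fun φ => by simp [hF, powerT]) (fun φ => by simp [hF, powerT])
      (fun θ => by simp only [hG, powerP_periodic])
      (fun p => c.R⁻¹ * (c.R ^ 2 * sin (p 0) * uR VI c.R (p 0) (p 1))
        - c.R⁻¹ * (c.R ^ 2 * sin (p 0) * uR VM c.R (p 0) (p 1)) + c.R * (sin (p 0) * Q p)) (by
        intro θ φ h0 hπ
        have hn := norm_smul_eR hR.le θ φ
        have d1 : DifferentiableAt ℝ (fun t => c.powerT uI wI ![t, φ]) θ :=
          differentiableAt_line_theta (f := fun a b => c.powerT uI wI ![a, b])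
            (by convert hTu using 2 with p; congr 1; funext i; fin_cases i <;> rfl) θ φ
        have d2 : DifferentiableAt ℝ (fun t => c.powerT vI wI ![t, φ]) θ :=
          differentiableAt_line_theta (f := fun a b => c.powerT vI wI ![a, b])
            (by convert hTv using 2 with p; congr 1; funext i; fin_cases i <;> rfl) θ φ
        have d3 : DifferentiableAt ℝ (fun t => c.powerP uI wI ![θ, t]) φ :=
          differentiableAt_line_phi (f := fun a b => c.powerP uI wI ![a, b])
            (by convert hPu using 2 with p; congr 1; funext i; fin_cases i <;> rfl) θ φ
        have d4 : DifferentiableAt ℝ (fun t => c.powerP vI wI ![θ, t]) φ :=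
          differentiableAt_line_phi (f := fun a b => c.powerP vI wI ![a, b])
            (by convert hPv using 2 with p; congr 1; funext i; fin_cases i <;> rfl) θ φ
        have i1 := surface_power_identity hR hue hwe h0 hπ φ
        have i2 := surface_power_identity hR hve hwe h0 hπ φ
        simp only [hF, hG]
        rw [deriv_fun_sub d1 d2, deriv_fun_sub d3 d4]
        have z0 : (![θ, φ] : Fin 2 → ℝ) 0 = θ := rfl
        have z1 : (![θ, φ] : Fin 2 → ℝ) 1 = φ := rfl
        have sI : stress c.μI c.νI wI (c.R • eR θ φ) = stress c.μI c.νI uI (c.R • eR θ φ)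
            - stress c.μI c.νI vI (c.R • eR θ φ) :=
          stress_sub ((hue _ hn).differentiableAt (by norm_num))
            ((hve _ hn).differentiableAt (by norm_num))
        have sM : stress c.μ c.ν wM (c.R • eR θ φ) = stress c.μ c.ν uM (c.R • eR θ φ)
            - stress c.μ c.ν vM (c.R • eR θ φ) :=
          stress_sub ((hu.smoothM _ hn.ge).differentiableAt (by norm_num))
            ((hv.smoothM _ hn.ge).differentiableAt (by norm_num))
        have csub : ∀ (A B : Matrix (Fin 3) (Fin 3) ℝ) (a b : E3),
            comp (A - B) a b = comp A a b - comp B a b := by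
          intro A B a b; simp only [comp_eq, Matrix.sub_apply]; ring
        have eR' : uR wM c.R θ φ = uR wI c.R θ φ := by rw [uR, uR, hcont _ hn]
        have eT' : uT wM c.R θ φ = uT wI c.R θ φ := by rw [uT, uT, hcont _ hn]
        have eP' : uP wM c.R θ φ = uP wI c.R θ φ := by rw [uP, uP, hcont _ hn]
        have tR1 := hu.tractionR θ φ h0 hπ
        have tR2 := hv.tractionR θ φ h0 hπ
        have tT1 := hu.tractionT θ φ h0 hπ
        have tT2 := hv.tractionT θ φ h0 hπ
        have tP1 := hu.tractionP θ φ h0 hπ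
        have tP2 := hv.tractionP θ φ h0 hπ
        rw [hVI, hVM, hQ]
        simp only [z0, z1, uR_power, sI, sM, csub, eR', eT', eP']
        field_simp
        linear_combination i1 - i2 + c.R * sin θ * (uR wI c.R θ φ * (tR1 - tR2)
          + uT wI c.R θ φ * (tT1 - tT2) + uP wI c.R θ φ * (tP1 - tP2)))
    have cI := (continuous_flux_integrand hR.le fun x hx => hVIs x hx.le)
    have cM := (continuous_flux_integrand hR.le fun x hx => hVMs x hx.ge)
    have nI : IntegrableOn (fun p : Fin 2 → ℝ =>
        c.R⁻¹ * (c.R ^ 2 * sin (p 0) * uR VI c.R (p 0) (p 1))) angles :=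
      (continuous_const.mul cI).continuousOn.integrableOn_compact isCompact_angles
    have nM : IntegrableOn (fun p : Fin 2 → ℝ =>
        c.R⁻¹ * (c.R ^ 2 * sin (p 0) * uR VM c.R (p 0) (p 1))) angles :=
      (continuous_const.mul cM).continuousOn.integrableOn_compact isCompact_angles
    have nQ : IntegrableOn (fun p : Fin 2 → ℝ => c.R * (sin (p 0) * Q p)) angles :=
      (by fun_prop : Continuous fun p : Fin 2 → ℝ =>
        c.R * (sin (p 0) * Q p)).continuousOn.integrableOn_compact isCompact_angles
    have nS : IntegrableOn (fun p : Fin 2 → ℝ =>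
        c.R⁻¹ * (c.R ^ 2 * sin (p 0) * uR VI c.R (p 0) (p 1))
          - c.R⁻¹ * (c.R ^ 2 * sin (p 0) * uR VM c.R (p 0) (p 1))) angles := nI.sub nM
    rw [integral_add nS nQ, integral_sub nI nM, integral_const_mul, integral_const_mul]
      at hzero
    change c.R⁻¹ * flux VI c.R - c.R⁻¹ * flux VM c.R + _ = 0 at hzero
    have hpos : 0 ≤ ∫ p in angles, c.R * (sin (p 0) * Q p) := by
      refine setIntegral_nonneg measurableSet_Icc fun p hp => ?_
      obtain ⟨hp0, -⟩ := mem_angles.1 hp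
      exact mul_nonneg hR.le (mul_nonneg (sin_nonneg_of_nonneg_of_le_pi hp0.1 hp0.2)
        (surfPower_sub_nonneg hs (hgrad _ _)))
    have h5 : c.R⁻¹ * flux VI c.R ≤ c.R⁻¹ * flux VM c.R := by linarith
    exact le_of_mul_le_mul_left h5 (inv_pos.2 hR)
  -- the fluxes vanish
  have hflux : ∀ a, c.R ≤ a → flux VM a ≤ 0 := by
    intro a ha
    -- The flux is nondecreasing in the radius, since the energy of a shell is nonnegative, and it
    -- tends to zero; so it is nonpositive.
    refine ge_of_tendsto (f := flux VM) (tendsto_flux_zero (isBigO_power hwO hwD)) ?_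
    filter_upwards [eventually_ge_atTop a] with b hb
    have h1 := hbalM a b ha hb
    have h2 := hnnM a b
    linarith
  have hR0 := hflux c.R le_rfl
  have hEI := energy_eq_zero_of_integral hc.μI_pos hc.νI_gt hc.νI_lt le_rfl hR
    (fun x _ hx => hwIs x hx) (by rw [hbalI]; linarith)
  have hEM : ∀ x : E3, c.R < ‖x‖ → energy c.μ c.ν wM x = 0 := by
    intro x hx
    refine energy_eq_zero_of_integral hc.μ_pos hc.ν_gt hc.ν_lt hR.le (b := ‖x‖ + 1) (by linarith)
      (fun x hx _ => hwMs x hx) ?_ x hx (by linarith)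
    -- The flux at the outer radius is at most zero, and the flux at R is at least the nonnegative
    -- energy of the ball; hence the energy of the shell is at most zero.
    rw [hbalM _ _ le_rfl (by linarith)]
    have h1 := hflux (‖x‖ + 1) (by linarith)
    linarith
  -- vanishing in the matrix
  have hM0 : ∀ x : E3, c.R < ‖x‖ → wM x = 0 := by
    refine eq_zero_of_strain_eq_zero (U := {x | c.R < ‖x‖}) (isOpen_lt continuous_const
      continuous_norm) (fun y hy => (hwMs y (le_of_lt hy)).differentiableAt (by norm_num))
      (fun y hy => strain_eq_zero_of_energy hc.μ_pos hc.ν_gt hc.ν_lt (hEM y hy)) ?_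
    intro y hy ε hε
    have hy' : c.R < ‖y‖ := hy
    have hwt : Tendsto wM (Bornology.cobounded E3) (𝓝 0) :=
      hwO.trans_tendsto (tendsto_inv_atTop_zero.comp tendsto_norm_cobounded_atTop)
    obtain ⟨ρ, -, hρ⟩ := (hasBasis_cobounded_norm (E := E3)).eventually_iff.1
      (hwt.eventually (Metric.closedBall_mem_nhds (0 : E3) hε))
    have hy0 : 0 < ‖y‖ := hR.trans hy'
    have hge : ∀ s : ℝ, 1 ≤ s → c.R < ‖s • y‖ := by
      intro s hs
      rw [norm_smul, Real.norm_of_nonneg (by linarith)]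
      nlinarith
    refine ⟨max 1 (ρ / ‖y‖), le_max_left _ _, fun s hs => hge s hs.1, ?_, ?_⟩
    · exact (hwMs _ (hge _ (le_max_left _ _)).le).continuousAt
    · have h1 : max 1 (ρ / ‖y‖) • y ∈ {x : E3 | ρ ≤ ‖x‖} := by
        change ρ ≤ ‖_‖
        rw [norm_smul, Real.norm_of_nonneg (by positivity)]
        calc ρ = ρ / ‖y‖ * ‖y‖ := by field_simp
          _ ≤ _ := by gcongr; exact le_max_right _ _
      simpa using hρ h1
  have hsphere : ∀ x : E3, ‖x‖ = c.R → wM x = 0 := by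
    intro x hx
    have hx0 : x ≠ 0 := by rintro rfl; simp at hx; linarith
    have hlim : Tendsto (fun t : ℝ => wM (t • x)) (𝓝[>] 1) (𝓝 (wM x)) := by
      have h1 : Tendsto (fun t : ℝ => t • x) (𝓝[>] 1) (𝓝 x) := by
        have : ContinuousAt (fun t : ℝ => t • x) 1 := by fun_prop
        simpa using this.tendsto.mono_left nhdsWithin_le_nhds
      exact (hwMs x hx.ge).continuousAt.tendsto.comp h1
    refine tendsto_nhds_unique hlim (tendsto_const_nhds.congr' ?_)
    filter_upwards [self_mem_nhdsWithin] with t ht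
    have ht' : 1 < t := ht
    rw [hM0]
    rw [norm_smul, Real.norm_of_nonneg (by linarith), hx]
    nlinarith
  -- vanishing in the inhomogeneity
  have hIsphere : ∀ x : E3, ‖x‖ = c.R → wI x = 0 := fun x hx => by rw [hcont x hx, hsphere x hx]
  -- The centre is excluded because a ray through it does not reach the interface; it is recovered
  -- by continuity.
  have hI0 : ∀ x ∈ {x : E3 | 0 < ‖x‖ ∧ ‖x‖ < c.R}, wI x = 0 := by
    refine eq_zero_of_strain_eq_zero ((isOpen_lt continuous_const continuous_norm).inter
      (isOpen_lt continuous_norm continuous_const))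
      (fun y hy => (hwIs y hy.2.le).differentiableAt (by norm_num))
      (fun y hy => strain_eq_zero_of_energy hc.μI_pos hc.νI_gt hc.νI_lt (hEI y hy.1 hy.2)) ?_
    rintro y ⟨hy0, hyR⟩ ε hε
    have hn : ‖(c.R / ‖y‖) • y‖ = c.R := by
      rw [norm_smul, Real.norm_of_nonneg (by positivity)]; field_simp
    refine ⟨c.R / ‖y‖, (one_le_div hy0).2 hyR.le, fun s hs => ?_, (hwIs _ hn.le).continuousAt, ?_⟩
    · have hs1 := hs.1
      have hs0 : 0 < s := by linarith
      change 0 < ‖s • y‖ ∧ ‖s • y‖ < c.R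
      rw [norm_smul, Real.norm_of_nonneg hs0.le]
      exact ⟨by positivity, (lt_div_iff₀ hy0).1 hs.2⟩
    · rw [hIsphere _ hn, norm_zero]; exact hε.le
  have hcenter : wI 0 = 0 := by
    obtain ⟨e, he⟩ : ∃ e : E3, ‖e‖ = c.R := ⟨c.R • eR 0 0, norm_smul_eR hR.le _ _⟩
    have hlim : Tendsto (fun t : ℝ => wI (t • e)) (𝓝[>] 0) (𝓝 (wI 0)) := by
      have h1 : Tendsto (fun t : ℝ => t • e) (𝓝[>] 0) (𝓝 0) := by
        have : ContinuousAt (fun t : ℝ => t • e) 0 := by fun_prop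
        simpa using this.tendsto.mono_left nhdsWithin_le_nhds
      exact (hwIs 0 (by simpa using hR.le)).continuousAt.tendsto.comp h1
    refine tendsto_nhds_unique hlim (tendsto_const_nhds.congr' ?_)
    filter_upwards [Ioo_mem_nhdsGT (show (0 : ℝ) < 1 by norm_num)] with t ht
    rw [hI0]
    change 0 < ‖t • e‖ ∧ ‖t • e‖ < c.R
    rw [norm_smul, Real.norm_of_nonneg ht.1.le, he]
    exact ⟨mul_pos ht.1 hR, by nlinarith [ht.2]⟩
  constructor
  · intro x hx
    refine sub_eq_zero.1 (?_ : wI x = 0)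
    rcases eq_or_lt_of_le hx with h | h
    · exact hIsphere x h
    · rcases eq_or_ne x 0 with rfl | h0
      · exact hcenter
      · exact hI0 x ⟨norm_pos_iff.2 h0, h⟩
  · intro x hx
    refine sub_eq_zero.1 (?_ : wM x = 0)
    rcases eq_or_lt_of_le hx with h | h
    · exact hsphere x h.symm
    · exact hM0 x h

end Composite

/-! ### Radial scalar fields -/

/-- On `U`, the scalar field `f` has the gradient `f₁(x) x`. -/
def IsRad (U : Set E3) (f f1 : E3 → ℝ) : Prop :=
  ∀ x ∈ U, HasFDerivAt f (f1 x • innerSL ℝ x) x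

namespace IsRad

variable {U : Set E3} {f f1 g g1 : E3 → ℝ}

theorem const (a : ℝ) : IsRad U (fun _ => a) fun _ => 0 := fun x _ => by
  simpa using hasFDerivAt_const a x

theorem add (hf : IsRad U f f1) (hg : IsRad U g g1) :
    IsRad U (fun x => f x + g x) fun x => f1 x + g1 x := fun x hx => by
  simpa [add_smul] using (hf x hx).fun_add (hg x hx)

theorem sub (hf : IsRad U f f1) (hg : IsRad U g g1) :
    IsRad U (fun x => f x - g x) fun x => f1 x - g1 x := fun x hx => by
  simpa [sub_smul] using (hf x hx).fun_sub (hg x hx)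

theorem const_mul (a : ℝ) (hf : IsRad U f f1) : IsRad U (fun x => a * f x) fun x => a * f1 x :=
  fun x hx => by simpa [mul_smul] using (hf x hx).const_mul a

theorem norm_sq : IsRad U (fun x => ‖x‖ ^ 2) fun _ => 2 := fun x _ => by
  have h := (hasStrictFDerivAt_norm_sq x).hasFDerivAt
  refine h.congr_fderiv ?_
  ext y
  simp

/-- The gradient of |x| is x/|x|, obtained from |x| = √(|x|²); hence the quotient h'(r)/r, and hence
the exclusion of the origin. -/
theorem comp_norm {h h' : ℝ → ℝ} (hU : ∀ x ∈ U, x ≠ 0)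
    (hh : ∀ x ∈ U, HasDerivAt h (h' ‖x‖) ‖x‖) :
    IsRad U (fun x => h ‖x‖) fun x => h' ‖x‖ / ‖x‖ := fun x hx => by
  have hn : 0 < ‖x‖ := norm_pos_iff.2 (hU x hx)
  have h1 := (hasStrictFDerivAt_norm_sq x).hasFDerivAt.sqrt (by positivity)
  have h2 : HasFDerivAt (fun y : E3 => ‖y‖) (‖x‖⁻¹ • innerSL ℝ x) x := by
    refine (h1.congr_fderiv ?_).congr_of_eventuallyEq
      (Eventually.of_forall fun y => (sqrt_sq (norm_nonneg y)).symm)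
    rw [sqrt_sq hn.le]
    ext y
    simp
    field_simp
  have h3 := (hh x hx).comp_hasFDerivAt x h2
  refine h3.congr_fderiv ?_
  simp only [smul_smul, div_eq_mul_inv]

theorem inv_norm_pow (hU : ∀ x ∈ U, x ≠ 0) (k : ℕ) :
    IsRad U (fun x => (‖x‖ ^ k)⁻¹) fun x => -k * (‖x‖ ^ (k + 2))⁻¹ := fun x hx => by
  have hn : ‖x‖ ≠ 0 := norm_ne_zero_iff.2 (hU x hx)
  have h := comp_norm (h := fun t => (t ^ k)⁻¹) (h' := fun t => -k * (t ^ (k + 1))⁻¹) hU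
    (fun y hy => by
      have hy0 : ‖y‖ ≠ 0 := norm_ne_zero_iff.2 (hU y hy)
      refine ((hasDerivAt_pow k ‖y‖).inv (pow_ne_zero k hy0)).congr_deriv ?_
      rcases k with _ | k
      · simp
      · simp only [Nat.add_sub_cancel]
        field_simp
        ring) x hx
  refine h.congr_fderiv ?_
  congr 1
  field_simp
  ring

end IsRad

/-! ### Displacements with the angular dependence of the simple shear -/

/-- The diagonal of the tensor `e₁ ⊗ e₁ - e₂ ⊗ e₂`. -/
def eps : Fin 3 → ℝ := ![1, -1, 0]

@[simp] theorem eps_zero : eps 0 = 1 := rfl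
@[simp] theorem eps_one : eps 1 = -1 := rfl
@[simp] theorem eps_two : eps 2 = 0 := rfl

/-- The quadratic form `x₁² - x₂²`. -/
def quad (x : E3) : ℝ := x 0 ^ 2 - x 1 ^ 2

/-- The displacement `α q x + β (x₁, -x₂, 0) + γ x` with `q = x₁² - x₂²`. -/
def field (α β γ : E3 → ℝ) (x : E3) : E3 :=
  WithLp.toLp 2 fun i => (α x * quad x + γ x + β x * eps i) * x i

theorem field_apply (α β γ : E3 → ℝ) (x : E3) (i : Fin 3) :
    field α β γ x i = (α x * quad x + γ x + β x * eps i) * x i := rfl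

theorem hasFDerivAt_coord (i : Fin 3) (x : E3) : HasFDerivAt (fun y : E3 => y i) (coordL i) x :=
  (coordL i).hasFDerivAt

theorem coordL_single (i j : Fin 3) :
    coordL i (EuclideanSpace.single j (1 : ℝ)) = (1 : Matrix (Fin 3) (Fin 3) ℝ) i j := by
  simp [coordL, Matrix.one_apply]

theorem innerSL_single (x : E3) (j : Fin 3) :
    innerSL ℝ x (EuclideanSpace.single j (1 : ℝ)) = x j := by
  rw [innerSL_apply_apply, real_inner_comm, EuclideanSpace.inner_single_left]; simp

/-- The derivative of `quad`. -/
def quadD (x : E3) : E3 →L[ℝ] ℝ := (2 * x 0) • coordL 0 - (2 * x 1) • coordL 1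

theorem hasFDerivAt_quad (x : E3) : HasFDerivAt quad (quadD x) x := by
  have h := ((hasFDerivAt_coord 0 x).pow 2).sub ((hasFDerivAt_coord 1 x).pow 2)
  refine h.congr_fderiv ?_
  simp [quadD]

theorem quadD_single (x : E3) (j : Fin 3) :
    quadD x (EuclideanSpace.single j (1 : ℝ)) = 2 * eps j * x j := by
  fin_cases j <;> simp [quadD, coordL]

theorem differentiableAt_e3 {u : E3 → E3} {x : E3}
    (h : ∀ i, DifferentiableAt ℝ (fun y => u y i) x) : DifferentiableAt ℝ u x := by
  have h1 : DifferentiableAt ℝ (fun y => (u y).ofLp) x := differentiableAt_pi.2 h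
  exact (EuclideanSpace.equiv (Fin 3) ℝ).symm.toContinuousLinearMap.differentiableAt.comp x h1

theorem contDiffAt_field {n : WithTop ℕ∞} {α β γ : E3 → ℝ} {x : E3} (hα : ContDiffAt ℝ n α x)
    (hβ : ContDiffAt ℝ n β x) (hγ : ContDiffAt ℝ n γ x) : ContDiffAt ℝ n (field α β γ) x := by
  have hc : ∀ i : Fin 3, ContDiffAt ℝ n (fun y : E3 => y i) x := fun i =>
    (coordL i).contDiff.contDiffAt
  have h : ContDiffAt ℝ n (fun y => (field α β γ y).ofLp) x := by
    refine contDiffAt_pi.2 fun i => ?_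
    simp only [field_apply]
    have hq : ContDiffAt ℝ n quad x := ((hc 0).pow 2).sub ((hc 1).pow 2)
    exact (((hα.mul hq).add hγ).add (hβ.mul contDiffAt_const)).mul (hc i)
  exact (EuclideanSpace.equiv (Fin 3) ℝ).symm.toContinuousLinearMap.contDiff.contDiffAt.comp x h

section Field

variable {U : Set E3} {α α1 α2 β β1 β2 γ γ1 γ2 : E3 → ℝ}

theorem hasFDerivAt_field (hα : IsRad U α α1) (hβ : IsRad U β β1) (hγ : IsRad U γ γ1) {x : E3}
    (hx : x ∈ U) (i : Fin 3) : HasFDerivAt (fun y => field α β γ y i)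
      ((α x * quad x + γ x + β x * eps i) • coordL i + x i • ((α x • quadD x
        + quad x • (α1 x • innerSL ℝ x)) + γ1 x • innerSL ℝ x + eps i • (β1 x • innerSL ℝ x))) x := by
  simp only [field_apply]
  exact ((((hα x hx).mul (hasFDerivAt_quad x)).add (hγ x hx)).add
    ((hβ x hx).mul_const (eps i))).mul (hasFDerivAt_coord i x)

theorem partialD_field (hα : IsRad U α α1) (hβ : IsRad U β β1) (hγ : IsRad U γ γ1) {x : E3}
    (hx : x ∈ U) (i j : Fin 3) : partialD (field α β γ) i j x =
      (α1 x * quad x + γ1 x) * x i * x j + 2 * α x * eps j * x i * x j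
        + β1 x * eps i * x i * x j
        + (α x * quad x + γ x + β x * eps i) * (1 : Matrix (Fin 3) (Fin 3) ℝ) i j := by
  have h := hasFDerivAt_field hα hβ hγ hx
  rw [partialD_eq_fderiv_coord (differentiableAt_e3 fun i => (h i).differentiableAt), (h i).fderiv]
  simp only [add_apply, smul_apply, coordL_single, innerSL_single, quadD_single, smul_eq_mul]
  ring

/-- In the trace, div(α q x) contributes 5 α q because q is homogeneous of degree two in three
dimensions, and β (x₁, −x₂, 0) contributes only β₁ q because diag(1, −1, 0) is trace-free. -/
theorem stress_field (hα : IsRad U α α1) (hβ : IsRad U β β1) (hγ : IsRad U γ γ1) (μ ν : ℝ)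
    {x : E3} (hx : x ∈ U) (i j : Fin 3) : stress μ ν (field α β γ) x i j =
      (lame μ ν * ((α1 x * quad x + γ1 x) * ‖x‖ ^ 2 + 5 * α x * quad x + 3 * γ x + β1 x * quad x)
          + 2 * μ * (α x * quad x + γ x)) * (1 : Matrix (Fin 3) (Fin 3) ℝ) i j
        + 2 * μ * (α1 x * quad x + γ1 x) * x i * x j
        + μ * (2 * α x + β1 x) * (eps i + eps j) * x i * x j
        + 2 * μ * β x * eps i * (1 : Matrix (Fin 3) (Fin 3) ℝ) i j := by
  rw [stress_apply, e3_norm_sq]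
  simp only [partialD_field hα hβ hγ hx]
  have h1 : (1 : Matrix (Fin 3) (Fin 3) ℝ) j i = (1 : Matrix (Fin 3) (Fin 3) ℝ) i j := by
    simp [Matrix.one_apply, eq_comm]
  have h2 : eps j * (1 : Matrix (Fin 3) (Fin 3) ℝ) i j = eps i * (1 : Matrix (Fin 3) (Fin 3) ℝ) i j := by
    rcases eq_or_ne i j with rfl | h
    · rfl
    · simp [Matrix.one_apply_ne h]
  have h3 : quad x = x 0 ^ 2 - x 1 ^ 2 := rfl
  simp only [eps_zero, eps_one, eps_two, Matrix.one_apply_eq, h1]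
  rw [h3]
  linear_combination μ * β x * h2

theorem isRad_eventually {x : E3} (hU : IsOpen U) (hx : x ∈ U) : ∀ᶠ y in 𝓝 x, y ∈ U :=
  hU.mem_nhds hx

/-- The divergence of the stress of such a displacement. -/
theorem divergence_stress_field (hU : IsOpen U) (hα : IsRad U α α1) (hβ : IsRad U β β1)
    (hγ : IsRad U γ γ1) (hα1 : IsRad U α1 α2) (hβ1 : IsRad U β1 β2) (hγ1 : IsRad U γ1 γ2)
    (μ ν : ℝ) {x : E3} (hx : x ∈ U) (i : Fin 3) :
    ∑ j : Fin 3, fderiv ℝ (fun y => stress μ ν (field α β γ) y i j) x (EuclideanSpace.single j 1)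
      = (quad x * (lame μ ν * (α2 x * ‖x‖ ^ 2 + 7 * α1 x + β2 x)
            + μ * (2 * α2 x * ‖x‖ ^ 2 + 16 * α1 x + β2 x))
          + (lame μ ν + 2 * μ) * (γ2 x * ‖x‖ ^ 2 + 5 * γ1 x)
          + eps i * (2 * lame μ ν * (α1 x * ‖x‖ ^ 2 + 5 * α x + β1 x)
            + μ * (2 * α1 x * ‖x‖ ^ 2 + β2 x * ‖x‖ ^ 2 + 14 * α x + 7 * β1 x))) * x i := by
  have hcongr : ∀ j, fderiv ℝ (fun y => stress μ ν (field α β γ) y i j) x = _ := fun j =>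
    EventuallyEq.fderiv_eq ((isRad_eventually hU hx).mono fun y hy =>
      stress_field hα hβ hγ μ ν hy i j)
  have ha := hα x hx
  have hb := hβ x hx
  have hg := hγ x hx
  have ha1 := hα1 x hx
  have hb1 := hβ1 x hx
  have hg1 := hγ1 x hx
  have hq := hasFDerivAt_quad x
  have hn := IsRad.norm_sq (U := Set.univ) x (Set.mem_univ x)
  have hc := fun k => hasFDerivAt_coord k x
  have hd : ∀ j, fderiv ℝ (fun y => stress μ ν (field α β γ) y i j) x
      (EuclideanSpace.single j 1) =
      (lame μ ν * ((α2 x * quad x + α1 x * (2 * eps j) + γ2 x) * x j * ‖x‖ ^ 2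
            + (α1 x * quad x + γ1 x) * (2 * x j) + 5 * α1 x * x j * quad x
            + 5 * α x * (2 * eps j * x j) + 3 * γ1 x * x j + β2 x * x j * quad x
            + β1 x * (2 * eps j * x j))
          + 2 * μ * (α1 x * x j * quad x + α x * (2 * eps j * x j) + γ1 x * x j))
          * (1 : Matrix (Fin 3) (Fin 3) ℝ) i j
        + 2 * μ * ((α2 x * quad x + α1 x * (2 * eps j) + γ2 x) * x j * x i * x j
          + (α1 x * quad x + γ1 x) * ((1 : Matrix (Fin 3) (Fin 3) ℝ) i j * x j + x i))
        + μ * (eps i + eps j) * ((2 * α1 x + β2 x) * x j * x i * x j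
          + (2 * α x + β1 x) * ((1 : Matrix (Fin 3) (Fin 3) ℝ) i j * x j + x i))
        + 2 * μ * (β1 x * x j) * eps i * (1 : Matrix (Fin 3) (Fin 3) ℝ) i j := by
    intro j
    rw [hcongr j]
    have hA := (((((((ha1.fun_mul hq).fun_add hg1).fun_mul hn).fun_add
      ((ha.const_mul 5).fun_mul hq)).fun_add (hg.const_mul 3)).fun_add
      (hb1.fun_mul hq)).const_mul (lame μ ν)).fun_add
      (((ha.fun_mul hq).fun_add hg).const_mul (2 * μ))
    have hB := ((((ha1.fun_mul hq).fun_add hg1).const_mul (2 * μ)).fun_mul (hc i)).fun_mul (hc j)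
    have hC := (((((ha.const_mul 2).fun_add hb1).const_mul μ).mul_const (eps i + eps j)).fun_mul
      (hc i)).fun_mul (hc j)
    have hD := ((hb.const_mul (2 * μ)).mul_const (eps i)).mul_const
      ((1 : Matrix (Fin 3) (Fin 3) ℝ) i j)
    have h := (((hA.mul_const ((1 : Matrix (Fin 3) (Fin 3) ℝ) i j)).fun_add hB).fun_add
      hC).fun_add hD
    rw [h.fderiv]
    simp only [add_apply, smul_apply, coordL_single, innerSL_single, quadD_single, smul_eq_mul,
      Matrix.one_apply_eq]
    ring
  simp only [hd, Fin.sum_univ_three]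
  rw [e3_norm_sq]
  have h3 : quad x = x 0 ^ 2 - x 1 ^ 2 := rfl
  rcases (by fin_cases i <;> simp : i = 0 ∨ i = 1 ∨ i = 2) with rfl | rfl | rfl <;>
    simp [h3] <;> ring

end Field

/-! ### Spherical components -/

/-- This is the link between the Cartesian class of displacements and the prescribed angular
dependence. -/
theorem quad_smul_eR (r θ φ : ℝ) : quad (r • eR θ φ) = r ^ 2 * (sin θ ^ 2 * cos (2 * φ)) := by
  simp only [quad, PiLp.smul_apply, smul_eq_mul, eR_zero, eR_one, cos_two_mul']
  ring

/-- The terms with α and γ are multiples of x and hence purely radial; only β (x₁, −x₂, 0) has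
tangential components. Thus β is U_θ/r, and α is determined by the difference U_r − U_θ. -/
theorem uR_field (α β γ : E3 → ℝ) (r θ φ : ℝ) : uR (field α β γ) r θ φ =
    r * γ (r • eR θ φ) + (r ^ 3 * α (r • eR θ φ) + r * β (r • eR θ φ))
      * (sin θ ^ 2 * cos (2 * φ)) := by
  rw [uR_eq]
  simp only [field_apply, quad_smul_eR, cos_two_mul', eps_zero, eps_one, eps_two]
  simp only [PiLp.smul_apply, smul_eq_mul, eR_zero, eR_one, eR_two]
  linear_combination (r * (α (r • eR θ φ) * r ^ 2 * sin θ ^ 2 * (cos φ ^ 2 - sin φ ^ 2)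
    + γ (r • eR θ φ))) * (sin θ ^ 2 * sin_sq_add_cos_sq φ + sin_sq_add_cos_sq θ)

theorem uT_field (α β γ : E3 → ℝ) (r θ φ : ℝ) : uT (field α β γ) r θ φ =
    r * β (r • eR θ φ) * sin θ * cos θ * cos (2 * φ) := by
  rw [uT_eq]
  simp only [field_apply, quad_smul_eR, cos_two_mul', eps_zero, eps_one, eps_two]
  simp only [PiLp.smul_apply, smul_eq_mul, eR_zero, eR_one, eR_two]
  linear_combination (r * (α (r • eR θ φ) * r ^ 2 * sin θ ^ 2 * (cos φ ^ 2 - sin φ ^ 2)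
    + γ (r • eR θ φ))) * sin θ * cos θ * sin_sq_add_cos_sq φ

theorem uP_field (α β γ : E3 → ℝ) (r θ φ : ℝ) : uP (field α β γ) r θ φ =
    -(r * β (r • eR θ φ) * sin θ * sin (2 * φ)) := by
  rw [uP_eq]
  simp only [field_apply, quad_smul_eR, sin_two_mul, eps_zero, eps_one]
  simp only [PiLp.smul_apply, smul_eq_mul, eR_zero, eR_one]
  ring

/-- A tensor with the symmetries of the stress of the displacements `field`. -/
def tens (A B C D : ℝ) (x : E3) : Matrix (Fin 3) (Fin 3) ℝ := fun i j =>
  A * (1 : Matrix (Fin 3) (Fin 3) ℝ) i j + B * x i * x j + C * (eps i + eps j) * x i * x j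
    + D * eps i * (1 : Matrix (Fin 3) (Fin 3) ℝ) i j

theorem comp_tens (A B C D : ℝ) (x a n : E3) : comp (tens A B C D x) a n =
    A * (a 0 * n 0 + a 1 * n 1 + a 2 * n 2)
    + B * (a 0 * x 0 + a 1 * x 1 + a 2 * x 2) * (n 0 * x 0 + n 1 * x 1 + n 2 * x 2)
    + C * ((a 0 * x 0 - a 1 * x 1) * (n 0 * x 0 + n 1 * x 1 + n 2 * x 2)
      + (a 0 * x 0 + a 1 * x 1 + a 2 * x 2) * (n 0 * x 0 - n 1 * x 1))
    + D * (a 0 * n 0 - a 1 * n 1) := by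
  rw [comp_eq]
  simp [tens]
  ring

theorem comp_tens_RR (A B C D r θ φ : ℝ) :
    comp (tens A B C D (r • eR θ φ)) (eR θ φ) (eR θ φ) =
      A + B * r ^ 2 + (2 * C * r ^ 2 + D) * (sin θ ^ 2 * cos (2 * φ)) := by
  have h1 : sin θ * cos φ * (sin θ * cos φ) + sin θ * sin φ * (sin θ * sin φ) + cos θ * cos θ = 1 := by
    linear_combination sin θ ^ 2 * sin_sq_add_cos_sq φ + sin_sq_add_cos_sq θ
  have h2 : sin θ * cos φ * (r * (sin θ * cos φ)) + sin θ * sin φ * (r * (sin θ * sin φ))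
      + cos θ * (r * cos θ) = r := by linear_combination r * h1
  rw [comp_tens]
  simp only [PiLp.smul_apply, smul_eq_mul, eR_zero, eR_one, eR_two]
  rw [h1, h2, cos_two_mul']
  ring

/-- The identity and x ⊗ x exert no shear on a sphere, so A and B drop out. The same combination C
r² + D occurs for `eP`, which is why the two tangential conditions reduce to one equation. -/
theorem comp_tens_TR (A B C D r θ φ : ℝ) :
    comp (tens A B C D (r • eR θ φ)) (eT θ φ) (eR θ φ) =
      (C * r ^ 2 + D) * (sin θ * cos θ * cos (2 * φ)) := by
  have h1 : sin θ * cos φ * (sin θ * cos φ) + sin θ * sin φ * (sin θ * sin φ) + cos θ * cos θ = 1 := by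
    linear_combination sin θ ^ 2 * sin_sq_add_cos_sq φ + sin_sq_add_cos_sq θ
  have h2 : sin θ * cos φ * (r * (sin θ * cos φ)) + sin θ * sin φ * (r * (sin θ * sin φ))
      + cos θ * (r * cos θ) = r := by linear_combination r * h1
  have h3 : cos θ * cos φ * (sin θ * cos φ) + cos θ * sin φ * (sin θ * sin φ) + -sin θ * cos θ = 0 := by
    linear_combination sin θ * cos θ * sin_sq_add_cos_sq φ
  have h4 : cos θ * cos φ * (r * (sin θ * cos φ)) + cos θ * sin φ * (r * (sin θ * sin φ))
      + -sin θ * (r * cos θ) = 0 := by linear_combination r * h3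
  rw [comp_tens]
  simp only [PiLp.smul_apply, smul_eq_mul, eR_zero, eR_one, eR_two, eT_zero, eT_one, eT_two]
  rw [h2, h3, h4, cos_two_mul']
  ring

theorem comp_tens_PR (A B C D r θ φ : ℝ) :
    comp (tens A B C D (r • eR θ φ)) (eP φ) (eR θ φ) =
      -((C * r ^ 2 + D) * (sin θ * sin (2 * φ))) := by
  have h1 : sin θ * cos φ * (sin θ * cos φ) + sin θ * sin φ * (sin θ * sin φ) + cos θ * cos θ = 1 := by
    linear_combination sin θ ^ 2 * sin_sq_add_cos_sq φ + sin_sq_add_cos_sq θ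
  have h2 : sin θ * cos φ * (r * (sin θ * cos φ)) + sin θ * sin φ * (r * (sin θ * sin φ))
      + cos θ * (r * cos θ) = r := by linear_combination r * h1
  rw [comp_tens]
  simp only [PiLp.smul_apply, smul_eq_mul, eR_zero, eR_one, eR_two, eP_zero, eP_one, eP_two]
  rw [h2, sin_two_mul]
  ring

section FieldTraction

variable {U : Set E3} {α α1 β β1 γ γ1 : E3 → ℝ}

theorem stress_field_eq_tens (hα : IsRad U α α1) (hβ : IsRad U β β1) (hγ : IsRad U γ γ1) (μ ν : ℝ)
    {x : E3} (hx : x ∈ U) : stress μ ν (field α β γ) x = tens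
      (lame μ ν * ((α1 x * quad x + γ1 x) * ‖x‖ ^ 2 + 5 * α x * quad x + 3 * γ x + β1 x * quad x)
          + 2 * μ * (α x * quad x + γ x)) (2 * μ * (α1 x * quad x + γ1 x))
      (μ * (2 * α x + β1 x)) (2 * μ * β x) x := by
  ext i j
  exact stress_field hα hβ hγ μ ν hx i j

end FieldTraction

namespace Composite

variable {c : Composite}

/-! ### Interface tractions of displacements with the angular dependence of the simple shear -/

theorem hasDerivAt_cos_two_mul (φ : ℝ) :
    HasDerivAt (fun t => cos (2 * t)) (-(2 * sin (2 * φ))) φ := by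
  refine (((hasDerivAt_id φ).const_mul 2).cos).congr_deriv ?_
  simp; ring

theorem hasDerivAt_sin_two_mul (φ : ℝ) :
    HasDerivAt (fun t => sin (2 * t)) (2 * cos (2 * φ)) φ := by
  refine (((hasDerivAt_id φ).const_mul 2).sin).congr_deriv ?_
  simp; ring

section Jumps

variable {u : E3 → E3} {a b d : ℝ}

theorem hoopP_of_form (hR : ∀ θ φ, uR u c.R θ φ = a + b * (sin θ ^ 2 * cos (2 * φ)))
    (hT : ∀ θ φ, uT u c.R θ φ = d * (sin θ * cos θ * cos (2 * φ)))
    (hP : ∀ θ φ, uP u c.R θ φ = -(d * (sin θ * sin (2 * φ)))) (θ φ : ℝ) :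
    c.hoopP u θ φ = sin θ * (a + cos (2 * φ) * (-d + (b - d) * sin θ ^ 2)) := by
  have h : HasDerivAt (fun t => uP u c.R θ t) (-(d * (sin θ * (2 * cos (2 * φ))))) φ := by
    simp only [hP]
    exact (((hasDerivAt_sin_two_mul φ).const_mul (sin θ)).const_mul d).fun_neg
  rw [hoopP, h.deriv, hT, hR]
  linear_combination d * sin θ * cos (2 * φ) * sin_sq_add_cos_sq θ

theorem hoopT_of_form (hR : ∀ θ φ, uR u c.R θ φ = a + b * (sin θ ^ 2 * cos (2 * φ)))
    (hT : ∀ θ φ, uT u c.R θ φ = d * (sin θ * cos θ * cos (2 * φ))) (θ φ : ℝ) :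
    c.hoopT u θ φ = a + cos (2 * φ) * (d + (b - 2 * d) * sin θ ^ 2) := by
  have h : HasDerivAt (fun t => uT u c.R t φ)
      (d * ((cos θ * cos θ + sin θ * (-sin θ)) * cos (2 * φ))) θ := by
    simp only [hT]
    exact ((((hasDerivAt_sin θ).fun_mul (hasDerivAt_cos θ)).mul_const _).const_mul d)
  rw [hoopT, h.deriv, hR]
  linear_combination d * cos (2 * φ) * sin_sq_add_cos_sq θ

theorem Ttt_of_form (hR : ∀ θ φ, uR u c.R θ φ = a + b * (sin θ ^ 2 * cos (2 * φ)))
    (hT : ∀ θ φ, uT u c.R θ φ = d * (sin θ * cos θ * cos (2 * φ)))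
    (hP : ∀ θ φ, uP u c.R θ φ = -(d * (sin θ * sin (2 * φ)))) {θ : ℝ} (hs : sin θ ≠ 0) (φ : ℝ) :
    c.Ttt u θ φ = c.s0
      + (c.l0 + c.s0) / c.R * (a + cos (2 * φ) * (-d + (b - d) * sin θ ^ 2))
      + (c.l0 + 2 * c.μ0) / c.R * (a + cos (2 * φ) * (d + (b - 2 * d) * sin θ ^ 2)) := by
  rw [Ttt, hoopP_of_form hR hT hP, hoopT_of_form hR hT]
  congr 2
  rw [div_mul_eq_mul_div, div_mul_eq_mul_div, mul_left_comm, mul_comm c.R,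
    mul_div_mul_left _ _ hs]

theorem Tpp_of_form (hR : ∀ θ φ, uR u c.R θ φ = a + b * (sin θ ^ 2 * cos (2 * φ)))
    (hT : ∀ θ φ, uT u c.R θ φ = d * (sin θ * cos θ * cos (2 * φ)))
    (hP : ∀ θ φ, uP u c.R θ φ = -(d * (sin θ * sin (2 * φ)))) {θ : ℝ} (hs : sin θ ≠ 0) (φ : ℝ) :
    c.Tpp u θ φ = c.s0
      + (c.l0 + 2 * c.μ0) / c.R * (a + cos (2 * φ) * (-d + (b - d) * sin θ ^ 2))
      + (c.l0 + c.s0) / c.R * (a + cos (2 * φ) * (d + (b - 2 * d) * sin θ ^ 2)) := by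
  rw [Tpp, hoopP_of_form hR hT hP, hoopT_of_form hR hT]
  congr 2
  rw [div_mul_eq_mul_div, div_mul_eq_mul_div, mul_left_comm, mul_comm c.R,
    mul_div_mul_left _ _ hs]

theorem deriv_uT_phi_of_form
    (hT : ∀ θ φ, uT u c.R θ φ = d * (sin θ * cos θ * cos (2 * φ))) (θ φ : ℝ) :
    deriv (fun t => uT u c.R θ t) φ = d * (sin θ * cos θ * -(2 * sin (2 * φ))) := by
  simp only [hT]
  exact (((hasDerivAt_cos_two_mul φ).const_mul (sin θ * cos θ)).const_mul d).deriv

theorem deriv_uP_theta_of_form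
    (hP : ∀ θ φ, uP u c.R θ φ = -(d * (sin θ * sin (2 * φ)))) (θ φ : ℝ) :
    deriv (fun t => uP u c.R t φ) θ = -(d * (cos θ * sin (2 * φ))) := by
  simp only [hP]
  exact (((hasDerivAt_sin θ).mul_const (sin (2 * φ))).const_mul d).fun_neg.deriv

theorem Tpt_of_form (hT : ∀ θ φ, uT u c.R θ φ = d * (sin θ * cos θ * cos (2 * φ)))
    (hP : ∀ θ φ, uP u c.R θ φ = -(d * (sin θ * sin (2 * φ)))) {θ : ℝ} (hs : sin θ ≠ 0) (φ : ℝ) :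
    c.Tpt u θ φ = -(d * (2 * c.μ0 - c.s0) / c.R * cos θ * sin (2 * φ)) := by
  rw [Tpt, deriv_uT_phi_of_form hT, deriv_uP_theta_of_form hP, hP]
  have h : 1 / (c.R * sin θ) = (sin θ)⁻¹ * c.R⁻¹ := by rw [one_div, mul_inv, mul_comm]
  rw [h, div_eq_mul_inv]
  linear_combination -(d * (2 * c.μ0 - c.s0) * c.R⁻¹ * cos θ * sin (2 * φ)) * inv_mul_cancel₀ hs

theorem Ttp_of_form (hT : ∀ θ φ, uT u c.R θ φ = d * (sin θ * cos θ * cos (2 * φ)))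
    (hP : ∀ θ φ, uP u c.R θ φ = -(d * (sin θ * sin (2 * φ)))) {θ : ℝ} (hs : sin θ ≠ 0) (φ : ℝ) :
    c.Ttp u θ φ = -(d * (2 * c.μ0 - c.s0) / c.R * cos θ * sin (2 * φ)) := by
  rw [Ttp, deriv_uT_phi_of_form hT, deriv_uP_theta_of_form hP, hP]
  have h : 1 / (c.R * sin θ) = (sin θ)⁻¹ * c.R⁻¹ := by rw [one_div, mul_inv, mul_comm]
  rw [h, div_eq_mul_inv]
  linear_combination -(d * (2 * c.μ0 - c.s0) * c.R⁻¹ * cos θ * sin (2 * φ)) * inv_mul_cancel₀ hs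

theorem Ttr_of_form (hR : ∀ θ φ, uR u c.R θ φ = a + b * (sin θ ^ 2 * cos (2 * φ)))
    (hT : ∀ θ φ, uT u c.R θ φ = d * (sin θ * cos θ * cos (2 * φ))) (θ φ : ℝ) :
    c.Ttr u θ φ = c.s0 / c.R * (2 * b - d) * (sin θ * cos θ) * cos (2 * φ) := by
  have h : HasDerivAt (fun t => uR u c.R t φ) (b * (2 * sin θ * cos θ * cos (2 * φ))) θ := by
    simp only [hR]
    refine ((((hasDerivAt_sin θ).fun_pow 2).mul_const (cos (2 * φ))).const_mul b).const_add a
      |>.congr_deriv ?_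
    norm_num
  rw [Ttr, h.deriv, hT]
  ring

theorem Tpr_of_form (hR : ∀ θ φ, uR u c.R θ φ = a + b * (sin θ ^ 2 * cos (2 * φ)))
    (hP : ∀ θ φ, uP u c.R θ φ = -(d * (sin θ * sin (2 * φ)))) {θ : ℝ} (hs : sin θ ≠ 0) (φ : ℝ) :
    c.Tpr u θ φ = -(c.s0 / c.R * (2 * b - d) * sin θ * sin (2 * φ)) := by
  have h : HasDerivAt (fun t => uR u c.R θ t) (b * (sin θ ^ 2 * -(2 * sin (2 * φ)))) φ := by
    simp only [hR]
    exact (((hasDerivAt_cos_two_mul φ).const_mul (sin θ ^ 2)).const_mul b).const_add a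
  rw [Tpr, h.deriv, hP]
  have h' : c.s0 / (c.R * sin θ) = c.s0 * c.R⁻¹ * (sin θ)⁻¹ := by rw [div_eq_mul_inv, mul_inv]; ring
  rw [h', div_eq_mul_inv]
  linear_combination -(c.s0 * c.R⁻¹ * (2 * b - d) * sin θ * sin (2 * φ)) * inv_mul_cancel₀ hs

/-- The function Y = sin²θ cos 2φ is a spherical harmonic of degree two, and the tangential
displacement is d/2 times its surface gradient; by isotropy the surface operator stays within 1, Y
and grad Y. The term −2σ₀/R, independent of the displacement, is the Young–Laplace pressure. -/
theorem jumpR_of_form (hc : c.R ≠ 0)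
    (hR : ∀ θ φ, uR u c.R θ φ = a + b * (sin θ ^ 2 * cos (2 * φ)))
    (hT : ∀ θ φ, uT u c.R θ φ = d * (sin θ * cos θ * cos (2 * φ)))
    (hP : ∀ θ φ, uP u c.R θ φ = -(d * (sin θ * sin (2 * φ)))) {θ : ℝ} (hs : sin θ ≠ 0) (φ : ℝ) :
    c.jumpR u θ φ = -(2 * c.s0 / c.R) - 2 * a * (2 * c.μ0 + 2 * c.l0 + c.s0) / c.R ^ 2
      + (6 * (c.l0 + c.μ0 + c.s0) * d - 4 * (c.l0 + c.μ0 + 2 * c.s0) * b) / c.R ^ 2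
        * (sin θ ^ 2 * cos (2 * φ)) := by
  have h1 : HasDerivAt (fun t => c.Tpr u θ t)
      (-(c.s0 / c.R * (2 * b - d) * sin θ * (2 * cos (2 * φ)))) φ := by
    simp only [Tpr_of_form hR hP hs]
    exact ((hasDerivAt_sin_two_mul φ).const_mul _).fun_neg
  have h2 : HasDerivAt (fun t => c.Ttr u t φ)
      (c.s0 / c.R * (2 * b - d) * (cos θ * cos θ + sin θ * -sin θ) * cos (2 * φ)) θ := by
    simp only [Ttr_of_form hR hT]
    exact (((hasDerivAt_sin θ).fun_mul (hasDerivAt_cos θ)).const_mul _).mul_const _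
  rw [jumpR, h1.deriv, h2.deriv, Ttr_of_form hR hT, Ttt_of_form hR hT hP hs,
    Tpp_of_form hR hT hP hs]
  field_simp
  linear_combination (2 * c.s0 * (2 * b - d) * cos (2 * φ)) * sin_sq_add_cos_sq θ

theorem jumpT_of_form (hc : c.R ≠ 0)
    (hR : ∀ θ φ, uR u c.R θ φ = a + b * (sin θ ^ 2 * cos (2 * φ)))
    (hT : ∀ θ φ, uT u c.R θ φ = d * (sin θ * cos θ * cos (2 * φ)))
    (hP : ∀ θ φ, uP u c.R θ φ = -(d * (sin θ * sin (2 * φ)))) {θ : ℝ} (hs : sin θ ≠ 0) (φ : ℝ) :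
    c.jumpT u θ φ = (4 * (c.l0 + c.μ0 + c.s0) * b - (6 * c.l0 + 10 * c.μ0 + 2 * c.s0) * d) / c.R ^ 2
        * (sin θ * cos θ * cos (2 * φ)) := by
  have hev : ∀ᶠ t in 𝓝 θ, sin t ≠ 0 := continuous_sin.continuousAt.eventually_ne hs
  have h1 : HasDerivAt (fun t => c.Tpt u θ t)
      (-(d * (2 * c.μ0 - c.s0) / c.R * cos θ * (2 * cos (2 * φ)))) φ := by
    simp only [Tpt_of_form hT hP hs]
    exact ((hasDerivAt_sin_two_mul φ).const_mul _).fun_neg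
  have h2 : HasDerivAt (fun t => c.Ttt u t φ)
      ((c.l0 + c.s0) / c.R * (cos (2 * φ) * ((b - d) * (2 * sin θ * cos θ)))
      + (c.l0 + 2 * c.μ0) / c.R * (cos (2 * φ) * ((b - 2 * d) * (2 * sin θ * cos θ)))) θ := by
    have hsq : HasDerivAt (fun t => sin t ^ 2) (2 * sin θ * cos θ) θ := by
      refine ((hasDerivAt_sin θ).fun_pow 2).congr_deriv ?_
      norm_num
    refine HasDerivAt.congr_of_eventuallyEq ?_ (hev.mono fun t ht => Ttt_of_form hR hT hP ht φ)
    exact ((((((hsq.const_mul _).const_add _).const_mul _).const_add _).const_mul _).const_add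
      _).fun_add (((((hsq.const_mul _).const_add _).const_mul _).const_add _).const_mul _)
  rw [jumpT, h1.deriv, h2.deriv, Ttr_of_form hR hT, Ttt_of_form hR hT hP hs,
    Tpp_of_form hR hT hP hs]
  field_simp
  ring

/-- The tangential jump is again a multiple of the surface gradient of Y, so the coefficient is that
of `jumpT_of_form`. -/
theorem jumpP_of_form (hc : c.R ≠ 0)
    (hR : ∀ θ φ, uR u c.R θ φ = a + b * (sin θ ^ 2 * cos (2 * φ)))
    (hT : ∀ θ φ, uT u c.R θ φ = d * (sin θ * cos θ * cos (2 * φ)))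
    (hP : ∀ θ φ, uP u c.R θ φ = -(d * (sin θ * sin (2 * φ)))) {θ : ℝ} (hs : sin θ ≠ 0) (φ : ℝ) :
    c.jumpP u θ φ = -((4 * (c.l0 + c.μ0 + c.s0) * b - (6 * c.l0 + 10 * c.μ0 + 2 * c.s0) * d)
      / c.R ^ 2 * (sin θ * sin (2 * φ))) := by
  have hev : ∀ᶠ t in 𝓝 θ, sin t ≠ 0 := continuous_sin.continuousAt.eventually_ne hs
  have h1 : HasDerivAt (fun t => c.Tpp u θ t)
      ((c.l0 + 2 * c.μ0) / c.R * (-(2 * sin (2 * φ)) * (-d + (b - d) * sin θ ^ 2))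
      + (c.l0 + c.s0) / c.R * (-(2 * sin (2 * φ)) * (d + (b - 2 * d) * sin θ ^ 2))) φ := by
    simp only [Tpp_of_form hR hT hP hs]
    exact (((((hasDerivAt_cos_two_mul φ).mul_const _).const_add _).const_mul _).const_add
      _).fun_add ((((hasDerivAt_cos_two_mul φ).mul_const _).const_add _).const_mul _)
  have h2 : HasDerivAt (fun t => c.Ttp u t φ)
      (-(d * (2 * c.μ0 - c.s0) / c.R * -sin θ * sin (2 * φ))) θ := by
    refine HasDerivAt.congr_of_eventuallyEq ?_ (hev.mono fun t ht => Ttp_of_form hT hP ht φ)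
    exact (((hasDerivAt_cos θ).const_mul _).mul_const _).fun_neg
  rw [jumpP, h1.deriv, h2.deriv, Tpr_of_form hR hP hs, Tpt_of_form hT hP hs,
    Ttp_of_form hT hP hs]
  field_simp
  linear_combination (-2 * d * (2 * c.μ0 - c.s0) * sin (2 * φ)) * sin_sq_add_cos_sq θ

end Jumps

end Composite

/-! ### Locality of the stress up to the boundary -/

/-- Gradients are continuous up to the boundary, so agreement on one side of the interface suffices
for equal gradients on it, although the two fields may differ on the other side. -/
theorem partialD_congr_of_closure {u v : E3 → E3} {U : Set E3} (hU : IsOpen U)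
    (h : ∀ y ∈ U, u y = v y) {x : E3} (hx : x ∈ closure U) (hu : ContDiffAt ℝ 1 u x)
    (hv : ContDiffAt ℝ 1 v x) (i j : Fin 3) : partialD u i j x = partialD v i j x := by
  have : (𝓝[U] x).NeBot := mem_closure_iff_nhdsWithin_neBot.1 hx
  have h1 : Tendsto (partialD u i j) (𝓝[U] x) (𝓝 (partialD u i j x)) :=
    (continuousAt_partialD hu i j).tendsto.mono_left nhdsWithin_le_nhds
  have h2 : Tendsto (partialD v i j) (𝓝[U] x) (𝓝 (partialD v i j x)) :=
    (continuousAt_partialD hv i j).tendsto.mono_left nhdsWithin_le_nhds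
  refine tendsto_nhds_unique h1 (h2.congr' ?_)
  filter_upwards [self_mem_nhdsWithin] with y hy
  have he : u =ᶠ[𝓝 y] v := by filter_upwards [hU.mem_nhds hy] with z hz using h z hz
  simp only [partialD, he.fderiv_eq]

theorem stress_congr_of_closure {μ ν : ℝ} {u v : E3 → E3} {U : Set E3} (hU : IsOpen U)
    (h : ∀ y ∈ U, u y = v y) {x : E3} (hx : x ∈ closure U) (hu : ContDiffAt ℝ 1 u x)
    (hv : ContDiffAt ℝ 1 v x) : stress μ ν u x = stress μ ν v x := by
  ext i j
  simp only [stress_apply, partialD_congr_of_closure hU h hx hu hv]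

theorem mem_closure_ball_of_norm_eq {r : ℝ} (hr : 0 < r) {x : E3} (hx : ‖x‖ = r) :
    x ∈ closure {y : E3 | 0 < ‖y‖ ∧ ‖y‖ < r} := by
  have h1 : Tendsto (fun t : ℝ => t • x) (𝓝[<] 1) (𝓝 x) := by
    have : ContinuousAt (fun t : ℝ => t • x) 1 := by fun_prop
    simpa using this.tendsto.mono_left nhdsWithin_le_nhds
  refine mem_closure_of_tendsto h1 ?_
  filter_upwards [Ioo_mem_nhdsLT (show (0 : ℝ) < 1 by norm_num)] with t ht
  rw [norm_smul, Real.norm_of_nonneg ht.1.le, hx]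
  exact ⟨mul_pos ht.1 hr, by nlinarith [ht.2]⟩

theorem mem_closure_exterior_of_norm_eq {r : ℝ} (hr : 0 < r) {x : E3} (hx : ‖x‖ = r) :
    x ∈ closure {y : E3 | r < ‖y‖} := by
  have h1 : Tendsto (fun t : ℝ => t • x) (𝓝[>] 1) (𝓝 x) := by
    have : ContinuousAt (fun t : ℝ => t • x) 1 := by fun_prop
    simpa using this.tendsto.mono_left nhdsWithin_le_nhds
  refine mem_closure_of_tendsto h1 ?_
  filter_upwards [self_mem_nhdsWithin] with t ht
  have ht' : 1 < t := ht
  change r < ‖t • x‖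
  rw [norm_smul, Real.norm_of_nonneg (by linarith), hx]
  nlinarith

namespace Composite

variable (c : Composite)

/-! ### The explicit displacements -/

/-- The coefficient `α` of the displacement in the inhomogeneity. -/
def inhA (A2 : ℝ) (_ : E3) : ℝ := (7 - 10 * c.νI) / (1 - 2 * c.νI) * A2

/-- The coefficient `β` of the displacement in the inhomogeneity. -/
def inhB (A1 A2 : ℝ) (x : E3) : ℝ := A1 - (7 - 4 * c.νI) / (1 - 2 * c.νI) * A2 * ‖x‖ ^ 2

/-- The displacement in the inhomogeneity with the additional radial term `g r`. -/
def inhField (g A1 A2 : ℝ) : E3 → E3 := field (c.inhA A2) (c.inhB A1 A2) fun _ => g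

/-- The coefficient `α` of the displacement in the matrix. -/
def matA (D3 D4 : ℝ) (x : E3) : ℝ :=
  5 * D3 * (‖x‖ ^ 7)⁻¹ + 3 / (1 - 2 * c.ν) * D4 * (‖x‖ ^ 5)⁻¹

/-- The coefficient `β` of the displacement in the matrix. -/
def matB (D1 D3 D4 : ℝ) (x : E3) : ℝ := D1 - 2 * D3 * (‖x‖ ^ 5)⁻¹ + 2 * D4 * (‖x‖ ^ 3)⁻¹

/-- The coefficient `γ` of the displacement in the matrix. -/
def matC (f h : ℝ) (x : E3) : ℝ := f + h * (‖x‖ ^ 3)⁻¹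

/-- The displacement in the matrix with the additional radial term `f r + h / r²`. -/
def matField (f h D1 D3 D4 : ℝ) : E3 → E3 := field (c.matA D3 D4) (matB D1 D3 D4) (matC f h)

variable {c}

theorem isRad_inhA (U : Set E3) (A2 : ℝ) : IsRad U (c.inhA A2) fun _ => 0 := IsRad.const _

theorem isRad_inhB (U : Set E3) (A1 A2 : ℝ) : IsRad U (c.inhB A1 A2)
    fun _ => -(2 * ((7 - 4 * c.νI) / (1 - 2 * c.νI) * A2)) := by
  have h := (IsRad.const (U := U) A1).sub
    (IsRad.norm_sq.const_mul ((7 - 4 * c.νI) / (1 - 2 * c.νI) * A2))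
  intro x hx
  refine (h x hx).congr_fderiv ?_
  congr 1
  ring

theorem isRad_matA (D3 D4 : ℝ) : IsRad {0}ᶜ (c.matA D3 D4)
    fun x => -(35 * D3 * (‖x‖ ^ 9)⁻¹ + 15 / (1 - 2 * c.ν) * D4 * (‖x‖ ^ 7)⁻¹) := by
  have h := ((IsRad.inv_norm_pow (U := {0}ᶜ) (fun x hx => hx) 7).const_mul (5 * D3)).add
    ((IsRad.inv_norm_pow (U := {0}ᶜ) (fun x hx => hx) 5).const_mul (3 / (1 - 2 * c.ν) * D4))
  intro x hx
  refine (h x hx).congr_fderiv ?_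
  congr 1
  push_cast
  ring

theorem isRad_matA' (D3 D4 : ℝ) : IsRad {0}ᶜ
    (fun x => -(35 * D3 * (‖x‖ ^ 9)⁻¹ + 15 / (1 - 2 * c.ν) * D4 * (‖x‖ ^ 7)⁻¹))
    fun x => 315 * D3 * (‖x‖ ^ 11)⁻¹ + 105 / (1 - 2 * c.ν) * D4 * (‖x‖ ^ 9)⁻¹ := by
  have h := (((IsRad.inv_norm_pow (U := {0}ᶜ) (fun x hx => hx) 9).const_mul (35 * D3)).add
    ((IsRad.inv_norm_pow (U := {0}ᶜ) (fun x hx => hx) 7).const_mul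
      (15 / (1 - 2 * c.ν) * D4))).const_mul (-1)
  intro x hx
  refine ((h x hx).congr_of_eventuallyEq (Eventually.of_forall fun y => ?_)).congr_fderiv ?_
  · simp
  · congr 1
    push_cast
    ring

theorem isRad_matB (D1 D3 D4 : ℝ) : IsRad {0}ᶜ (matB D1 D3 D4)
    fun x => 10 * D3 * (‖x‖ ^ 7)⁻¹ - 6 * D4 * (‖x‖ ^ 5)⁻¹ := by
  have h := ((IsRad.const (U := {0}ᶜ) D1).sub
    ((IsRad.inv_norm_pow (U := {0}ᶜ) (fun x hx => hx) 5).const_mul (2 * D3))).add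
    ((IsRad.inv_norm_pow (U := {0}ᶜ) (fun x hx => hx) 3).const_mul (2 * D4))
  intro x hx
  refine (h x hx).congr_fderiv ?_
  congr 1
  push_cast
  ring

theorem isRad_matB' (D3 D4 : ℝ) : IsRad {0}ᶜ
    (fun x => 10 * D3 * (‖x‖ ^ 7)⁻¹ - 6 * D4 * (‖x‖ ^ 5)⁻¹)
    fun x => -(70 * D3 * (‖x‖ ^ 9)⁻¹) + 30 * D4 * (‖x‖ ^ 7)⁻¹ := by
  have h := ((IsRad.inv_norm_pow (U := {0}ᶜ) (fun x hx => hx) 7).const_mul (10 * D3)).sub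
    ((IsRad.inv_norm_pow (U := {0}ᶜ) (fun x hx => hx) 5).const_mul (6 * D4))
  intro x hx
  refine (h x hx).congr_fderiv ?_
  congr 1
  push_cast
  ring

theorem isRad_matC (f h : ℝ) : IsRad {0}ᶜ (matC f h) fun x => -(3 * h * (‖x‖ ^ 5)⁻¹) := by
  have h := (IsRad.const (U := {0}ᶜ) f).add
    ((IsRad.inv_norm_pow (U := {0}ᶜ) (fun x hx => hx) 3).const_mul h)
  intro x hx
  refine (h x hx).congr_fderiv ?_
  congr 1
  push_cast
  ring

theorem isRad_matC' (h : ℝ) : IsRad {0}ᶜ (fun x => -(3 * h * (‖x‖ ^ 5)⁻¹))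
    fun x => 15 * h * (‖x‖ ^ 7)⁻¹ := by
  have h := (IsRad.inv_norm_pow (U := {0}ᶜ) (fun x hx => hx) 5).const_mul (-(3 * h))
  intro x hx
  refine ((h x hx).congr_of_eventuallyEq (Eventually.of_forall fun y => ?_)).congr_fderiv ?_
  · simp
  · congr 1
    push_cast
    ring

theorem contDiff_inhField (g A1 A2 : ℝ) : ContDiff ℝ 2 (c.inhField g A1 A2) := by
  refine contDiff_iff_contDiffAt.2 fun x => contDiffAt_field contDiffAt_const ?_ contDiffAt_const
  have h : ContDiffAt ℝ 2 (fun x : E3 => ‖x‖ ^ 2) x := (contDiff_norm_sq ℝ).contDiffAt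
  exact contDiffAt_const.sub (contDiffAt_const.mul h)

theorem contDiffAt_matField (f h D1 D3 D4 : ℝ) {x : E3} (hx : x ≠ 0) :
    ContDiffAt ℝ 2 (c.matField f h D1 D3 D4) x := by
  have hn : ContDiffAt ℝ 2 (fun x : E3 => ‖x‖) x := contDiffAt_norm ℝ hx
  have hp : ∀ k : ℕ, ContDiffAt ℝ 2 (fun x : E3 => (‖x‖ ^ k)⁻¹) x := fun k =>
    (hn.pow k).inv (pow_ne_zero k (norm_ne_zero_iff.2 hx))
  exact contDiffAt_field ((contDiffAt_const.mul (hp 7)).add (contDiffAt_const.mul (hp 5)))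
    ((contDiffAt_const.sub (contDiffAt_const.mul (hp 5))).add (contDiffAt_const.mul (hp 3)))
    (contDiffAt_const.add (contDiffAt_const.mul (hp 3)))

/-- As α and β₁ are constant, only the part along (x₁, −x₂, 0) survives. It is (10λ + 14μ) α + (2λ +
7μ) β₁ = 0, which fixes the ratio of 7 − 10ν to 7 − 4ν in the two coefficients. -/
theorem equilibriumAt_inhField (hν : 1 - 2 * c.νI ≠ 0) (g A1 A2 : ℝ) (x : E3) :
    EquilibriumAt c.μI c.νI (c.inhField g A1 A2) x := by
  intro i
  rw [inhField, divergence_stress_field isOpen_univ (isRad_inhA _ A2) (isRad_inhB _ A1 A2)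
    (IsRad.const g) (IsRad.const 0) (IsRad.const _) (IsRad.const 0) _ _ (Set.mem_univ x)]
  simp only [inhA, lame]
  field_simp
  ring

theorem equilibriumAt_matField (hν : 1 - 2 * c.ν ≠ 0) (f h D1 D3 D4 : ℝ) {x : E3} (hx : x ≠ 0) :
    EquilibriumAt c.μ c.ν (c.matField f h D1 D3 D4) x := by
  intro i
  have hn : ‖x‖ ≠ 0 := norm_ne_zero_iff.2 hx
  rw [matField, divergence_stress_field isOpen_compl_singleton (isRad_matA D3 D4)
    (isRad_matB D1 D3 D4) (isRad_matC f h) (isRad_matA' D3 D4) (isRad_matB' D3 D4)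
    (isRad_matC' h) _ _ hx]
  simp only [matA, lame]
  field_simp
  ring

/-! #### Components on spheres -/

theorem uR_inhField (g A1 A2 : ℝ) {r : ℝ} (hr : 0 ≤ r) (θ φ : ℝ) :
    uR (c.inhField g A1 A2) r θ φ = r * g + c.UrInh A1 A2 r * (sin θ ^ 2 * cos (2 * φ)) := by
  rw [inhField, uR_field, inhA, inhB, norm_smul_eR hr, UrInh]
  ring

theorem uT_inhField (g A1 A2 : ℝ) {r : ℝ} (hr : 0 ≤ r) (θ φ : ℝ) :
    uT (c.inhField g A1 A2) r θ φ = c.UtInh A1 A2 r * (sin θ * cos θ * cos (2 * φ)) := by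
  rw [inhField, uT_field, inhB, norm_smul_eR hr, UtInh]
  ring

theorem uP_inhField (g A1 A2 : ℝ) {r : ℝ} (hr : 0 ≤ r) (θ φ : ℝ) :
    uP (c.inhField g A1 A2) r θ φ = -(c.UtInh A1 A2 r * (sin θ * sin (2 * φ))) := by
  rw [inhField, uP_field, inhB, norm_smul_eR hr, UtInh]
  ring

theorem uR_matField (hν : 1 - 2 * c.ν ≠ 0) (f h D1 D3 D4 : ℝ) {r : ℝ} (hr : 0 < r) (θ φ : ℝ) :
    uR (c.matField f h D1 D3 D4) r θ φ =
      f * r + h / r ^ 2 + c.UrMat D1 D3 D4 r * (sin θ ^ 2 * cos (2 * φ)) := by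
  rw [matField, uR_field, matA, matB, matC, norm_smul_eR hr.le, UrMat]
  field_simp
  ring

theorem uT_matField (f h D1 D3 D4 : ℝ) {r : ℝ} (hr : 0 < r) (θ φ : ℝ) :
    uT (c.matField f h D1 D3 D4) r θ φ = UtMat D1 D3 D4 r * (sin θ * cos θ * cos (2 * φ)) := by
  rw [matField, uT_field, matB, norm_smul_eR hr.le, UtMat]
  field_simp

theorem uP_matField (f h D1 D3 D4 : ℝ) {r : ℝ} (hr : 0 < r) (θ φ : ℝ) :
    uP (c.matField f h D1 D3 D4) r θ φ = -(UtMat D1 D3 D4 r * (sin θ * sin (2 * φ))) := by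
  rw [matField, uP_field, matB, norm_smul_eR hr.le, UtMat]
  field_simp

/-! #### Tractions on the interface -/

theorem tractionR_inhField (hR : 0 < c.R) (hν : 1 - 2 * c.νI ≠ 0) (g A1 A2 θ φ : ℝ) :
    comp (stress c.μI c.νI (c.inhField g A1 A2) (c.R • eR θ φ)) (eR θ φ) (eR θ φ) =
      3 * c.KI * g + 2 * c.μI * (A1 + c.R ^ 2 * (3 * c.νI / (1 - 2 * c.νI)) * A2)
        * (sin θ ^ 2 * cos (2 * φ)) := by
  rw [inhField, stress_field_eq_tens (isRad_inhA _ A2) (isRad_inhB _ A1 A2)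
    (IsRad.const g) _ _ (Set.mem_univ _), comp_tens_RR]
  simp only [inhA, inhB, norm_smul_eR hR.le, quad_smul_eR, lame, KI, bulk]
  field_simp
  ring

theorem tractionT_inhField (hR : 0 < c.R) (hν : 1 - 2 * c.νI ≠ 0) (g A1 A2 θ φ : ℝ) :
    comp (stress c.μI c.νI (c.inhField g A1 A2) (c.R • eR θ φ)) (eT θ φ) (eR θ φ) =
      2 * c.μI * (A1 - c.R ^ 2 * ((7 + 2 * c.νI) / (1 - 2 * c.νI)) * A2)
        * (sin θ * cos θ * cos (2 * φ)) := by
  rw [inhField, stress_field_eq_tens (isRad_inhA _ A2) (isRad_inhB _ A1 A2)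
    (IsRad.const g) _ _ (Set.mem_univ _), comp_tens_TR]
  simp only [inhA, inhB, norm_smul_eR hR.le]
  field_simp
  ring

theorem tractionP_inhField (hR : 0 < c.R) (hν : 1 - 2 * c.νI ≠ 0) (g A1 A2 θ φ : ℝ) :
    comp (stress c.μI c.νI (c.inhField g A1 A2) (c.R • eR θ φ)) (eP φ) (eR θ φ) =
      -(2 * c.μI * (A1 - c.R ^ 2 * ((7 + 2 * c.νI) / (1 - 2 * c.νI)) * A2)
        * (sin θ * sin (2 * φ))) := by
  rw [inhField, stress_field_eq_tens (isRad_inhA _ A2) (isRad_inhB _ A1 A2)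
    (IsRad.const g) _ _ (Set.mem_univ _), comp_tens_PR]
  simp only [inhA, inhB, norm_smul_eR hR.le]
  field_simp
  ring

theorem smul_eR_ne_zero {r : ℝ} (hr : 0 < r) (θ φ : ℝ) : r • eR θ φ ≠ 0 := by
  rw [← norm_ne_zero_iff, norm_smul_eR hr.le]; exact hr.ne'

/-- The radial terms separate by type: f x is a uniform dilatation with pressure governed by K,
while h x/|x|³ is divergence-free, so only the shear modulus enters its traction. -/
theorem tractionR_matField (hν : 1 - 2 * c.ν ≠ 0) (f h D1 D3 D4 : ℝ) {r : ℝ} (hr : 0 < r)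
    (θ φ : ℝ) :
    comp (stress c.μ c.ν (c.matField f h D1 D3 D4) (r • eR θ φ)) (eR θ φ) (eR θ φ) =
      3 * c.K * f - 4 * c.μ * h / r ^ 3
      + 2 * c.μ * (D1 + 2 / r ^ 3 * (-6 / r ^ 2 * D3 + (c.ν - 5) / (1 - 2 * c.ν) * D4))
        * (sin θ ^ 2 * cos (2 * φ)) := by
  rw [matField, stress_field_eq_tens (isRad_matA D3 D4) (isRad_matB D1 D3 D4) (isRad_matC f h) _ _
    (smul_eR_ne_zero hr θ φ), comp_tens_RR]
  simp only [matA, matB, matC, norm_smul_eR hr.le, quad_smul_eR, lame, K, bulk]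
  field_simp
  ring

theorem tractionT_matField (hν : 1 - 2 * c.ν ≠ 0) (f h D1 D3 D4 : ℝ) {r : ℝ} (hr : 0 < r)
    (θ φ : ℝ) :
    comp (stress c.μ c.ν (c.matField f h D1 D3 D4) (r • eR θ φ)) (eT θ φ) (eR θ φ) =
      2 * c.μ * (D1 + 2 / r ^ 3 * (4 / r ^ 2 * D3 + (1 + c.ν) / (1 - 2 * c.ν) * D4))
        * (sin θ * cos θ * cos (2 * φ)) := by
  rw [matField, stress_field_eq_tens (isRad_matA D3 D4) (isRad_matB D1 D3 D4) (isRad_matC f h) _ _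
    (smul_eR_ne_zero hr θ φ), comp_tens_TR]
  simp only [matA, matB, norm_smul_eR hr.le]
  field_simp
  ring

theorem tractionP_matField (hν : 1 - 2 * c.ν ≠ 0) (f h D1 D3 D4 : ℝ) {r : ℝ} (hr : 0 < r)
    (θ φ : ℝ) :
    comp (stress c.μ c.ν (c.matField f h D1 D3 D4) (r • eR θ φ)) (eP φ) (eR θ φ) =
      -(2 * c.μ * (D1 + 2 / r ^ 3 * (4 / r ^ 2 * D3 + (1 + c.ν) / (1 - 2 * c.ν) * D4))
        * (sin θ * sin (2 * φ))) := by
  rw [matField, stress_field_eq_tens (isRad_matA D3 D4) (isRad_matB D1 D3 D4) (isRad_matC f h) _ _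
    (smul_eR_ne_zero hr θ φ), comp_tens_PR]
  simp only [matA, matB, norm_smul_eR hr.le]
  field_simp
  ring

end Composite

/-! ### Orders of growth at infinity -/

/-- `f` is of order `‖x‖ ^ k` at infinity. -/
def OrderAtInfinity (f : E3 → ℝ) (k : ℤ) : Prop :=
  f =O[Bornology.cobounded E3] fun x => ‖x‖ ^ k

theorem eventually_one_le_norm : ∀ᶠ x : E3 in Bornology.cobounded E3, 1 ≤ ‖x‖ :=
  (hasBasis_cobounded_norm (E := E3)).eventually_iff.2 ⟨1, trivial, fun _ hx => hx⟩

namespace OrderAtInfinity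

variable {f g : E3 → ℝ} {k l : ℤ}

theorem mul (hf : OrderAtInfinity f k) (hg : OrderAtInfinity g l) :
    OrderAtInfinity (fun x => f x * g x) (k + l) := by
  refine (IsBigO.mul hf hg).congr' (EventuallyEq.refl _ _) ?_
  filter_upwards [eventually_one_le_norm] with x hx
  rw [zpow_add₀ (by linarith)]

theorem mono (hf : OrderAtInfinity f k) (h : k ≤ l) : OrderAtInfinity f l := by
  refine IsBigO.trans hf (IsBigO.of_bound 1 ?_)
  filter_upwards [eventually_one_le_norm] with x hx
  rw [one_mul, norm_zpow, norm_zpow, norm_norm]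
  exact zpow_le_zpow_right₀ hx h

theorem add (hf : OrderAtInfinity f k) (hg : OrderAtInfinity g k) :
    OrderAtInfinity (fun x => f x + g x) k := IsBigO.add hf hg

theorem sub (hf : OrderAtInfinity f k) (hg : OrderAtInfinity g k) :
    OrderAtInfinity (fun x => f x - g x) k := IsBigO.sub hf hg

theorem neg (hf : OrderAtInfinity f k) : OrderAtInfinity (fun x => -f x) k := IsBigO.neg_left hf

theorem const_mul (a : ℝ) (hf : OrderAtInfinity f k) : OrderAtInfinity (fun x => a * f x) k :=
  IsBigO.const_mul_left hf a

theorem inv_norm_pow (m : ℕ) : OrderAtInfinity (fun x => (‖x‖ ^ m)⁻¹) (-m) := by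
  simp only [OrderAtInfinity, zpow_neg, zpow_natCast]
  exact isBigO_refl _ _

theorem coord (i : Fin 3) : OrderAtInfinity (fun x => x i) 1 := by
  simp only [OrderAtInfinity, zpow_one]
  exact IsBigO.of_norm_le fun x => PiLp.norm_apply_le x i

theorem quad : OrderAtInfinity quad 2 := by
  have h := ((coord 0).mul (coord 0)).sub ((coord 1).mul (coord 1))
  refine IsBigO.congr_left h fun x => ?_
  simp only [SphInh.quad]
  ring

end OrderAtInfinity

theorem tendsto_stress {μ ν : ℝ} {u : E3 → E3} {l : Filter E3} {E : Matrix (Fin 3) (Fin 3) ℝ}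
    (h : ∀ i j, Tendsto (partialD u i j) l (𝓝 (E i j))) :
    Tendsto (fun x => stress μ ν u x) l (𝓝 fun i j => lame μ ν * (E 0 0 + E 1 1 + E 2 2)
      * (1 : Matrix (Fin 3) (Fin 3) ℝ) i j + μ * (E i j + E j i)) := by
  refine tendsto_pi_nhds.2 fun i => tendsto_pi_nhds.2 fun j => ?_
  simp only [stress_apply]
  exact (((((h 0 0).add (h 1 1)).add (h 2 2)).const_mul _).mul_const _).add
    (((h i j).add (h j i)).const_mul _)

namespace Composite

variable (c : Composite)

/-- The far-field stress of `matField`. -/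
def farTensor (f D1 : ℝ) : Matrix (Fin 3) (Fin 3) ℝ := fun i j =>
  (3 * c.K * f + 2 * c.μ * D1 * eps i) * (1 : Matrix (Fin 3) (Fin 3) ℝ) i j

variable {c}

theorem order_matA (D3 D4 : ℝ) : OrderAtInfinity (c.matA D3 D4) (-5) :=
  (((OrderAtInfinity.inv_norm_pow 7).mono (by norm_num)).const_mul (5 * D3)).add
    ((OrderAtInfinity.inv_norm_pow 5).const_mul (3 / (1 - 2 * c.ν) * D4))

theorem order_matB_sub (D1 D3 D4 : ℝ) : OrderAtInfinity (fun x => matB D1 D3 D4 x - D1) (-3) := by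
  have h := (((OrderAtInfinity.inv_norm_pow 3).const_mul (2 * D4))).sub
    (((OrderAtInfinity.inv_norm_pow 5).mono (show _ ≤ -3 by norm_num)).const_mul (2 * D3))
  refine IsBigO.congr_left h fun x => ?_
  simp only [matB]
  ring

theorem order_matC_sub (f h : ℝ) : OrderAtInfinity (fun x => matC f h x - f) (-3) := by
  refine IsBigO.congr_left ((OrderAtInfinity.inv_norm_pow 3).const_mul h) fun x => ?_
  simp only [matC]
  ring

theorem order_partialD_matField (f h D1 D3 D4 : ℝ) (i j : Fin 3) :
    OrderAtInfinity (fun x => partialD (c.matField f h D1 D3 D4) i j x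
      - (f + D1 * eps i) * (1 : Matrix (Fin 3) (Fin 3) ℝ) i j) (-2) := by
  have x2 : OrderAtInfinity (fun x => x i * x j) 2 :=
    (OrderAtInfinity.coord i).mul (OrderAtInfinity.coord j)
  have hα := order_matA (c := c) D3 D4
  have hαq : OrderAtInfinity (fun x => c.matA D3 D4 x * quad x) (-3) := hα.mul OrderAtInfinity.quad
  have hα1 : OrderAtInfinity
      (fun x => -(35 * D3 * (‖x‖ ^ 9)⁻¹ + 15 / (1 - 2 * c.ν) * D4 * (‖x‖ ^ 7)⁻¹)) (-7) :=
    ((((OrderAtInfinity.inv_norm_pow 9).mono (by norm_num)).const_mul (35 * D3)).add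
    ((OrderAtInfinity.inv_norm_pow 7).const_mul (15 / (1 - 2 * c.ν) * D4))).neg
  have hγ1 : OrderAtInfinity (fun x => -(3 * h * (‖x‖ ^ 5)⁻¹)) (-5) :=
    ((OrderAtInfinity.inv_norm_pow 5).const_mul (3 * h)).neg
  have hβ1 : OrderAtInfinity (fun x => 10 * D3 * (‖x‖ ^ 7)⁻¹ - 6 * D4 * (‖x‖ ^ 5)⁻¹) (-5) :=
    (((OrderAtInfinity.inv_norm_pow 7).mono (by norm_num)).const_mul (10 * D3)).sub
      ((OrderAtInfinity.inv_norm_pow 5).const_mul (6 * D4))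
  have t1 := ((hα1.mul OrderAtInfinity.quad).add hγ1).mul x2
  have t2 := (hα.mul x2).const_mul (2 * eps j)
  have t3 := (hβ1.mul x2).const_mul (eps i)
  have t4 := ((hαq.add (order_matC_sub f h)).add ((order_matB_sub D1 D3 D4).const_mul
    (eps i))).const_mul ((1 : Matrix (Fin 3) (Fin 3) ℝ) i j)
  have t := ((t1.add t2).add t3).add t4
  -- Every correction is in fact of order −3; order −2 is what regularity at infinity asks for.
  refine (OrderAtInfinity.mono t (by norm_num) : OrderAtInfinity _ (-2)).congr' ?_
    (EventuallyEq.refl _ _)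
  filter_upwards [eventually_one_le_norm] with x hx
  have hx0 : x ∈ ({0}ᶜ : Set E3) := by
    rintro (rfl : x = 0)
    norm_num at hx
  rw [matField, partialD_field (isRad_matA D3 D4) (isRad_matB D1 D3 D4) (isRad_matC f h) hx0]
  ring

theorem tendsto_partialD_matField (f h D1 D3 D4 : ℝ) (i j : Fin 3) :
    Tendsto (partialD (c.matField f h D1 D3 D4) i j) (Bornology.cobounded E3)
      (𝓝 ((f + D1 * eps i) * (1 : Matrix (Fin 3) (Fin 3) ℝ) i j)) := by
  have h0 : Tendsto (fun x : E3 => ‖x‖ ^ (-2 : ℤ)) (Bornology.cobounded E3) (𝓝 0) :=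
    (tendsto_zpow_atTop_zero (by norm_num)).comp tendsto_norm_cobounded_atTop
  have h1 := (order_partialD_matField (c := c) f h D1 D3 D4 i j).trans_tendsto h0
  have h2 := h1.add_const ((f + D1 * eps i) * (1 : Matrix (Fin 3) (Fin 3) ℝ) i j)
  simpa using h2

theorem tendsto_stress_matField (hν : 1 - 2 * c.ν ≠ 0) (f h D1 D3 D4 : ℝ) :
    Tendsto (fun x => stress c.μ c.ν (c.matField f h D1 D3 D4) x) (Bornology.cobounded E3)
      (𝓝 (c.farTensor f D1)) := by
  have h := tendsto_stress (μ := c.μ) (ν := c.ν)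
    (E := fun i j => (f + D1 * eps i) * (1 : Matrix (Fin 3) (Fin 3) ℝ) i j)
    (tendsto_partialD_matField (c := c) f h D1 D3 D4)
  refine (congrArg (fun S => Tendsto _ _ (𝓝 S)) ?_).mp h
  funext i j
  rcases eq_or_ne i j with rfl | hij
  · simp only [farTensor, Matrix.one_apply_eq, eps_zero, eps_one, eps_two, lame, K, bulk]
    field_simp
    ring
  · simp [farTensor, Matrix.one_apply_ne hij, Matrix.one_apply_ne hij.symm]

theorem farStrain_farTensor (hc : c.Admissible) (f D1 : ℝ) (i j : Fin 3) :
    c.farStrain (c.farTensor f D1) i j = (f + D1 * eps i) * (1 : Matrix (Fin 3) (Fin 3) ℝ) i j := by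
  have h1 : 1 + c.ν ≠ 0 := by have := hc.ν_gt; linarith
  have h2 : 1 - 2 * c.ν ≠ 0 := by have := hc.ν_lt; linarith
  have h3 := hc.μ_pos.ne'
  have htr : (c.farTensor f D1).trace = 9 * c.K * f := by
    simp [Matrix.trace, Fin.sum_univ_three, farTensor]
    ring
  simp only [farStrain, Matrix.smul_apply, Matrix.sub_apply, htr, smul_eq_mul]
  simp only [farTensor, K, bulk]
  field_simp
  ring

theorem regularAtInfinity_matField (hc : c.Admissible) (f h D1 D3 D4 : ℝ) :
    c.RegularAtInfinity (c.farTensor f D1) (c.matField f h D1 D3 D4) := by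
  constructor
  · refine isBigO_e3 fun i => ?_
    have t := ((((order_matA (c := c) D3 D4).mul OrderAtInfinity.quad).add
      (order_matC_sub f h)).add ((order_matB_sub D1 D3 D4).const_mul (eps i))).mul
      (OrderAtInfinity.coord i)
    have t' : OrderAtInfinity _ (-1) := OrderAtInfinity.mono t (by norm_num)
    refine IsBigO.congr t' (fun x => ?_) (fun x => by simp)
    have hm : ((c.farStrain (c.farTensor f D1)).mulVec x.ofLp) i = (f + D1 * eps i) * x i := by
      simp only [Matrix.mulVec, dotProduct, farStrain_farTensor hc, Fin.sum_univ_three]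
      rcases (by fin_cases i <;> simp : i = 0 ∨ i = 1 ∨ i = 2) with rfl | rfl | rfl <;> simp
    change _ = c.matField f h D1 D3 D4 x i - ((c.farStrain (c.farTensor f D1)).mulVec x.ofLp) i
    rw [hm, matField, field_apply]
    ring
  · intro i j
    have t := order_partialD_matField (c := c) f h D1 D3 D4 i j
    refine IsBigO.congr t (fun x => ?_) (fun x => ?_)
    · rw [farStrain_farTensor hc]
    · simp [zpow_neg]

/-! ### The equations for the coefficients -/

/-- Continuity and balance of tractions on the interface for the displacements `inhField` and
`matField`. -/
structure CoefficientSystem (c : Composite) (g f h A1 A2 D1 D3 D4 : ℝ) : Prop where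
  cont : g = f + h / c.R ^ 3
  trac : 3 * c.KI * g - (3 * c.K * f - 4 * c.μ * h / c.R ^ 3)
    = -(2 * c.s0 / c.R) - 2 * g * c.eta0
  shear : c.ShearSystem D1 A1 A2 D3 D4

theorem UrInh_R (A1 A2 : ℝ) : c.UrInh A1 A2 c.R = c.R * c.tipR A1 A2 := by
  rw [UrInh, tipR]; ring

theorem UtInh_R (A1 A2 : ℝ) : c.UtInh A1 A2 c.R = c.R * c.tipT A1 A2 := by
  rw [UtInh, tipT]; ring

theorem UrMat_R (hR : c.R ≠ 0) (D1 D3 D4 : ℝ) : c.UrMat D1 D3 D4 c.R =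
    c.R * (D1 + 3 / c.R ^ 5 * D3 + 1 / c.R ^ 3 * ((5 - 4 * c.ν) / (1 - 2 * c.ν)) * D4) := by
  rw [UrMat, div_eq_mul_inv (5 - 4 * c.ν)]; field_simp

theorem UtMat_R (hR : c.R ≠ 0) (D1 D3 D4 : ℝ) : UtMat D1 D3 D4 c.R =
    c.R * (D1 - 2 / c.R ^ 5 * D3 + 2 / c.R ^ 3 * D4) := by
  rw [UtMat]; field_simp

/-- The bulk tractions carry a factor 2μ, and (S) is divided by it; this turns 6μ here and 12μ in
`jump_f1` into the factors 3 and 6 of the system. -/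
theorem jump_f2 (hR : c.R ≠ 0) (hμ : c.μ ≠ 0) (A1 A2 : ℝ) :
    (6 * (c.l0 + c.μ0 + c.s0) * (c.R * c.tipT A1 A2)
      - 4 * (c.l0 + c.μ0 + 2 * c.s0) * (c.R * c.tipR A1 A2)) / c.R ^ 2
      = 6 * c.μ * c.f2 A1 A2 := by
  rw [f2]; field_simp; ring

theorem jump_f1 (hR : c.R ≠ 0) (hμ : c.μ ≠ 0) (A1 A2 : ℝ) :
    (4 * (c.l0 + c.μ0 + c.s0) * (c.R * c.tipR A1 A2)
      - (6 * c.l0 + 10 * c.μ0 + 2 * c.s0) * (c.R * c.tipT A1 A2)) / c.R ^ 2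
      = 12 * c.μ * c.f1 A1 A2 := by
  rw [f1]; field_simp; ring

theorem jump_const (hR : c.R ≠ 0) (g : ℝ) :
    -(2 * c.s0 / c.R) - 2 * (c.R * g) * (2 * c.μ0 + 2 * c.l0 + c.s0) / c.R ^ 2
      = -(2 * c.s0 / c.R) - 2 * g * c.eta0 := by
  rw [eta0]; field_simp

section SphereData

variable {u : E3 → E3} {g A1 A2 : ℝ}

theorem jumpR_inhField (hc : c.Admissible) (hu : ∀ x, ‖x‖ = c.R → u x = c.inhField g A1 A2 x)
    {θ : ℝ} (hs : sin θ ≠ 0) (φ : ℝ) : c.jumpR u θ φ = -(2 * c.s0 / c.R) - 2 * g * c.eta0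
      + 6 * c.μ * c.f2 A1 A2 * (sin θ ^ 2 * cos (2 * φ)) := by
  have hR := hc.R_pos
  rw [jumpR_of_form (a := c.R * g) (b := c.R * c.tipR A1 A2) (d := c.R * c.tipT A1 A2) hR.ne'
    (fun θ φ => by rw [← UrInh_R, ← uR_inhField g A1 A2 hR.le, uR, hu _ (norm_smul_eR hR.le _ _), uR])
    (fun θ φ => by rw [← UtInh_R, ← uT_inhField g A1 A2 hR.le, uT, hu _ (norm_smul_eR hR.le _ _), uT])
    (fun θ φ => by rw [← UtInh_R, ← uP_inhField g A1 A2 hR.le, uP, hu _ (norm_smul_eR hR.le _ _), uP])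
    hs, jump_f2 hR.ne' hc.μ_pos.ne', jump_const hR.ne']

theorem jumpT_inhField (hc : c.Admissible) (hu : ∀ x, ‖x‖ = c.R → u x = c.inhField g A1 A2 x)
    {θ : ℝ} (hs : sin θ ≠ 0) (φ : ℝ) : c.jumpT u θ φ =
      12 * c.μ * c.f1 A1 A2 * (sin θ * cos θ * cos (2 * φ)) := by
  have hR := hc.R_pos
  rw [jumpT_of_form (a := c.R * g) (b := c.R * c.tipR A1 A2) (d := c.R * c.tipT A1 A2) hR.ne'
    (fun θ φ => by rw [← UrInh_R, ← uR_inhField g A1 A2 hR.le, uR, hu _ (norm_smul_eR hR.le _ _), uR])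
    (fun θ φ => by rw [← UtInh_R, ← uT_inhField g A1 A2 hR.le, uT, hu _ (norm_smul_eR hR.le _ _), uT])
    (fun θ φ => by rw [← UtInh_R, ← uP_inhField g A1 A2 hR.le, uP, hu _ (norm_smul_eR hR.le _ _), uP])
    hs, jump_f1 hR.ne' hc.μ_pos.ne']

theorem jumpP_inhField (hc : c.Admissible) (hu : ∀ x, ‖x‖ = c.R → u x = c.inhField g A1 A2 x)
    {θ : ℝ} (hs : sin θ ≠ 0) (φ : ℝ) : c.jumpP u θ φ =
      -(12 * c.μ * c.f1 A1 A2 * (sin θ * sin (2 * φ))) := by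
  have hR := hc.R_pos
  rw [jumpP_of_form (a := c.R * g) (b := c.R * c.tipR A1 A2) (d := c.R * c.tipT A1 A2) hR.ne'
    (fun θ φ => by rw [← UrInh_R, ← uR_inhField g A1 A2 hR.le, uR, hu _ (norm_smul_eR hR.le _ _), uR])
    (fun θ φ => by rw [← UtInh_R, ← uT_inhField g A1 A2 hR.le, uT, hu _ (norm_smul_eR hR.le _ _), uT])
    (fun θ φ => by rw [← UtInh_R, ← uP_inhField g A1 A2 hR.le, uP, hu _ (norm_smul_eR hR.le _ _), uP])
    hs, jump_f1 hR.ne' hc.μ_pos.ne']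

end SphereData

theorem Admissible.one_sub_ne (hc : c.Admissible) : 1 - 2 * c.ν ≠ 0 := by
  have := hc.ν_lt; linarith

theorem Admissible.one_subI_ne (hc : c.Admissible) : 1 - 2 * c.νI ≠ 0 := by
  have := hc.νI_lt; linarith

theorem shear_tracT_iff (hμ : c.μ ≠ 0) {x A y : ℝ} : x = c.μI / c.μ * A - 6 * y ↔
    2 * c.μI * A - 2 * c.μ * x = 12 * c.μ * y := by
  constructor
  · rintro rfl; field_simp; ring
  · intro h; field_simp; linarith

theorem shear_tracR_iff (hμ : c.μ ≠ 0) {x A y : ℝ} : x = c.μI / c.μ * A - 3 * y ↔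
    2 * c.μI * A - 2 * c.μ * x = 6 * c.μ * y := by
  constructor
  · rintro rfl; field_simp; ring
  · intro h; field_simp; linarith

/-- Coefficients satisfying the system give a solution. -/
theorem isSolution_of_system (hc : c.Admissible) {g f h A1 A2 D1 D3 D4 : ℝ}
    (hs : CoefficientSystem c g f h A1 A2 D1 D3 D4) :
    c.IsSolution (c.farTensor f D1) (c.inhField g A1 A2) (c.matField f h D1 D3 D4) := by
  have hR := hc.R_pos
  have hμ := hc.μ_pos.ne'
  have hne : ∀ x : E3, c.R ≤ ‖x‖ → x ≠ 0 := fun x hx => norm_pos_iff.1 (hR.trans_le hx)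
  refine ⟨fun x _ => (contDiff_inhField g A1 A2).contDiffAt,
    fun x hx => contDiffAt_matField f h D1 D3 D4 (hne x hx),
    fun x _ => equilibriumAt_inhField hc.one_subI_ne g A1 A2 x,
    fun x hx => equilibriumAt_matField hc.one_sub_ne f h D1 D3 D4 (hne x hx.le), ?_, ?_, ?_, ?_,
    tendsto_stress_matField hc.one_sub_ne f h D1 D3 D4⟩
  · intro x hx
    obtain ⟨θ, φ, -, -, -, -, hx'⟩ := exists_spherical x
    rw [hx] at hx'
    rw [hx']
    refine eq_of_inner_frame (θ := θ) (φ := φ) ?_ ?_ ?_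
    · change uR _ c.R θ φ = uR _ c.R θ φ
      rw [uR_inhField _ _ _ hR.le, uR_matField hc.one_sub_ne _ _ _ _ _ hR, UrInh_R,
        UrMat_R hR.ne', hs.shear.contR, hs.cont]
      field_simp
    · change uT _ c.R θ φ = uT _ c.R θ φ
      rw [uT_inhField _ _ _ hR.le, uT_matField _ _ _ _ _ hR, UtInh_R,
        UtMat_R hR.ne', hs.shear.contT]
    · change uP _ c.R θ φ = uP _ c.R θ φ
      rw [uP_inhField _ _ _ hR.le, uP_matField _ _ _ _ _ hR, UtInh_R,
        UtMat_R hR.ne', hs.shear.contT]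
  · intro θ φ h0 hπ
    have hsin := (sin_pos_of_pos_of_lt_pi h0 hπ).ne'
    rw [tractionR_inhField hR hc.one_subI_ne, tractionR_matField hc.one_sub_ne _ _ _ _ _ hR,
      jumpR_inhField hc (fun _ _ => rfl) hsin]
    linear_combination hs.trac
      + (sin θ ^ 2 * cos (2 * φ)) * (shear_tracR_iff hμ).1 hs.shear.tracR
  · intro θ φ h0 hπ
    have hsin := (sin_pos_of_pos_of_lt_pi h0 hπ).ne'
    rw [tractionT_inhField hR hc.one_subI_ne, tractionT_matField hc.one_sub_ne _ _ _ _ _ hR,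
      jumpT_inhField hc (fun _ _ => rfl) hsin]
    linear_combination (sin θ * cos θ * cos (2 * φ)) * (shear_tracT_iff hμ).1 hs.shear.tracT
  · intro θ φ h0 hπ
    have hsin := (sin_pos_of_pos_of_lt_pi h0 hπ).ne'
    rw [tractionP_inhField hR hc.one_subI_ne, tractionP_matField hc.one_sub_ne _ _ _ _ _ hR,
      jumpP_inhField hc (fun _ _ => rfl) hsin]
    -- The scalar equation already used for the polar traction serves here as well.
    linear_combination (-(sin θ * sin (2 * φ))) * (shear_tracT_iff hμ).1 hs.shear.tracT

/-- The coefficients of a solution of the explicit form satisfy the system. -/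
theorem system_of_isSolution (hc : c.Admissible) {S : Matrix (Fin 3) (Fin 3) ℝ}
    {uI uM : E3 → E3} {g f h A1 A2 D1 D3 D4 : ℝ} (hs : c.IsSolution S uI uM)
    (hI : ∀ x : E3, ‖x‖ ≤ c.R → uI x = c.inhField g A1 A2 x)
    (hM : ∀ x : E3, c.R ≤ ‖x‖ → uM x = c.matField f h D1 D3 D4 x) :
    CoefficientSystem c g f h A1 A2 D1 D3 D4 ∧ S = c.farTensor f D1 := by
  have hR := hc.R_pos
  have hμ := hc.μ_pos.ne'
  have hne : ∀ x : E3, c.R ≤ ‖x‖ → x ≠ 0 := fun x hx => norm_pos_iff.1 (hR.trans_le hx)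
  have hn := norm_smul_eR hR.le
  have hcont : ∀ θ φ, c.inhField g A1 A2 (c.R • eR θ φ)
      = c.matField f h D1 D3 D4 (c.R • eR θ φ) := fun θ φ => by
    rw [← hI _ (hn θ φ).le, ← hM _ (hn θ φ).ge, hs.continuity _ (hn θ φ)]
  have hcR : ∀ θ φ, uR (c.inhField g A1 A2) c.R θ φ = uR (c.matField f h D1 D3 D4) c.R θ φ :=
    fun θ φ => by rw [uR, uR, hcont]
  have hcT : ∀ θ φ, uT (c.inhField g A1 A2) c.R θ φ = uT (c.matField f h D1 D3 D4) c.R θ φ :=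
    fun θ φ => by rw [uT, uT, hcont]
  simp only [uR_inhField _ _ _ hR.le, uR_matField hc.one_sub_ne _ _ _ _ _ hR, UrInh_R,
    UrMat_R hR.ne'] at hcR
  simp only [uT_inhField _ _ _ hR.le, uT_matField _ _ _ _ _ hR, UtInh_R, UtMat_R hR.ne'] at hcT
  -- `uI` is prescribed in the closed ball only; its stress on the interface is obtained as a limit
  -- from inside, and that of `uM` from outside.
  have hsI : ∀ θ φ, stress c.μI c.νI uI (c.R • eR θ φ)
      = stress c.μI c.νI (c.inhField g A1 A2) (c.R • eR θ φ) := fun θ φ =>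
    stress_congr_of_closure ((isOpen_lt continuous_const continuous_norm).inter
      (isOpen_lt continuous_norm continuous_const)) (fun y hy => hI y hy.2.le)
      (mem_closure_ball_of_norm_eq hR (hn θ φ)) ((hs.smoothI _ (hn θ φ).le).of_le (by norm_num))
      ((contDiff_inhField g A1 A2).contDiffAt.of_le (by norm_num))
  have hsM : ∀ θ φ, stress c.μ c.ν uM (c.R • eR θ φ)
      = stress c.μ c.ν (c.matField f h D1 D3 D4) (c.R • eR θ φ) := fun θ φ =>
    stress_congr_of_closure (isOpen_lt continuous_const continuous_norm)
      (fun y hy => hM y (le_of_lt hy))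
      (mem_closure_exterior_of_norm_eq hR (hn θ φ)) ((hs.smoothM _ (hn θ φ).ge).of_le (by norm_num))
      ((contDiffAt_matField f h D1 D3 D4 (smul_eR_ne_zero hR θ φ)).of_le (by norm_num))
  have hjR := hs.tractionR
  have hjT := hs.tractionT
  have hIR : ∀ x : E3, ‖x‖ = c.R → uI x = c.inhField g A1 A2 x := fun x hx => hI x hx.le
  simp only [hsI, hsM, tractionR_inhField hR hc.one_subI_ne,
    tractionR_matField hc.one_sub_ne _ _ _ _ _ hR] at hjR
  simp only [hsI, hsM, tractionT_inhField hR hc.one_subI_ne,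
    tractionT_matField hc.one_sub_ne _ _ _ _ _ hR] at hjT
  have s1 : sin (π / 2) ≠ 0 := by simp
  have s2 : sin (π / 4) ≠ 0 := by rw [sin_pi_div_four]; positivity
  have c2 : cos (π / 4) ≠ 0 := by rw [cos_pi_div_four]; positivity
  have c4 : cos (2 * (π / 4)) = 0 := by
    rw [show 2 * (π / 4) = π / 2 by ring, cos_pi_div_two]
  -- At φ = π/4 the factor cos 2φ vanishes, which isolates the part constant in the angles; φ = 0
  -- then yields the coefficient of sin²θ cos 2φ. The tangential equation is taken at θ = π/4, where
  -- sin θ cos θ ≠ 0.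
  have r0 := hjR (π / 2) (π / 4) (by positivity) (by linarith [pi_pos])
  have r1 := hjR (π / 2) 0 (by positivity) (by linarith [pi_pos])
  have t1 := hjT (π / 4) 0 (by positivity) (by linarith [pi_pos])
  rw [jumpR_inhField hc hIR s1, c4] at r0
  rw [jumpR_inhField hc hIR s1] at r1
  rw [jumpT_inhField hc hIR s2] at t1
  have k0 := hcR (π / 2) (π / 4)
  have k1 := hcR (π / 2) 0
  have k2 := hcT (π / 4) 0
  rw [c4] at k0
  simp only [mul_zero, cos_zero, sin_pi_div_two, add_zero, one_pow, mul_one] at r0 r1 t1 k0 k1 k2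
  refine ⟨⟨?_, r0, ?_⟩, ?_⟩
  · have : c.R * g = c.R * (f + h / c.R ^ 3) := by
      rw [k0]; field_simp
    exact mul_left_cancel₀ hR.ne' this
  · constructor
    · have h1 := mul_right_cancel₀ (mul_ne_zero s2 c2) k2
      exact (mul_left_cancel₀ hR.ne' h1).symm
    · rw [k0] at k1
      exact (mul_left_cancel₀ hR.ne' (add_left_cancel k1)).symm
    · refine (shear_tracT_iff hμ).2 (mul_right_cancel₀ (mul_ne_zero s2 c2) ?_)
      linear_combination t1
    · refine (shear_tracR_iff hμ).2 ?_
      linear_combination r1 - r0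
  · refine tendsto_nhds_unique (f := fun x => stress c.μ c.ν uM x) hs.farField
      ((tendsto_stress_matField hc.one_sub_ne f h D1 D3 D4).congr' ?_)
    refine (hasBasis_cobounded_norm (E := E3)).eventually_iff.2 ⟨c.R, trivial, fun x hx => ?_⟩
    have hx' : c.R ≤ ‖x‖ := hx
    have hcl : x ∈ closure {y : E3 | c.R < ‖y‖} := by
      rcases eq_or_lt_of_le hx' with h | h
      · exact mem_closure_exterior_of_norm_eq hR h.symm
      · exact subset_closure h
    exact (stress_congr_of_closure (isOpen_lt continuous_const continuous_norm)
      (fun y hy => hM y (le_of_lt hy)) hcl ((hs.smoothM _ hx').of_le (by norm_num))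
      ((contDiffAt_matField f h D1 D3 D4 (hne x hx')).of_le (by norm_num))).symm

end Composite

/-! ### Radially symmetric equilibrium displacements -/

/-- Solutions of the Euler equation `t k'' + 4 k' = 0`. -/
theorem euler_ode {I : Set ℝ} (hI : IsOpen I) (hc : IsPreconnected I) (hp : ∀ t ∈ I, 0 < t)
    {k k1 k2 : ℝ → ℝ} (h1 : ∀ t ∈ I, HasDerivAt k (k1 t) t)
    (h2 : ∀ t ∈ I, HasDerivAt k1 (k2 t) t) (h : ∀ t ∈ I, k2 t * t + 4 * k1 t = 0) :
    ∃ a b : ℝ, ∀ t ∈ I, k t = a + b * (t ^ 3)⁻¹ := by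
  -- With the integrating factor t³ the equation becomes (t⁴ k')' = 0.
  have d1 : ∀ t ∈ I, HasDerivAt (fun s => s ^ 4 * k1 s) 0 t := fun t ht => by
    refine ((hasDerivAt_pow 4 t).mul (h2 t ht)).congr_deriv ?_
    linear_combination t ^ 3 * h t ht
  obtain ⟨C, hC⟩ := hI.exists_is_const_of_deriv_eq_zero hc
    (fun t ht => (d1 t ht).differentiableAt.differentiableWithinAt) (fun t ht => (d1 t ht).deriv)
  have d2 : ∀ t ∈ I, HasDerivAt (fun s => k s + C / 3 * (s ^ 3)⁻¹) 0 t := fun t ht => by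
    have t0 : t ≠ 0 := (hp t ht).ne'
    refine ((h1 t ht).add (((hasDerivAt_pow 3 t).inv (pow_ne_zero 3 t0)).const_mul
      (C / 3))).congr_deriv ?_
    rw [← hC t ht]
    field_simp
    push_cast
    ring
  obtain ⟨a, ha⟩ := hI.exists_is_const_of_deriv_eq_zero hc
    (fun t ht => (d2 t ht).differentiableAt.differentiableWithinAt) (fun t ht => (d2 t ht).deriv)
  exact ⟨a, -(C / 3), fun t ht => by linear_combination ha t ht⟩

/-- For γ = k(|x|) one has γ₁ = k'/r and γ₂ r² = k'' − k'/r, so the divergence of the stress is (λ +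
2μ)(k'' + 4k'/r) x. -/
theorem radial_equilibrium {I : Set ℝ} (hI : IsOpen I) (hc : IsPreconnected I)
    (hp : ∀ t ∈ I, 0 < t) {μ ν : ℝ} (hμ : lame μ ν + 2 * μ ≠ 0) {u : E3 → E3} {k : ℝ → ℝ}
    (hk : ∀ x : E3, ‖x‖ ∈ I → u x = k ‖x‖ • x) (hs : ∀ x : E3, ‖x‖ ∈ I → ContDiffAt ℝ 2 u x)
    (he : ∀ x : E3, ‖x‖ ∈ I → EquilibriumAt μ ν u x) :
    ∃ a b : ℝ, ∀ t ∈ I, k t = a + b * (t ^ 3)⁻¹ := by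
  have hn : ∀ t ∈ I, ‖t • eR 0 0‖ = t := fun t ht => norm_smul_eR (hp t ht).le 0 0
  -- The profile is read off on the polar axis, so it inherits the smoothness of `u`.
  have hk2 : ∀ t ∈ I, k t = u (t • eR 0 0) 2 / t := fun t ht => by
    have t0 : t ≠ 0 := (hp t ht).ne'
    rw [hk _ (by rwa [hn t ht]), hn t ht]
    simp [t0]
  have hd : ContDiffOn ℝ (1 + 1) k I := fun t ht => by
    have t0 : t ≠ 0 := (hp t ht).ne'
    have a1 : ContDiffAt ℝ 2 (fun s : ℝ => u (s • eR 0 0)) t :=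
      ContDiffAt.comp t (hs _ (by rwa [hn t ht])) (by fun_prop)
    have a2 : ContDiffAt ℝ 2 (fun s : ℝ => u (s • eR 0 0) 2 / s) t :=
      ContDiffAt.div (𝕜 := ℝ) (f := fun s : ℝ => u (s • eR 0 0) 2) (g := fun s => s)
        ((coordL 2).contDiff.contDiffAt.comp t a1) contDiffAt_id t0
    have a3 : ContDiffAt ℝ 2 k t :=
      a2.congr_of_eventuallyEq (by filter_upwards [hI.mem_nhds ht] with s hs' using hk2 s hs')
    rw [one_add_one_eq_two]
    exact a3.contDiffWithinAt
  rw [contDiffOn_succ_iff_deriv_of_isOpen hI] at hd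
  have h1 : ∀ t ∈ I, HasDerivAt k (deriv k t) t := fun t ht =>
    (hd.1.differentiableAt (hI.mem_nhds ht)).hasDerivAt
  have h2 : ∀ t ∈ I, HasDerivAt (deriv k) (deriv (deriv k) t) t := fun t ht =>
    ((hd.2.2.differentiableOn (by norm_num)).differentiableAt (hI.mem_nhds ht)).hasDerivAt
  have h3 : ∀ t ∈ I, HasDerivAt (fun s => deriv k s / s)
      ((deriv (deriv k) t * t - deriv k t) / t ^ 2) t := fun t ht => by
    refine ((h2 t ht).div (hasDerivAt_id t) (hp t ht).ne').congr_deriv ?_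
    simp
  set U : Set E3 := {x | ‖x‖ ∈ I} with hU
  have hUo : IsOpen U := hI.preimage continuous_norm
  have hU0 : ∀ x ∈ U, x ≠ 0 := fun x hx => norm_pos_iff.1 (hp _ hx)
  have r1 : IsRad U (fun x => k ‖x‖) fun x => deriv k ‖x‖ / ‖x‖ :=
    IsRad.comp_norm hU0 fun x hx => h1 _ hx
  have r2 := IsRad.comp_norm hU0 (h := fun s => deriv k s / s)
    (h' := fun t => (deriv (deriv k) t * t - deriv k t) / t ^ 2) fun x hx => h3 _ hx
  refine euler_ode hI hc hp h1 h2 fun t ht => ?_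
  have t0 : t ≠ 0 := (hp t ht).ne'
  have hx : t • eR 0 0 ∈ U := by
    change ‖t • eR 0 0‖ ∈ I
    rwa [hn t ht]
  have hf : ∀ x ∈ U, u x = field (fun _ => 0) (fun _ => 0) (fun y => k ‖y‖) x := fun x hx => by
    rw [hk x hx]
    ext i
    simp [field_apply]
  have hst : ∀ i j : Fin 3, (fun y => stress μ ν u y i j) =ᶠ[𝓝 (t • eR 0 0)]
      fun y => stress μ ν (field (fun _ => 0) (fun _ => 0) fun y => k ‖y‖) y i j := fun i j => by
    filter_upwards [hUo.eventually_mem hx] with y hy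
    have : u =ᶠ[𝓝 y] field (fun _ => 0) (fun _ => 0) fun y => k ‖y‖ := by
      filter_upwards [hUo.eventually_mem hy] with z hz using hf z hz
    simp only [stress_apply, partialD, this.fderiv_eq]
  have e1 := he _ hx 2
  rw [Finset.sum_congr rfl fun j _ => by rw [(hst 2 j).fderiv_eq], divergence_stress_field hUo (IsRad.const 0) (IsRad.const 0) r1 (IsRad.const 0)
    (IsRad.const 0) r2 μ ν hx 2, hn t ht] at e1
  have e2 : (lame μ ν + 2 * μ) * (deriv (deriv k) t * t + 4 * deriv k t) = 0 := by
    rw [← e1]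
    simp
    field_simp
    ring
  exact (mul_eq_zero.1 e2).resolve_left hμ

/-! ### Displacements given by their spherical components -/

theorem eq_of_components {u v : E3 → E3} {x : E3}
    (h : ∀ θ φ, uR u ‖x‖ θ φ = uR v ‖x‖ θ φ ∧ uT u ‖x‖ θ φ = uT v ‖x‖ θ φ ∧
      uP u ‖x‖ θ φ = uP v ‖x‖ θ φ) : u x = v x := by
  obtain ⟨θ, φ, -, -, -, -, hx⟩ := exists_spherical x
  rw [hx]
  exact eq_of_inner_frame (h θ φ).1 (h θ φ).2.1 (h θ φ).2.2

namespace Composite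

variable {c : Composite} {uI uM : E3 → E3}

/-- The spherical frame spans, so components determine the field. The additional radial term becomes
γ = g inside and γ = f + h/r³ outside. -/
theorem hasShearForm_iff (hc : c.Admissible) {aI aM : ℝ → ℝ} {g f h A1 A2 D1 D3 D4 : ℝ}
    (hI : ∀ r, aI r = r * g) (hM : ∀ r, c.R ≤ r → aM r = f * r + h / r ^ 2) :
    c.HasShearForm aI aM A1 A2 D1 D3 D4 uI uM ↔
      (∀ x : E3, ‖x‖ ≤ c.R → uI x = c.inhField g A1 A2 x) ∧
        ∀ x : E3, c.R ≤ ‖x‖ → uM x = c.matField f h D1 D3 D4 x := by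
  have hR := hc.R_pos
  constructor
  · intro hs
    refine ⟨fun x hx => eq_of_components fun θ φ => ⟨?_, ?_, ?_⟩,
      fun x hx => eq_of_components fun θ φ => ⟨?_, ?_, ?_⟩⟩
    · rw [hs.inhR _ _ _ (norm_nonneg x) hx, uR_inhField _ _ _ (norm_nonneg x), hI]; ring
    · rw [hs.inhT _ _ _ (norm_nonneg x) hx, uT_inhField _ _ _ (norm_nonneg x)]; ring
    · rw [hs.inhP _ _ _ (norm_nonneg x) hx, uP_inhField _ _ _ (norm_nonneg x)]; ring
    · rw [hs.matR _ _ _ hx, uR_matField hc.one_sub_ne _ _ _ _ _ (hR.trans_le hx), hM _ hx]; ring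
    · rw [hs.matT _ _ _ hx, uT_matField _ _ _ _ _ (hR.trans_le hx)]; ring
    · rw [hs.matP _ _ _ hx, uP_matField _ _ _ _ _ (hR.trans_le hx)]; ring
  · rintro ⟨h1, h2⟩
    have e1 : ∀ r θ φ : ℝ, 0 ≤ r → r ≤ c.R →
        uI (r • eR θ φ) = c.inhField g A1 A2 (r • eR θ φ) := fun r θ φ h0 hr =>
      h1 _ (by rwa [norm_smul_eR h0])
    have e2 : ∀ r θ φ : ℝ, c.R ≤ r →
        uM (r • eR θ φ) = c.matField f h D1 D3 D4 (r • eR θ φ) := fun r θ φ hr =>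
      h2 _ (by rwa [norm_smul_eR (hR.le.trans hr)])
    constructor
    · intro r θ φ h0 hr
      have := uR_inhField (c := c) g A1 A2 h0 θ φ
      rw [uR, e1 r θ φ h0 hr, hI, ← uR, this]; ring
    · intro r θ φ h0 hr
      have := uT_inhField (c := c) g A1 A2 h0 θ φ
      rw [uT, e1 r θ φ h0 hr, ← uT, this]; ring
    · intro r θ φ h0 hr
      have := uP_inhField (c := c) g A1 A2 h0 θ φ
      rw [uP, e1 r θ φ h0 hr, ← uP, this]; ring
    · intro r θ φ hr
      have := uR_matField hc.one_sub_ne f h D1 D3 D4 (hR.trans_le hr) θ φ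
      rw [uR, e2 r θ φ hr, hM _ hr, ← uR, this]; ring
    · intro r θ φ hr
      have := uT_matField (c := c) f h D1 D3 D4 (hR.trans_le hr) θ φ
      rw [uT, e2 r θ φ hr, ← uT, this]; ring
    · intro r θ φ hr
      have := uP_matField (c := c) f h D1 D3 D4 (hR.trans_le hr) θ φ
      rw [uP, e2 r θ φ hr, ← uP, this]; ring

theorem hasRadialForm_iff {f g : ℝ → ℝ} :
    c.HasRadialForm f g uI uM ↔ c.HasShearForm f g 0 0 0 0 0 uI uM := by
  have e1 : ∀ r, c.UrInh 0 0 r = 0 := fun r => by simp [UrInh]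
  have e2 : ∀ r, c.UtInh 0 0 r = 0 := fun r => by simp [UtInh]
  have e3 : ∀ r, c.UrMat 0 0 0 r = 0 := fun r => by simp [UrMat]
  have e4 : ∀ r, UtMat 0 0 0 r = 0 := fun r => by simp [UtMat]
  constructor
  · rintro ⟨h1, h2, h3, h4, h5, h6⟩
    constructor <;> simpa only [e1, e2, e3, e4, zero_mul, add_zero, neg_zero]
  · rintro ⟨h1, h2, h3, h4, h5, h6⟩
    simp only [e1, e2, e3, e4, zero_mul, add_zero, neg_zero] at h1 h2 h3 h4 h5 h6
    exact ⟨h1, h2, h3, h4, h5, h6⟩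

theorem hasModifiedForm_iff (hc : c.Admissible) {A1 A2 D1 D3 D4 : ℝ} :
    c.HasModifiedForm A1 A2 D1 D3 D4 uI uM ↔
      (∀ x : E3, ‖x‖ ≤ c.R → uI x = c.inhField (c.A * c.s0 / c.R) A1 A2 x) ∧
        ∀ x : E3, c.R ≤ ‖x‖ → uM x = c.matField 0 (c.A * c.s0 * c.R ^ 2) D1 D3 D4 x := by
  have hR := hc.R_pos
  refine hasShearForm_iff hc (fun r => ?_) fun r hr => ?_
  · rw [zpow_one]; ring
  · have : 0 < r := hR.trans_le hr
    rw [zpow_neg, zpow_ofNat]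
    field_simp
    ring

theorem hasHydrostaticForm_iff (hc : c.Admissible) {sh : ℝ} :
    c.HasHydrostaticForm sh uI uM ↔
      (∀ x : E3, ‖x‖ ≤ c.R → uI x = c.inhField (c.F1 sh) 0 0 x) ∧
        ∀ x : E3, c.R ≤ ‖x‖ → uM x = c.matField (c.F2 sh) (c.F3 sh) 0 0 0 x :=
  hasRadialForm_iff.trans (hasShearForm_iff hc (fun _ => mul_comm _ _) fun _ _ => rfl)

/-! ### The far field -/

theorem farTensor_shear (hc : c.Admissible) (sd : ℝ) :
    c.farTensor 0 (sd / (2 * c.μ)) = shearStress sd := by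
  have := hc.μ_pos
  ext i j
  fin_cases i <;> fin_cases j <;> simp [farTensor, shearStress] <;> field_simp

theorem K_pos (hc : c.Admissible) : 0 < c.K := bulk_pos hc.μ_pos hc.ν_gt hc.ν_lt

theorem KI_pos (hc : c.Admissible) : 0 < c.KI := bulk_pos hc.μI_pos hc.νI_gt hc.νI_lt

theorem farTensor_hydro (hc : c.Admissible) (sh : ℝ) :
    c.farTensor (c.F2 sh) 0 = hydroStress sh := by
  have := K_pos hc
  ext i j
  fin_cases i <;> fin_cases j <;> simp [farTensor, hydroStress, F2] <;> field_simp

theorem eq_of_farTensor_eq_shear (hc : c.Admissible) {sd D1 : ℝ}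
    (h : shearStress sd = c.farTensor 0 D1) : D1 = sd / (2 * c.μ) := by
  have h0 := congrFun (congrFun h 0) 0
  have := hc.μ_pos
  simp [farTensor, shearStress] at h0
  rw [h0]
  field_simp

theorem eq_of_farTensor_eq_hydro (hc : c.Admissible) {sh f : ℝ}
    (h : hydroStress sh = c.farTensor f 0) : f = c.F2 sh := by
  have h0 := congrFun (congrFun h 0) 0
  have := K_pos hc
  simp [farTensor, hydroStress] at h0
  rw [h0, F2]
  field_simp

/-! ### Solving for the radial coefficients -/

/-- Substituting h/R³ = g − f leaves Δ g = (3K + 4μ) f − 2σ₀/R. The cases used are f = 0 for simple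
shear and f = F₂ for hydrostatic load. -/
theorem radial_coefficients_iff (hc : c.Admissible) (hd : c.denom ≠ 0) {g f h : ℝ} :
    (g = f + h / c.R ^ 3 ∧ 3 * c.KI * g - (3 * c.K * f - 4 * c.μ * h / c.R ^ 3)
        = -(2 * c.s0 / c.R) - 2 * g * c.eta0) ↔
      g = ((3 * c.K + 4 * c.μ) * f - 2 * c.s0 / c.R) / c.denom ∧ h = c.R ^ 3 * (g - f) := by
  have hR := hc.R_pos.ne'
  have key : ∀ x : ℝ, 4 * c.μ * (c.R ^ 3 * x) / c.R ^ 3 = 4 * c.μ * x := fun x => by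
    field_simp
  constructor
  · rintro ⟨h1, h2⟩
    have h3 : h = c.R ^ 3 * (g - f) := by rw [h1]; field_simp; ring
    refine ⟨?_, h3⟩
    rw [h3, key] at h2
    rw [eq_div_iff hd, denom]
    linear_combination h2
  · rintro ⟨h1, h2⟩
    refine ⟨by rw [h2]; field_simp; ring, ?_⟩
    rw [eq_div_iff hd, denom] at h1
    rw [h2, key]
    linear_combination h1

theorem shear_coefficients (hc : c.Admissible) (hd : c.denom ≠ 0) {A1 A2 D1 D3 D4 : ℝ}
    (hs : c.ShearSystem D1 A1 A2 D3 D4) :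
    CoefficientSystem c (c.A * c.s0 / c.R) 0 (c.A * c.s0 * c.R ^ 2) A1 A2 D1 D3 D4 := by
  have hR := hc.R_pos.ne'
  have h := (radial_coefficients_iff hc hd (g := c.A * c.s0 / c.R) (f := 0)
    (h := c.A * c.s0 * c.R ^ 2)).2 ⟨by rw [A]; field_simp; ring, by field_simp; ring⟩
  exact ⟨h.1, h.2, hs⟩

theorem shearSystem_zero : c.ShearSystem 0 0 0 0 0 := by
  constructor <;> simp [tipT, tipR, f1, f2]

theorem F1_eq (hc : c.Admissible) (sh : ℝ) :
    c.F1 sh = ((3 * c.K + 4 * c.μ) * c.F2 sh - 2 * c.s0 / c.R) / c.denom := by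
  have hK := (K_pos hc).ne'
  rw [F1, F2]
  congr 2
  field_simp

theorem F3_eq (hc : c.Admissible) (hd : c.denom ≠ 0) (sh : ℝ) :
    c.F3 sh = c.R ^ 3 * (c.F1 sh - c.F2 sh) := by
  have hK := (K_pos hc).ne'
  rw [F3, F1, F2]
  congr 1
  rw [div_eq_iff hd, sub_mul, div_mul_cancel₀ _ hd, denom]
  field_simp
  ring

theorem hydro_coefficients (hc : c.Admissible) (hd : c.denom ≠ 0) (sh : ℝ) :
    CoefficientSystem c (c.F1 sh) (c.F2 sh) (c.F3 sh) 0 0 0 0 0 := by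
  have h := (radial_coefficients_iff hc hd).2 ⟨F1_eq hc sh, F3_eq hc hd sh⟩
  exact ⟨h.1, h.2, shearSystem_zero⟩

/-! ### The linear system for simple shear -/

/-- The homogeneous part of the linear system for simple shear. -/
def shearMap (c : Composite) : (ℝ × ℝ × ℝ × ℝ) →ₗ[ℝ] ℝ × ℝ × ℝ × ℝ where
  toFun p :=
    (c.tipT p.1 p.2.1 + 2 / c.R ^ 5 * p.2.2.1 - 2 / c.R ^ 3 * p.2.2.2,
      c.tipR p.1 p.2.1 - 3 / c.R ^ 5 * p.2.2.1
        - 1 / c.R ^ 3 * ((5 - 4 * c.ν) / (1 - 2 * c.ν)) * p.2.2.2,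
      c.μI / c.μ * (p.1 - c.R ^ 2 * ((7 + 2 * c.νI) / (1 - 2 * c.νI)) * p.2.1)
        - 6 * c.f1 p.1 p.2.1
        - 2 / c.R ^ 3 * (4 / c.R ^ 2 * p.2.2.1 + (1 + c.ν) / (1 - 2 * c.ν) * p.2.2.2),
      c.μI / c.μ * (p.1 + c.R ^ 2 * (3 * c.νI / (1 - 2 * c.νI)) * p.2.1)
        - 3 * c.f2 p.1 p.2.1
        - 2 / c.R ^ 3 * (-6 / c.R ^ 2 * p.2.2.1 + (c.ν - 5) / (1 - 2 * c.ν) * p.2.2.2))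
  map_add' p q := by
    simp only [Prod.fst_add, Prod.snd_add, Prod.mk_add_mk, Prod.mk.injEq, tipT, tipR, f1, f2]
    refine ⟨?_, ?_, ?_, ?_⟩ <;> ring
  map_smul' a p := by
    simp only [Prod.smul_fst, Prod.smul_snd, Prod.smul_mk, Prod.mk.injEq, tipT, tipR, f1, f2,
      smul_eq_mul, RingHom.id_apply]
    refine ⟨?_, ?_, ?_, ?_⟩ <;> ring

theorem shearSystem_iff {D1 : ℝ} {p : ℝ × ℝ × ℝ × ℝ} :
    c.ShearSystem D1 p.1 p.2.1 p.2.2.1 p.2.2.2 ↔ c.shearMap p = (D1, D1, D1, D1) := by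
  simp only [shearMap, LinearMap.coe_mk, AddHom.coe_mk, Prod.mk.injEq]
  constructor
  · rintro ⟨h1, h2, h3, h4⟩
    exact ⟨by linear_combination -h1, by linear_combination -h2, by linear_combination -h3,
      by linear_combination -h4⟩
  · rintro ⟨h1, h2, h3, h4⟩
    exact ⟨by linear_combination -h1, by linear_combination -h2, by linear_combination -h3,
      by linear_combination -h4⟩

/-- An injective endomorphism of a finite-dimensional space is bijective; the datum enters as the
constant vector (D₁, D₁, D₁, D₁). -/
theorem existsUnique_shearSystem (h : c.Nonsingular) (D1 : ℝ) :
    ∃! p : ℝ × ℝ × ℝ × ℝ, c.ShearSystem D1 p.1 p.2.1 p.2.2.1 p.2.2.2 := by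
  have hi : Function.Injective c.shearMap := by
    rw [← LinearMap.ker_eq_bot, LinearMap.ker_eq_bot']
    intro p hp
    obtain ⟨h1, h2, h3, h4⟩ := h _ _ _ _ (shearSystem_iff.2 hp)
    ext <;> assumption
  simp only [shearSystem_iff]
  exact Function.Bijective.existsUnique ⟨hi, LinearMap.injective_iff_surjective.1 hi⟩ _

theorem denom_pos (hc : c.Admissible) (hs : c.SurfaceNonneg) : 0 < c.denom := by
  have h1 := KI_pos hc
  have h2 := hc.μ_pos
  have h3 : 0 ≤ c.eta0 := div_nonneg hs.area hc.R_pos.le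
  rw [denom]
  positivity

/-- At θ = π/2, φ = π/4 the component u_φ is −U_θ. The radii R and R/2 separate the powers r and r³.
-/
theorem eq_zero_of_inhField_eq (hc : c.Admissible) {g A1 A2 : ℝ}
    (h : ∀ x : E3, ‖x‖ ≤ c.R → c.inhField g A1 A2 x = c.inhField g 0 0 x) :
    A1 = 0 ∧ A2 = 0 := by
  have hR := hc.R_pos
  have hU : ∀ r, 0 ≤ r → r ≤ c.R → c.UtInh A1 A2 r = 0 := fun r h0 hr => by
    have e1 := uP_inhField (c := c) g A1 A2 h0 (π / 2) (π / 4)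
    have e2 := uP_inhField (c := c) g 0 0 h0 (π / 2) (π / 4)
    rw [uP, h _ (by rwa [norm_smul_eR h0]), ← uP, e2] at e1
    rw [show 2 * (π / 4) = π / 2 by ring, sin_pi_div_two] at e1
    have e3 : c.UtInh 0 0 r = 0 := by simp [UtInh]
    linarith
  have e1 := hU c.R hR.le le_rfl
  have e2 := hU (c.R / 2) (by positivity) (by linarith)
  rw [UtInh] at e1 e2
  have hk : (7 - 4 * c.νI) / (1 - 2 * c.νI) ≠ 0 :=
    div_ne_zero (by linarith [hc.νI_lt]) hc.one_subI_ne
  have e3 : (7 - 4 * c.νI) / (1 - 2 * c.νI) * A2 * c.R ^ 3 = 0 := by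
    linear_combination (-4 / 3) * e1 + 8 / 3 * e2
  have e4 : A2 = 0 := by simpa [hk, hR.ne'] using e3
  refine ⟨?_, e4⟩
  rw [e4] at e1
  simpa [hR.ne'] using e1

/-- The same point of the sphere gives U_θ, and the radii R and 2R separate r⁻⁴ from r⁻². -/
theorem eq_zero_of_matField_eq (hc : c.Admissible) {f h D1 D3 D4 : ℝ}
    (hm : ∀ x : E3, c.R ≤ ‖x‖ → c.matField f h D1 D3 D4 x = c.matField f h D1 0 0 x) :
    D3 = 0 ∧ D4 = 0 := by
  have hR := hc.R_pos
  have hU : ∀ r, c.R ≤ r → UtMat D1 D3 D4 r = UtMat D1 0 0 r := fun r hr => by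
    have e1 := uP_matField (c := c) f h D1 D3 D4 (hR.trans_le hr) (π / 2) (π / 4)
    have e2 := uP_matField (c := c) f h D1 0 0 (hR.trans_le hr) (π / 2) (π / 4)
    rw [uP, hm _ (by rwa [norm_smul_eR (hR.le.trans hr)]), ← uP, e2] at e1
    rw [show 2 * (π / 4) = π / 2 by ring, sin_pi_div_two] at e1
    linarith
  have e1 := hU c.R le_rfl
  have e2 := hU (2 * c.R) (by linarith)
  rw [UtMat, UtMat] at e1 e2
  field_simp at e1 e2
  have e3 : D4 * c.R ^ 2 = 0 := by linarith
  have e4 : D4 = 0 := by simpa [hR.ne'] using e3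
  refine ⟨?_, e4⟩
  rw [e4] at e1
  linarith

/-- A solution of the homogeneous system and the zero solution yield two regular displacements with
the same radial term and zero far-field stress. They coincide by uniqueness, and so do their
coefficients; no determinant has to be computed. -/
theorem nonsingular (hc : c.Admissible) (hs : c.SurfaceNonneg) : c.Nonsingular := by
  intro A1 A2 D3 D4 h
  have hd := (denom_pos hc hs).ne'
  obtain ⟨e1, e2⟩ := solution_unique hc hs
    (isSolution_of_system hc (shear_coefficients hc hd h))
    (isSolution_of_system hc (shear_coefficients hc hd shearSystem_zero))
    (regularAtInfinity_matField hc _ _ _ _ _) (regularAtInfinity_matField hc _ _ _ _ _)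
  obtain ⟨h1, h2⟩ := eq_zero_of_inhField_eq hc e1
  obtain ⟨h3, h4⟩ := eq_zero_of_matField_eq hc e2
  exact ⟨h1, h2, h3, h4⟩

end Composite

/-! ### Radially symmetric solutions -/

theorem eq_of_closure {u v : E3 → E3} {U : Set E3} (h : ∀ y ∈ U, u y = v y) {x : E3}
    (hx : x ∈ closure U) (hu : ContinuousAt u x) (hv : ContinuousAt v x) : u x = v x := by
  have : (𝓝[U] x).NeBot := mem_closure_iff_nhdsWithin_neBot.1 hx
  refine tendsto_nhds_unique (l := 𝓝[U] x) (hu.tendsto.mono_left nhdsWithin_le_nhds)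
    ((hv.tendsto.mono_left nhdsWithin_le_nhds).congr' ?_)
  filter_upwards [self_mem_nhdsWithin] with y hy using (h y hy).symm

theorem eq_smul_of_radial {u : E3 → E3} {f : ℝ → ℝ} {x : E3} (hx : x ≠ 0)
    (hR : ∀ θ φ, uR u ‖x‖ θ φ = f ‖x‖) (hT : ∀ θ φ, uT u ‖x‖ θ φ = 0)
    (hP : ∀ θ φ, uP u ‖x‖ θ φ = 0) : u x = (f ‖x‖ / ‖x‖) • x := by
  have hn : ‖x‖ ≠ 0 := norm_ne_zero_iff.2 hx
  have e : u x = field (fun _ => 0) (fun _ => 0) (fun y => f ‖y‖ / ‖y‖) x := by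
    refine eq_of_components fun θ φ => ?_
    rw [hR, hT, hP, uR_field, uT_field, uP_field, norm_smul_eR (norm_nonneg x)]
    refine ⟨?_, ?_, ?_⟩
    · field_simp
      ring
    · ring
    · ring
  rw [e]
  ext i
  simp [field_apply]

theorem lame_add_pos {μ ν : ℝ} (hμ : 0 < μ) (h1 : -1 < ν) (h2 : ν < 1 / 2) :
    0 < lame μ ν + 2 * μ := by
  have hb := bulk_pos hμ h1 h2
  have h3 : 1 - 2 * ν ≠ 0 := by linarith
  have h4 : lame μ ν = bulk μ ν - 2 / 3 * μ := by
    rw [lame, bulk]; field_simp; ring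
  rw [h4]
  linarith

theorem smul_eR_two (t : ℝ) : (t • eR 0 0) 2 = t := by simp

theorem zero_mem_closure_ball {r : ℝ} (hr : 0 < r) :
    (0 : E3) ∈ closure {y : E3 | 0 < ‖y‖ ∧ ‖y‖ < r} := by
  have h1 : Tendsto (fun t : ℝ => t • eR 0 0) (𝓝[>] 0) (𝓝 (0 : E3)) := by
    have : ContinuousAt (fun t : ℝ => t • eR 0 0) 0 := by fun_prop
    simpa using this.tendsto.mono_left nhdsWithin_le_nhds
  refine mem_closure_of_tendsto h1 ?_
  filter_upwards [Ioo_mem_nhdsGT hr] with t ht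
  rw [norm_smul_eR ht.1.le]
  exact ht

namespace Composite

variable {c : Composite} {uI uM : E3 → E3}

theorem inhField_zero_apply (g : ℝ) (x : E3) : c.inhField g 0 0 x = g • x := by
  ext i
  simp [inhField, inhA, inhB, field_apply]

theorem matField_zero_apply (f h : ℝ) (x : E3) :
    c.matField f h 0 0 0 x = (f + h * (‖x‖ ^ 3)⁻¹) • x := by
  ext i
  simp [matField, matA, matB, matC, field_apply]

/-- The term b/r² of the general radial solution is incompatible with continuity at the centre:
along the polar axis t² u₃ = a t³ + b tends to b, but also to zero. -/
theorem eq_inhField_of_radial (hc : c.Admissible) {f : ℝ → ℝ}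
    (hs : ∀ x : E3, ‖x‖ ≤ c.R → ContDiffAt ℝ 2 uI x)
    (he : ∀ x : E3, ‖x‖ < c.R → EquilibriumAt c.μI c.νI uI x)
    (hk : ∀ x : E3, x ≠ 0 → ‖x‖ ≤ c.R → uI x = (f ‖x‖ / ‖x‖) • x) :
    ∃ g, ∀ x : E3, ‖x‖ ≤ c.R → uI x = c.inhField g 0 0 x := by
  have hR := hc.R_pos
  obtain ⟨a, b, hab⟩ := radial_equilibrium (I := Set.Ioo 0 c.R) isOpen_Ioo isPreconnected_Ioo
    (fun t ht => ht.1) (lame_add_pos hc.μI_pos hc.νI_gt hc.νI_lt).ne' (u := uI)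
    (k := fun t => f t / t) (fun x hx => hk x (norm_pos_iff.1 hx.1) hx.2.le)
    (fun x hx => hs x hx.2.le) fun x hx => he x hx.2
  have hcont : Tendsto (fun t : ℝ => t ^ 2 * uI (t • eR 0 0) 2) (𝓝[>] 0) (𝓝 0) := by
    have h0 : ContinuousAt uI ((0 : ℝ) • eR 0 0) := by
      rw [zero_smul]
      exact (hs 0 (by simpa using hR.le)).continuousAt
    have h1 : ContinuousAt (fun t : ℝ => uI (t • eR 0 0)) 0 :=
      ContinuousAt.comp (f := fun t : ℝ => t • eR 0 0) h0 (by fun_prop)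
    have h2 : ContinuousAt (fun t : ℝ => t ^ 2 * uI (t • eR 0 0) 2) 0 :=
      (continuousAt_id.pow 2).mul ((coordL 2).continuous.continuousAt.comp h1)
    simpa using h2.tendsto.mono_left (nhdsWithin_le_nhds (s := Set.Ioi 0))
  have hb : b = 0 := by
    have h1 : Tendsto (fun t : ℝ => a * t ^ 3 + b) (𝓝[>] 0) (𝓝 b) := by
      have : ContinuousAt (fun t : ℝ => a * t ^ 3 + b) 0 := by fun_prop
      simpa using this.tendsto.mono_left (nhdsWithin_le_nhds (s := Set.Ioi 0))
    refine tendsto_nhds_unique h1 (hcont.congr' ?_)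
    filter_upwards [Ioo_mem_nhdsGT hR] with t ht
    have t0 : t ≠ 0 := ht.1.ne'
    rw [hk _ (smul_eR_ne_zero ht.1 0 0) (by rw [norm_smul_eR ht.1.le]; exact ht.2.le),
      norm_smul_eR ht.1.le, PiLp.smul_apply, smul_eR_two, hab t ht, smul_eq_mul]
    field_simp
  have hin : ∀ x ∈ {y : E3 | 0 < ‖y‖ ∧ ‖y‖ < c.R}, uI x = c.inhField a 0 0 x := fun x hx => by
    rw [hk x (norm_pos_iff.1 hx.1) hx.2.le, inhField_zero_apply, hab _ hx, hb, zero_mul, add_zero]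
  refine ⟨a, fun x hx => ?_⟩
  have hcl : x ∈ closure {y : E3 | 0 < ‖y‖ ∧ ‖y‖ < c.R} := by
    rcases eq_or_ne x 0 with rfl | h0
    · exact zero_mem_closure_ball hR
    rcases hx.lt_or_eq with h | h
    · exact subset_closure ⟨norm_pos_iff.2 h0, h⟩
    · exact mem_closure_ball_of_norm_eq hR h
  exact eq_of_closure hin hcl (hs x hx).continuousAt
    (contDiff_inhField _ _ _).continuous.continuousAt

theorem eq_matField_of_radial (hc : c.Admissible) {g : ℝ → ℝ}
    (hs : ∀ x : E3, c.R ≤ ‖x‖ → ContDiffAt ℝ 2 uM x)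
    (he : ∀ x : E3, c.R < ‖x‖ → EquilibriumAt c.μ c.ν uM x)
    (hk : ∀ x : E3, c.R ≤ ‖x‖ → uM x = (g ‖x‖ / ‖x‖) • x) :
    ∃ f h, ∀ x : E3, c.R ≤ ‖x‖ → uM x = c.matField f h 0 0 0 x := by
  have hR := hc.R_pos
  obtain ⟨a, b, hab⟩ := radial_equilibrium (I := Set.Ioi c.R) isOpen_Ioi isPreconnected_Ioi
    (fun t ht => hR.trans ht) (lame_add_pos hc.μ_pos hc.ν_gt hc.ν_lt).ne' (u := uM)
    (k := fun t => g t / t) (fun x hx => hk x (le_of_lt hx))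
    (fun x hx => hs x (le_of_lt hx)) fun x hx => he x hx
  have hin : ∀ x ∈ {y : E3 | c.R < ‖y‖}, uM x = c.matField a b 0 0 0 x := fun x hx => by
    rw [hk x (le_of_lt hx), matField_zero_apply, hab _ hx]
  refine ⟨a, b, fun x hx => ?_⟩
  have hcl : x ∈ closure {y : E3 | c.R < ‖y‖} := by
    rcases hx.lt_or_eq with h | h
    · exact subset_closure h
    · exact mem_closure_exterior_of_norm_eq hR h.symm
  exact eq_of_closure hin hcl (hs x hx).continuousAt
    (contDiffAt_matField _ _ _ _ _ (norm_pos_iff.1 (hR.trans_le hx))).continuousAt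

/-! ### The solutions -/

theorem shear_form_of_isSolution (hc : c.Admissible) (hd : c.denom ≠ 0)
    {sd A0 A1 A2 D0 D1 D3 D4 : ℝ} (hs : c.IsSolution (shearStress sd) uI uM)
    (hf : c.HasShearForm (fun r => -(r * A0)) (fun r => -(1 / r ^ 2 * D0)) A1 A2 D1 D3 D4 uI uM) :
    D1 = sd / (2 * c.μ) ∧ A0 = 2 * c.s0 / c.R / c.denom ∧ D0 / c.R ^ 3 = A0 ∧
      c.ShearSystem D1 A1 A2 D3 D4 ∧ c.HasModifiedForm A1 A2 D1 D3 D4 uI uM := by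
  have hR := hc.R_pos.ne'
  have he := (hasShearForm_iff hc (g := -A0) (f := 0) (h := -D0) (fun r => by ring)
    fun r _ => by ring).1 hf
  obtain ⟨hsys, hS⟩ := system_of_isSolution hc hs he.1 he.2
  obtain ⟨h1, h2⟩ := (radial_coefficients_iff hc hd).1 ⟨hsys.cont, hsys.trac⟩
  have h3 : A0 = 2 * c.s0 / c.R / c.denom := by linear_combination -h1
  have h4 : D0 = c.R ^ 3 * A0 := by linear_combination -h2
  refine ⟨eq_of_farTensor_eq_shear hc hS, h3, by rw [h4]; field_simp, hsys.shear, ?_⟩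
  have h5 : c.A * c.s0 / c.R = -A0 := by rw [h3, A]; ring
  have h6 : c.A * c.s0 * c.R ^ 2 = -D0 := by
    rw [h4, ← neg_eq_iff_eq_neg.2 h5]
    field_simp
  rw [hasModifiedForm_iff hc, h5, h6]
  exact he

theorem isSolution_shear (hc : c.Admissible) (hd : c.denom ≠ 0) {sd A1 A2 D3 D4 : ℝ}
    (hs : c.ShearSystem (sd / (2 * c.μ)) A1 A2 D3 D4) :
    c.IsSolution (shearStress sd) (c.inhField (c.A * c.s0 / c.R) A1 A2)
      (c.matField 0 (c.A * c.s0 * c.R ^ 2) (sd / (2 * c.μ)) D3 D4) := by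
  rw [← farTensor_shear hc]
  exact isSolution_of_system hc (shear_coefficients hc hd hs)

theorem regularAtInfinity_shear (hc : c.Admissible) (sd h D3 D4 : ℝ) :
    c.RegularAtInfinity (shearStress sd) (c.matField 0 h (sd / (2 * c.μ)) D3 D4) := by
  rw [← farTensor_shear hc]
  exact regularAtInfinity_matField hc _ _ _ _ _

theorem hydrostatic_form_of_isSolution (hc : c.Admissible) (hd : c.denom ≠ 0) {sh : ℝ}
    {f g : ℝ → ℝ} (hs : c.IsSolution (hydroStress sh) uI uM) (hf : c.HasRadialForm f g uI uM) :
    c.HasHydrostaticForm sh uI uM := by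
  have hR := hc.R_pos
  obtain ⟨a, ha⟩ := eq_inhField_of_radial hc hs.smoothI hs.equilibriumI (f := f)
    fun x hx hxR => eq_smul_of_radial hx (fun _ _ => hf.inhR _ _ _ (norm_nonneg x) hxR)
      (fun _ _ => hf.inhT _ _ _ (norm_nonneg x) hxR) fun _ _ => hf.inhP _ _ _ (norm_nonneg x) hxR
  obtain ⟨a', b', hb⟩ := eq_matField_of_radial hc hs.smoothM hs.equilibriumM (g := g)
    fun x hxR => eq_smul_of_radial (norm_pos_iff.1 (hR.trans_le hxR))
      (fun _ _ => hf.matR _ _ _ hxR) (fun _ _ => hf.matT _ _ _ hxR) fun _ _ => hf.matP _ _ _ hxR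
  obtain ⟨hsys, hS⟩ := system_of_isSolution hc hs ha hb
  obtain ⟨h1, h2⟩ := (radial_coefficients_iff hc hd).1 ⟨hsys.cont, hsys.trac⟩
  have h3 := eq_of_farTensor_eq_hydro hc hS
  rw [h3, ← F1_eq hc] at h1
  rw [h1, h3, ← F3_eq hc hd] at h2
  rw [hasHydrostaticForm_iff hc, ← h1, ← h2, ← h3]
  exact ⟨ha, hb⟩

theorem isSolution_hydro (hc : c.Admissible) (hd : c.denom ≠ 0) (sh : ℝ) :
    c.IsSolution (hydroStress sh) (c.inhField (c.F1 sh) 0 0)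
      (c.matField (c.F2 sh) (c.F3 sh) 0 0 0) := by
  rw [← farTensor_hydro hc]
  exact isSolution_of_system hc (hydro_coefficients hc hd sh)

theorem regularAtInfinity_hydro (hc : c.Admissible) (sh : ℝ) :
    c.RegularAtInfinity (hydroStress sh) (c.matField (c.F2 sh) (c.F3 sh) 0 0 0) := by
  rw [← farTensor_hydro hc]
  exact regularAtInfinity_matField hc _ _ _ _ _

end Composite

end SphInh

end

/-! ### The five assertions assembled -/

theorem mainTheorem1 (c : SphInh.Composite) (hc : c.Admissible) :
    -- Simple shear: what the coefficients of a solution of the represented form must be.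
    (∀ sd : ℝ, c.denom ≠ 0 →
      ∀ (uI uM : SphInh.E3 → SphInh.E3) (A0 A1 A2 D0 D1 D3 D4 : ℝ),
        c.IsSolution (SphInh.shearStress sd) uI uM →
        c.HasShearForm (fun r => -(r * A0)) (fun r => -(1 / r ^ 2 * D0)) A1 A2 D1 D3 D4 uI uM →
        D1 = sd / (2 * c.μ) ∧ A0 = 2 * c.s0 / c.R / c.denom ∧ D0 / c.R ^ 3 = A0 ∧
          c.ShearSystem D1 A1 A2 D3 D4 ∧ c.HasModifiedForm A1 A2 D1 D3 D4 uI uM) ∧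
    -- Simple shear: such coefficients do give a solution.
    (∀ sd : ℝ, c.denom ≠ 0 →
      ∀ A1 A2 D3 D4 : ℝ, c.ShearSystem (sd / (2 * c.μ)) A1 A2 D3 D4 →
        ∃ uI uM : SphInh.E3 → SphInh.E3,
          c.IsSolution (SphInh.shearStress sd) uI uM ∧
          c.RegularAtInfinity (SphInh.shearStress sd) uM ∧
          c.HasModifiedForm A1 A2 (sd / (2 * c.μ)) D3 D4 uI uM) ∧
    -- Simple shear: the coefficients exist and are unique.
    (c.Nonsingular → ∀ sd : ℝ,
      ∃! p : ℝ × ℝ × ℝ × ℝ, c.ShearSystem (sd / (2 * c.μ)) p.1 p.2.1 p.2.2.1 p.2.2.2) ∧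
    -- Hydrostatic load: every radially symmetric solution has the stated form, and there is one.
    (∀ sh : ℝ, c.denom ≠ 0 →
      (∀ (uI uM : SphInh.E3 → SphInh.E3) (f g : ℝ → ℝ),
        c.IsSolution (SphInh.hydroStress sh) uI uM → c.HasRadialForm f g uI uM →
        c.HasHydrostaticForm sh uI uM) ∧
      ∃ uI uM : SphInh.E3 → SphInh.E3,
        c.IsSolution (SphInh.hydroStress sh) uI uM ∧
        c.RegularAtInfinity (SphInh.hydroStress sh) uM ∧
        c.HasHydrostaticForm sh uI uM) ∧
    -- With nonnegative surface energy these are the only solutions that are regular at infinity.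
    (c.SurfaceNonneg →
      0 < c.denom ∧ c.Nonsingular ∧
      (∀ sd : ℝ, ∃ A1 A2 D3 D4 : ℝ, c.ShearSystem (sd / (2 * c.μ)) A1 A2 D3 D4 ∧
        ∀ uI uM : SphInh.E3 → SphInh.E3,
          c.IsSolution (SphInh.shearStress sd) uI uM →
          c.RegularAtInfinity (SphInh.shearStress sd) uM →
          c.HasModifiedForm A1 A2 (sd / (2 * c.μ)) D3 D4 uI uM) ∧
      (∀ (sh : ℝ) (uI uM : SphInh.E3 → SphInh.E3),
        c.IsSolution (SphInh.hydroStress sh) uI uM →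
        c.RegularAtInfinity (SphInh.hydroStress sh) uM →
        c.HasHydrostaticForm sh uI uM)) := by
  refine ⟨fun sd hd uI uM A0 A1 A2 D0 D1 D3 D4 hs hf =>
      SphInh.Composite.shear_form_of_isSolution hc hd hs hf,
    fun sd hd A1 A2 D3 D4 hs => ⟨_, _, SphInh.Composite.isSolution_shear hc hd hs,
      SphInh.Composite.regularAtInfinity_shear hc _ _ _ _,
      (SphInh.Composite.hasModifiedForm_iff hc).2 ⟨fun _ _ => rfl, fun _ _ => rfl⟩⟩,
    fun hn sd => SphInh.Composite.existsUnique_shearSystem hn _,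
    fun sh hd => ⟨fun uI uM f g hs hf =>
        SphInh.Composite.hydrostatic_form_of_isSolution hc hd hs hf,
      _, _, SphInh.Composite.isSolution_hydro hc hd sh,
      SphInh.Composite.regularAtInfinity_hydro hc sh,
      (SphInh.Composite.hasHydrostaticForm_iff hc).2 ⟨fun _ _ => rfl, fun _ _ => rfl⟩⟩,
    fun hn => ?_⟩
  have hd := SphInh.Composite.denom_pos hc hn
  have hns := SphInh.Composite.nonsingular hc hn
  refine ⟨hd, hns, fun sd => ?_, fun sh uI uM hs hr => ?_⟩
  · obtain ⟨p, hp, -⟩ := SphInh.Composite.existsUnique_shearSystem hns (sd / (2 * c.μ))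
    refine ⟨_, _, _, _, hp, fun uI uM hs hr => ?_⟩
    exact (SphInh.Composite.hasModifiedForm_iff hc).2 <| SphInh.Composite.solution_unique hc hn hs
      (SphInh.Composite.isSolution_shear hc hd.ne' hp) hr
      (SphInh.Composite.regularAtInfinity_shear hc _ _ _ _)
  · exact (SphInh.Composite.hasHydrostaticForm_iff hc).2 <|
      SphInh.Composite.solution_unique hc hn hs (SphInh.Composite.isSolution_hydro hc hd.ne' sh) hr
      (SphInh.Composite.regularAtInfinity_hydro hc sh)
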